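/- **Definitions.** A *BY forest* (resp. *BY tree*) $T=(T,S,\epsilon F)$ consists of a finite forest (resp. tree) $T$ whose edges $e$ have positive integer lengths $l(e)$, a subgraph $S\subseteq T$, a length-preserving graph automorphism $F$ of $T$ with $F(S)=S$, and a sign function $\epsilon\colon\pi_0(T\setminus S)\to\{\pm1\}$ on the connected components of the topological complement. Let $\Lambda_T=\mathrm H_1(T,S;\mathbb Z)$ be the relative homology lattice with its intersection length pairing ($\langle\gamma,\gamma'\rangle$ is the sum over the edges $e\not\subseteq S$ of $l(e)$ times the product of the multiplicities of $e$ in $\gamma$ and $\gamma'$). The signed automorphism $\epsilon F$ acts isometrically on $\Lambda_T$, sending a path $\gamma$ in the closure of a component $C$ of $T\setminus S$ to $\epsilon(C)[F\gamma]$, and hence acts on $\Lambda_T^\vee/\Lambda_T$, where $\Lambda_T\hookrightarrow\Lambda_T^\vee=\mathrm{Hom}(\Lambda_T,\mathbb Z)$ via the pairing. The *Tamagawa number* of $T$ is $c_T=\#(\Lambda_T^\vee/\Lambda_T)^{\epsilon F}$. A BY tree is *simple* if $S$ is non-empty and has no edges, and $T\setminus S$ has exactly one component (so $S$ is a non-empty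 set of degree $1$ vertices); it is then *negative* if the sign of this component is $-1$. The parity conditions are: * (A) if two vertices of $T$ lie an odd distance apart, then at least one of them is either a degree $1$ vertex in $S$ whose incident edge is not in $S$, or a degree $2$ vertex not in $S$, or a degree $2$ vertex in $S$ both of whose incident edges are in $S$; * (B) no iterate of $F$ inverts an edge of odd length. If $T$ satisfies (B), let $\widehat T$ be $(T,S,F)$ with every edge that is inverted by some iterate of $F$ (such edges have even length) subdivided at its midpoint into two edges of half the length; so $\widehat T=T$ if no iterate of $F$ inverts an edge. **Theorem.** Let $T=(T,S,-F)$ be a negative simple BY tree satisfying (A) and (B). (1) Suppose that $T$ is not a path, i.e. that it has a vertex of degree $\geq3$. Write $S=S_0\sqcup S_1$, where $S_0$ (resp. $S_1$) consists of the points in even-sized (resp. odd-sized) $F$-orbits, and write $S_1/\langle F\rangle=A_0\sqcup A_1$, where $A_1$ consists of the orbits of those points of $S_1$ whose distance to the nearest vertex of degree $\geq3$ is odd. Contract every edge of $\widehat T$ that lies in an odd-size $F$-orbit (of unoriented edges). The result is a tree on which the automorphism induced by $F$ has a unique fixed point $*$, and $*$ is a vertex. Let $T'$ be this tree, with its induced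 automorphism, with the image of $S_0$ together with $*$ as its marked subgraph, and with sign $+1$ on every component of the complement. Then $T'$ is a BY tree satisfying (B), and \[c_T=\tilde c_1\,c_{T'},\qquad \tilde c_1=\begin{cases}2^{\#A_0-1}&\text{if }\#A_0\geq1,\\2&\text{if }\#A_0=0\text{ and }\#S\text{ is even},\\1&\text{if }\#A_0=0\text{ and }\#S\text{ is odd}.\end{cases}\] (2) If $\#S=1$, then $c_T=1$. (3) If $T$ is a path of length $l$ connecting two points of $S$, then \[c_T=\begin{cases}2&\text{if $l$ is even and $T$ is pointwise fixed by $F$},\\1&\text{if $l$ is odd and $T$ is pointwise fixed by $F$},\\l&\text{if $T$ is reversed by $F$}.\end{cases}\] -/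

import Mathlib

/-- The orbit `{a, f a, f (f a), …}`; for a bijection `f` of a finite set this is the orbit of `a`
under the group generated by `f`. -/
def iterOrbit {α : Type*} (f : α → α) (a : α) : Set α := Set.range fun n : ℕ => f^[n] a

/-- A graph `T` with positive integral edge lengths, a subgraph `S`, and an isometric graph
automorphism `F` of `T` fixing `S` setwise. (The sign function is added in `BYGraph`.) -/
structure BYPair (V : Type*) where
  graph : SimpleGraph V
  len : Sym2 V → ℕ
  len_pos : ∀ e ∈ graph.edgeSet, 0 < len e
  S : graph.Subgraph
  F : graph ≃g graph
  len_F : ∀ e ∈ graph.edgeSet, len (e.map F) = len e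
  verts_F : ∀ v, F v ∈ S.verts ↔ v ∈ S.verts
  adj_F : ∀ u v, S.Adj (F u) (F v) ↔ S.Adj u v

namespace BYPair

variable {V : Type*} (X : BYPair V)

/-- The vertices and open edges making up the topological complement `T ∖ S`. -/
abbrev Cell : Type _ :=
  {v : V // v ∉ X.S.verts} ⊕ {e : Sym2 V // e ∈ X.graph.edgeSet \ X.S.edgeSet}

/-- Incidence between the vertices and the open edges of `T ∖ S`. -/
def incidence : SimpleGraph X.Cell where
  Adj a b := match a, b with
    | .inl v, .inr e => v.1 ∈ e.1
    | .inr e, .inl v => v.1 ∈ e.1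
    | _, _ => False
  symm := ⟨by rintro (a | a) (b | b) h <;> exact h⟩
  loopless := ⟨by rintro (a | a) h <;> exact h⟩

/-- The set of connected components of the topological space `T ∖ S`. -/
abbrev Pi0 : Type _ := X.incidence.ConnectedComponent

/-- The degree of a vertex of `T`. -/
noncomputable def deg (v : V) : ℕ := (X.graph.neighborSet v).ncard

/-- The length of a walk: the sum of the lengths of its edges. -/
def walkLen {u v : V} (p : X.graph.Walk u v) : ℕ := (p.edges.map X.len).sum

/-- The path metric on the vertices of `T` (with value `0` for vertices in different components). -/
noncomputable def dist (u v : V) : ℕ :=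
  sInf {n | ∃ p : X.graph.Walk u v, X.walkLen p = n}

/-- Parity condition (A). -/
def ParityA : Prop :=
  ∀ u v, Odd (X.dist u v) → ∃ w, (w = u ∨ w = v) ∧
    ((X.deg w = 1 ∧ w ∈ X.S.verts ∧ ∀ z, X.graph.Adj w z → ¬ X.S.Adj w z) ∨
     (X.deg w = 2 ∧ w ∉ X.S.verts) ∨
     (X.deg w = 2 ∧ w ∈ X.S.verts ∧ ∀ z, X.graph.Adj w z → X.S.Adj w z))

/-- Some iterate of `F` inverts the edge `e`. -/
def IsInverted (e : Sym2 V) : Prop :=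
  e ∈ X.graph.edgeSet ∧ ∃ (n : ℕ) (u v : V), e = s(u, v) ∧ X.F^[n] u = v ∧ X.F^[n] v = u

/-- Parity condition (B): no iterate of `F` inverts any edge of odd length. -/
def ParityB : Prop := ∀ e, X.IsInverted e → ¬ Odd (X.len e)

/-- The set `S` consists of vertices only, is non-empty, and `T ∖ S` has exactly one component. -/
def IsSimple : Prop :=
  (∀ u v, ¬ X.S.Adj u v) ∧ X.S.verts.Nonempty ∧ Nat.card X.Pi0 = 1

/-- `v` lies in an `F`-orbit of odd size. -/
def OddVertex (v : V) : Prop := Odd (iterOrbit X.F v).ncard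

/-- `e` lies in an `F`-orbit (of unoriented edges) of odd size. -/
def OddEdge (e : Sym2 V) : Prop := Odd (iterOrbit (Sym2.map X.F) e).ncard

/-- `v` is at the end of an odd-length twig: the distance from `v` to the nearest vertex of degree
at least `3` is odd. -/
def OddTwig (v : V) : Prop := Odd (sInf {n | ∃ w, 3 ≤ X.deg w ∧ X.dist v w = n})

/-- The set `A₀` of odd-size orbits of points of `S` that are not at the end of an odd-length
twig. -/
def A0 : Set (Set V) :=
  {o | ∃ s ∈ X.S.verts, X.OddVertex s ∧ ¬ X.OddTwig s ∧ o = iterOrbit X.F s}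

open Classical in
/-- The power of two `c̃₁`. -/
noncomputable def c1 : ℕ :=
  if 1 ≤ X.A0.ncard then 2 ^ (X.A0.ncard - 1)
  else if Even X.S.verts.ncard then 2 else 1

/-- `F` has exactly one fixed point on the topological space `T`, and this point is a vertex (a
fixed point in the interior of an edge would force `F` to stabilise that edge). -/
def HasUniqueFixedPoint : Prop :=
  (∃! v, X.F v = v) ∧ ∀ e ∈ X.graph.edgeSet, e.map X.F ≠ e

/-! ### Subdividing the inverted edges -/

/-- The edges of even length that are inverted by some iterate of `F` (under (B), every inverted
edge has even length). -/
abbrev Mid : Type _ := {e : Sym2 V // X.IsInverted e ∧ Even (X.len e)}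

variable {X} in
theorem isInverted_map_F {e : Sym2 V} (h : X.IsInverted e) : X.IsInverted (e.map X.F) := by
  obtain ⟨he, n, u, v, rfl, h1, h2⟩ := h
  refine ⟨X.F.map_adj_iff.2 he, n, X.F u, X.F v, rfl, ?_, ?_⟩
  · rw [← Function.iterate_succ_apply, Function.iterate_succ_apply', h1]
  · rw [← Function.iterate_succ_apply, Function.iterate_succ_apply', h2]

theorem map_symm_F (e : Sym2 V) : (e.map X.F.symm).map X.F = e := by
  induction e with | _ u v => simp

theorem map_F_symm (e : Sym2 V) : (e.map X.F).map X.F.symm = e := by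
  induction e with | _ u v => simp

theorem iterate_symm {n : ℕ} {u v : V} (h : X.F^[n] u = v) :
    X.F^[n] (X.F.symm u) = X.F.symm v := by
  apply X.F.injective
  rw [← Function.iterate_succ_apply' (⇑X.F), Function.iterate_succ_apply]
  simpa using h

variable {X} in
theorem isInverted_map_symm {e : Sym2 V} (h : X.IsInverted e) :
    X.IsInverted (e.map X.F.symm) := by
  obtain ⟨he, n, u, v, rfl, h1, h2⟩ := h
  exact ⟨X.F.symm.map_adj_iff.2 he, n, X.F.symm u, X.F.symm v, rfl,
    X.iterate_symm h1, X.iterate_symm h2⟩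

/-- The action of `F` on the midpoints of inverted edges. -/
def midF : X.Mid ≃ X.Mid where
  toFun e := ⟨e.1.map X.F, isInverted_map_F e.2.1, by rw [X.len_F _ e.2.1.1]; exact e.2.2⟩
  invFun e := ⟨e.1.map X.F.symm, isInverted_map_symm e.2.1, by
    rw [← X.len_F _ (isInverted_map_symm e.2.1).1, X.map_symm_F]; exact e.2.2⟩
  left_inv e := Subtype.ext (X.map_F_symm e.1)
  right_inv e := Subtype.ext (X.map_symm_F e.1)

theorem isMid_map_iff (e : Sym2 V) :
    (X.IsInverted (e.map X.F) ∧ Even (X.len (e.map X.F))) ↔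
      (X.IsInverted e ∧ Even (X.len e)) := by
  constructor
  · rintro ⟨h, h'⟩
    have h1 := isInverted_map_symm h
    rw [X.map_F_symm] at h1
    exact ⟨h1, by rwa [X.len_F _ h1.1] at h'⟩
  · rintro ⟨h, h'⟩
    exact ⟨isInverted_map_F h, by rwa [X.len_F _ h.1]⟩

theorem mem_edge_map_iff (u : V) (e : Sym2 V) : X.F u ∈ e.map X.F ↔ u ∈ e := by
  rw [Sym2.mem_map]
  constructor
  · rintro ⟨a, ha, h⟩; rwa [← X.F.injective h]
  · intro h; exact ⟨u, h, rfl⟩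

theorem edge_map_iff (e : Sym2 V) : e.map X.F ∈ X.S.edgeSet ↔ e ∈ X.S.edgeSet := by
  induction e with | _ u v => exact X.adj_F u v

/-- Subdivide at its midpoint every even-length edge that is inverted by an iterate of `F`: the
edge `e = {u, v}` becomes two edges `{u, e}` and `{v, e}` of length `len e / 2`. Everything else,
and the underlying metric space, is unchanged. -/
def subdivide : BYPair (V ⊕ X.Mid) where
  graph :=
    { Adj := fun a b => match a, b with
        | .inl u, .inl v => X.graph.Adj u v ∧ ¬ (X.IsInverted s(u, v) ∧ Even (X.len s(u, v)))
        | .inl u, .inr e => u ∈ e.1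
        | .inr e, .inl u => u ∈ e.1
        | .inr _, .inr _ => False
      symm := ⟨by
        rintro (a | a) (b | b) h
        · exact ⟨h.1.symm, by rw [Sym2.eq_swap]; exact h.2⟩
        all_goals exact h⟩
      loopless := ⟨by
        rintro (a | a) h
        · exact h.1.ne rfl
        · exact h⟩ }
  len := Sym2.lift ⟨fun a b => match a, b with
    | .inl u, .inl v => X.len s(u, v)
    | .inl _, .inr e => X.len e.1 / 2
    | .inr e, .inl _ => X.len e.1 / 2
    | .inr _, .inr _ => 0, by
      rintro (a | a) (b | b)
      · exact congrArg X.len Sym2.eq_swap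
      all_goals rfl⟩
  len_pos e he := by
    have key : ∀ e : X.Mid, 0 < X.len e.1 / 2 := fun e => by
      have h1 := X.len_pos _ e.2.1.1
      obtain ⟨k, hk⟩ := e.2.2
      omega
    induction e with | _ a b =>
    rcases a with a | a <;> rcases b with b | b
    · exact X.len_pos _ he.1
    · exact key b
    · exact key a
    · exact he.elim
  S :=
    { verts := {a | match a with
        | .inl u => u ∈ X.S.verts
        | .inr e => e.1 ∈ X.S.edgeSet}
      Adj := fun a b => match a, b with
        | .inl u, .inl v => X.S.Adj u v ∧ ¬ (X.IsInverted s(u, v) ∧ Even (X.len s(u, v)))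
        | .inl u, .inr e => u ∈ e.1 ∧ e.1 ∈ X.S.edgeSet
        | .inr e, .inl u => u ∈ e.1 ∧ e.1 ∈ X.S.edgeSet
        | .inr _, .inr _ => False
      adj_sub := by
        rintro (a | a) (b | b) h
        · exact ⟨X.S.adj_sub h.1, h.2⟩
        · exact h.1
        · exact h.1
        · exact h
      edge_vert := by
        rintro (a | a) (b | b) h
        · exact X.S.edge_vert h.1
        · exact X.S.mem_verts_of_mem_edge h.2 h.1
        · exact h.2
        · exact h.elim
      symm := ⟨by
        rintro (a | a) (b | b) h
        · exact ⟨h.1.symm, by rw [Sym2.eq_swap]; exact h.2⟩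
        all_goals exact h⟩ }
  F :=
    { toEquiv := Equiv.sumCongr X.F.toEquiv X.midF
      map_rel_iff' := by
        rintro (a | a) (b | b)
        · exact and_congr X.F.map_adj_iff (not_congr (X.isMid_map_iff s(a, b)))
        · exact X.mem_edge_map_iff a b.1
        · exact X.mem_edge_map_iff b a.1
        · exact Iff.rfl }
  len_F e he := by
    induction e with | _ a b =>
    rcases a with a | a <;> rcases b with b | b
    · exact X.len_F s(a, b) he.1
    · exact congrArg (· / 2) (X.len_F b.1 b.2.1.1)
    · exact congrArg (· / 2) (X.len_F a.1 a.2.1.1)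
    · exact he.elim
  verts_F := by
    rintro (a | a)
    · exact X.verts_F a
    · exact X.edge_map_iff a.1
  adj_F := by
    rintro (a | a) (b | b)
    · exact and_congr (X.adj_F a b) (not_congr (X.isMid_map_iff s(a, b)))
    · exact and_congr (X.mem_edge_map_iff a b.1) (X.edge_map_iff b.1)
    · exact and_congr (X.mem_edge_map_iff b a.1) (X.edge_map_iff a.1)
    · exact Iff.rfl

/-! ### Contracting the edges in odd-size orbits -/

/-- The spanning subgraph of the edges in odd-size `F`-orbits. -/
def oddPart : SimpleGraph V where
  Adj u v := X.graph.Adj u v ∧ X.OddEdge s(u, v)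
  symm := ⟨fun u v h => ⟨h.1.symm, by rw [Sym2.eq_swap]; exact h.2⟩⟩
  loopless := ⟨fun _ h => h.1.ne rfl⟩

theorem oddEdge_map_iff (e : Sym2 V) : X.OddEdge (e.map X.F) ↔ X.OddEdge e := by
  have h : iterOrbit (Sym2.map X.F) (e.map X.F) = Sym2.map X.F '' iterOrbit (Sym2.map X.F) e := by
    unfold iterOrbit
    rw [← Set.range_comp]
    congr 1
    ext1 n
    simp only [Function.comp]
    rw [← Function.iterate_succ_apply' (Sym2.map X.F), Function.iterate_succ_apply]
  unfold OddEdge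
  rw [h, Set.ncard_image_of_injective _ (Sym2.map.injective X.F.injective)]

/-- The automorphism of `oddPart` induced by `F`. -/
def oddF : X.oddPart ≃g X.oddPart where
  toEquiv := X.F.toEquiv
  map_rel_iff' {u v} := and_congr X.F.map_adj_iff (X.oddEdge_map_iff s(u, v))

/-- The vertices of the graph obtained by contracting all edges in odd-size orbits. -/
abbrev CVert : Type _ := X.oddPart.ConnectedComponent

/-- The image of a vertex in the contracted graph. -/
abbrev toC (v : V) : X.CVert := X.oddPart.connectedComponentMk v

/-- The permutation of the vertices of the contracted graph induced by `F`. -/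
def cF : X.CVert ≃ X.CVert := X.oddF.connectedComponentEquiv

theorem cF_toC (v : V) : X.cF (X.toC v) = X.toC (X.F v) := rfl

theorem cF_map_toC (e : Sym2 V) : (e.map X.toC).map X.cF = (e.map X.F).map X.toC := by
  simp only [Sym2.map_map]; rfl

theorem map_F_mem (e : Sym2 V) : e.map X.F ∈ X.graph.edgeSet ↔ e ∈ X.graph.edgeSet := by
  induction e with | _ u v => exact X.F.map_adj_iff

end BYPair

/-- The data of a BY forest: `(T, S, F)` together with a sign for each component of `T ∖ S`. It
is a BY forest when `graph` is acyclic, and a BY tree when `graph` is a tree. -/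
structure BYGraph (V : Type*) extends BYPair V where
  sign : toBYPair.Pi0 → ℤˣ

namespace BYPair

variable {V : Type*} (X : BYPair V)

/-- The BY forest `T'`: contract all edges in odd-size `F`-orbits; as marked set take the image of
those points of `S` in even-size `F`-orbits together with the vertices fixed by `F`; declare all
signs to be `+1`. When `T` is a tree, distinct vertices `a`, `b` of the contracted graph are joined
by at most one edge of `T`, and this has the same length in the contracted graph. -/
noncomputable def prime : BYGraph X.CVert where
  graph :=
    { Adj := fun a b => a ≠ b ∧ ∃ u v, X.graph.Adj u v ∧ X.toC u = a ∧ X.toC v = b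
      symm := ⟨by rintro a b ⟨h, u, v, h1, h2, h3⟩; exact ⟨h.symm, v, u, h1.symm, h3, h2⟩⟩
      loopless := ⟨fun _ h => h.1 rfl⟩ }
  len e' := sInf {n | ∃ e ∈ X.graph.edgeSet, e.map X.toC = e' ∧ X.len e = n}
  len_pos e' he' := by
    have hne : {n | ∃ e ∈ X.graph.edgeSet, e.map X.toC = e' ∧ X.len e = n}.Nonempty := by
      induction e' with | _ a b =>
      obtain ⟨-, u, v, h1, rfl, rfl⟩ := he'
      exact ⟨_, s(u, v), h1, rfl, rfl⟩
    obtain ⟨e, h1, -, h3⟩ := Nat.sInf_mem hne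
    rw [← h3]
    exact X.len_pos e h1
  S :=
    { verts := {a | ∃ s ∈ X.S.verts, ¬ X.OddVertex s ∧ X.toC s = a} ∪ {a | X.cF a = a}
      Adj := fun _ _ => False
      adj_sub := False.elim
      edge_vert := False.elim
      symm := ⟨fun _ _ h => h⟩ }
  F :=
    { toEquiv := X.cF
      map_rel_iff' := by
        intro a b
        refine and_congr (X.cF.injective.ne_iff) ⟨?_, ?_⟩
        · rintro ⟨u, v, h1, h2, h3⟩
          refine ⟨X.F.symm u, X.F.symm v, X.F.symm.map_adj_iff.2 h1, ?_, ?_⟩ <;>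
          · apply X.cF.injective
            rw [cF_toC]
            simpa
        · rintro ⟨u, v, h1, rfl, rfl⟩
          exact ⟨X.F u, X.F v, X.F.map_adj_iff.2 h1, rfl, rfl⟩ }
  len_F e' _ := by
    congr 1
    ext n
    constructor
    · rintro ⟨e, h1, h2, h3⟩
      have h4 : e.map X.F.symm ∈ X.graph.edgeSet := by
        rw [← X.map_F_mem, X.map_symm_F]; exact h1
      refine ⟨e.map X.F.symm, h4, ?_, ?_⟩
      · apply Sym2.map.injective X.cF.injective
        rw [X.cF_map_toC, X.map_symm_F]
        exact h2
      · rw [← X.len_F _ h4, X.map_symm_F]; exact h3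
    · rintro ⟨e, h1, rfl, h3⟩
      exact ⟨e.map X.F, (X.map_F_mem e).2 h1, (X.cF_map_toC e).symm, by rw [X.len_F e h1, h3]⟩
  verts_F a := by
    have horb : ∀ s, X.OddVertex (X.F s) ↔ X.OddVertex s := fun s => by
      have h : iterOrbit X.F (X.F s) = X.F '' iterOrbit X.F s := by
        unfold iterOrbit
        rw [← Set.range_comp]
        congr 1
        ext1 n
        simp only [Function.comp]
        rw [← Function.iterate_succ_apply' (⇑X.F), Function.iterate_succ_apply]
      unfold OddVertex
      rw [h, Set.ncard_image_of_injective _ X.F.injective]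
    refine or_congr ⟨?_, ?_⟩ X.cF.injective.eq_iff
    · rintro ⟨s, h1, h2, h3⟩
      refine ⟨X.F.symm s, ?_, ?_, ?_⟩
      · rw [← X.verts_F]; simpa
      · rw [← horb]; simpa
      · apply X.cF.injective
        rw [cF_toC]
        simpa using h3
    · rintro ⟨s, h1, h2, rfl⟩
      exact ⟨X.F s, (X.verts_F s).2 h1, by rwa [horb], rfl⟩
  adj_F _ _ := Iff.rfl
  sign _ := 1

end BYPair

namespace BYGraph

variable {V : Type*} (T : BYGraph V)

open Classical in
/-- The sign of the component of `T ∖ S` containing the open edge `e` (and `1` by convention if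
`e` is not an edge of `T` outside `S`). -/
noncomputable def edgeSign (e : Sym2 V) : ℤ :=
  if h : e ∈ T.graph.edgeSet \ T.S.edgeSet then
    ((T.sign (T.incidence.connectedComponentMk (.inr ⟨e, h⟩)) : ℤˣ) : ℤ)
  else 1

theorem edgeSign_mul_self (e : Sym2 V) : T.edgeSign e * T.edgeSign e = 1 := by
  unfold edgeSign
  split_ifs with h
  · rw [← Units.val_mul, Int.units_mul_self, Units.val_one]
  · rfl

open Classical in
/-- The sign of the component of `T ∖ S` containing the vertex `v` (`1` if `v ∈ S`). -/
noncomputable def vertSign (v : V) : ℤ :=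
  if h : v ∉ T.S.verts then
    ((T.sign (T.incidence.connectedComponentMk (.inl ⟨v, h⟩)) : ℤˣ) : ℤ)
  else 1

theorem edgeSign_eq_vertSign {u v : V} (hv : v ∉ T.S.verts)
    (h : T.graph.Adj u v ∧ ¬ T.S.Adj u v) : T.edgeSign s(u, v) = T.vertSign v := by
  have h' : s(u, v) ∈ T.graph.edgeSet \ T.S.edgeSet := h
  unfold edgeSign vertSign
  rw [dif_pos h', dif_pos hv]
  congr 2
  rw [SimpleGraph.ConnectedComponent.eq]
  exact SimpleGraph.Adj.reachable (show v ∈ s(u, v) from Sym2.mem_mk_right u v)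

theorem sAdj_symm_iff (u v : V) :
    (T.graph.Adj (T.F.symm u) (T.F.symm v) ∧ ¬ T.S.Adj (T.F.symm u) (T.F.symm v)) ↔
      (T.graph.Adj u v ∧ ¬ T.S.Adj u v) := by
  refine and_congr T.F.symm.map_adj_iff (not_congr ?_)
  rw [← T.adj_F]; simp

variable [Finite V]

/-- The relative homology lattice `Λ_T = H₁(T, S; ℤ)`. A relative `1`-chain is an antisymmetric
function `c` on ordered pairs of vertices supported on the edges of `T` not in `S` (`c u v` is the
coefficient of the edge oriented from `u` to `v`). There are no `2`-cells, so `H₁` is the group of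
relative cycles, that is of those chains whose boundary vanishes at every vertex outside `S`. -/
noncomputable def lattice : Submodule ℤ (V → V → ℤ) where
  carrier := {c | (∀ u v, c u v = -c v u) ∧
    (∀ u v, ¬ (T.graph.Adj u v ∧ ¬ T.S.Adj u v) → c u v = 0) ∧
    ∀ v, v ∉ T.S.verts → ∑ᶠ u, c u v = 0}
  zero_mem' := ⟨fun _ _ => by simp, fun _ _ _ => rfl, fun _ _ => by simp⟩
  add_mem' {a b} ha hb := by
    refine ⟨fun u v => ?_, fun u v h => ?_, fun v h => ?_⟩
    · simp only [Pi.add_apply]; rw [ha.1 u v, hb.1 u v]; ring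
    · simp only [Pi.add_apply]; rw [ha.2.1 u v h, hb.2.1 u v h]; rfl
    · simp only [Pi.add_apply]
      rw [finsum_add_distrib (Set.toFinite _) (Set.toFinite _), ha.2.2 v h, hb.2.2 v h]; rfl
  smul_mem' k a ha := by
    refine ⟨fun u v => ?_, fun u v h => ?_, fun v h => ?_⟩
    · simp only [Pi.smul_apply]; rw [ha.1 u v]; simp
    · simp only [Pi.smul_apply]; rw [ha.2.1 u v h]; simp
    · simp only [Pi.smul_apply]
      rw [← smul_finsum, ha.2.2 v h, smul_zero]

/-- The product of the coefficients of an edge in two relative cycles; it does not depend on the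
orientation of the edge. -/
def edgeProd (a b : T.lattice) : Sym2 V → ℤ :=
  Sym2.lift ⟨fun u v => a.1 u v * b.1 u v, fun u v => by
    dsimp only
    rw [a.2.1 u v, b.2.1 u v]; ring⟩

/-- The intersection length pairing `⟨a, b⟩ = ∑_e l(e) a(e) b(e)`, as a map `Λ_T → Λ_T^∨`. -/
noncomputable def pairing : T.lattice →ₗ[ℤ] Module.Dual ℤ T.lattice :=
  LinearMap.mk₂ ℤ (fun a b => ∑ᶠ e : Sym2 V, (T.len e : ℤ) * T.edgeProd a b e)
    (fun a a' b => by
      rw [← finsum_add_distrib (Set.toFinite _) (Set.toFinite _)]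
      refine finsum_congr fun e => ?_
      induction e with | _ u v =>
      simp [edgeProd]; ring)
    (fun k a b => by
      rw [smul_finsum]
      refine finsum_congr fun e => ?_
      induction e with | _ u v =>
      simp [edgeProd]; ring)
    (fun a b b' => by
      rw [← finsum_add_distrib (Set.toFinite _) (Set.toFinite _)]
      refine finsum_congr fun e => ?_
      induction e with | _ u v =>
      simp [edgeProd]; ring)
    (fun k a b => by
      rw [smul_finsum]
      refine finsum_congr fun e => ?_
      induction e with | _ u v =>
      simp [edgeProd]; ring)

theorem pairing_apply (a b : T.lattice) :
    T.pairing a b = ∑ᶠ e : Sym2 V, (T.len e : ℤ) * T.edgeProd a b e := rfl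

/-- The action of the signed automorphism `εF` on `Λ_T`: an oriented edge `e` in the component `C`
of `T ∖ S` is sent to `ε(C) F(e)`. -/
noncomputable def act : T.lattice ≃ₗ[ℤ] T.lattice where
  toFun c := ⟨fun u v => T.edgeSign s(T.F.symm u, T.F.symm v) * c.1 (T.F.symm u) (T.F.symm v), by
    refine ⟨fun u v => ?_, fun u v h => ?_, fun v h => ?_⟩
    · dsimp only
      rw [Sym2.eq_swap, c.2.1 (T.F.symm u)]; ring
    · dsimp only
      rw [c.2.2.1 _ _ (mt (T.sAdj_symm_iff u v).1 h), mul_zero]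
    · have hv : T.F.symm v ∉ T.S.verts := by rw [← T.verts_F]; simpa using h
      have h1 : ∀ u, T.edgeSign s(T.F.symm u, T.F.symm v) * c.1 (T.F.symm u) (T.F.symm v) =
          T.vertSign (T.F.symm v) • c.1 (T.F.symm u) (T.F.symm v) := fun u => by
        by_cases hu : T.graph.Adj (T.F.symm u) (T.F.symm v) ∧ ¬ T.S.Adj (T.F.symm u) (T.F.symm v)
        · rw [T.edgeSign_eq_vertSign hv hu]; rfl
        · rw [c.2.2.1 _ _ hu]; simp
      have h2 := finsum_comp_equiv T.F.symm.toEquiv (f := fun u => c.1 u (T.F.symm v))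
      rw [finsum_congr h1, ← smul_finsum]
      exact (congrArg _ (h2.trans (c.2.2.2 _ hv))).trans (smul_zero _)⟩
  map_add' a b := by ext u v; simp [mul_add]
  map_smul' k a := by ext u v; simp; ring
  invFun c := ⟨fun u v => T.edgeSign s(u, v) * c.1 (T.F u) (T.F v), by
    refine ⟨fun u v => ?_, fun u v h => ?_, fun v h => ?_⟩
    · dsimp only
      rw [Sym2.eq_swap, c.2.1 (T.F u)]; ring
    · dsimp only
      rw [c.2.2.1 _ _ (by rw [← T.sAdj_symm_iff]; simpa using h), mul_zero]
    · have h1 : ∀ u, T.edgeSign s(u, v) * c.1 (T.F u) (T.F v) =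
          T.vertSign v • c.1 (T.F u) (T.F v) := fun u => by
        by_cases hu : T.graph.Adj u v ∧ ¬ T.S.Adj u v
        · rw [T.edgeSign_eq_vertSign h hu]; rfl
        · rw [c.2.2.1 _ _ (by rw [← T.sAdj_symm_iff]; simpa using hu)]; simp
      have h2 := finsum_comp_equiv T.F.toEquiv (f := fun u => c.1 u (T.F v))
      rw [finsum_congr h1, ← smul_finsum]
      exact (congrArg _ (h2.trans (c.2.2.2 _ (by rwa [T.verts_F])))).trans (smul_zero _)⟩
  left_inv c := by
    ext u v
    simp [← mul_assoc, T.edgeSign_mul_self]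
  right_inv c := by
    ext u v
    simp [← mul_assoc, T.edgeSign_mul_self]

/-- The signed automorphism is isometric. -/
theorem pairing_act (a b : T.lattice) : T.pairing (T.act a) (T.act b) = T.pairing a b := by
  let g : Sym2 V ≃ Sym2 V :=
    ⟨Sym2.map T.F, Sym2.map T.F.symm, T.map_F_symm, T.map_symm_F⟩
  rw [pairing_apply, pairing_apply,
    ← finsum_comp_equiv g (f := fun e => (T.len e : ℤ) * T.edgeProd (T.act a) (T.act b) e)]
  refine finsum_congr fun e => ?_
  induction e with | _ u v =>
  change (T.len s(T.F u, T.F v) : ℤ) *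
    ((T.edgeSign s(T.F.symm (T.F u), T.F.symm (T.F v)) * a.1 (T.F.symm (T.F u)) (T.F.symm (T.F v))) *
     (T.edgeSign s(T.F.symm (T.F u), T.F.symm (T.F v)) * b.1 (T.F.symm (T.F u)) (T.F.symm (T.F v))))
      = (T.len s(u, v) : ℤ) * (a.1 u v * b.1 u v)
  simp only [RelIso.symm_apply_apply]
  by_cases h : T.graph.Adj u v
  · have h1 : T.len s(T.F u, T.F v) = T.len s(u, v) := T.len_F s(u, v) h
    have h2 := T.edgeSign_mul_self s(u, v)
    rw [h1]
    linear_combination ((T.len s(u, v) : ℤ) * a.1 u v * b.1 u v) * h2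
  · have h1 : a.1 u v = 0 := a.2.2.1 u v fun h' => h h'.1
    simp [h1]

/-- The geometric component group `Λ_T^∨ / Λ_T`. -/
abbrev GeomComponentGroup : Type _ :=
  Module.Dual ℤ T.lattice ⧸ LinearMap.range T.pairing

/-- The action `φ ↦ φ ∘ (εF)⁻¹` of the signed automorphism on `Λ_T^∨`. -/
noncomputable def dualAct : Module.Dual ℤ T.lattice →ₗ[ℤ] Module.Dual ℤ T.lattice :=
  (T.act.symm : T.lattice →ₗ[ℤ] T.lattice).dualMap

/-- The action of the signed automorphism on `Λ_T^∨ / Λ_T`. -/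
noncomputable def quotAct : T.GeomComponentGroup →ₗ[ℤ] T.GeomComponentGroup :=
  Submodule.mapQ _ _ T.dualAct (by
    rintro _ ⟨a, rfl⟩
    refine ⟨T.act a, ?_⟩
    ext b
    have h := T.pairing_act a (T.act.symm b)
    rw [LinearEquiv.apply_symm_apply] at h
    exact h)

/-- The Tamagawa number: the order of the group of invariants of `εF` in `Λ_T^∨ / Λ_T`. -/
noncomputable def tamagawa : ℕ := Nat.card {x : T.GeomComponentGroup // T.quotAct x = x}

end BYGraph

/-! Root the tree at `r` and let `G s t` be the length common to the paths from `r` to `s` and to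
`t`. A relative cycle is determined by its boundary, so `Λ_T` becomes the degree-zero functions on
`S`, its dual becomes `ℤ^S` modulo constants (`functional`), and the pairing becomes the matrix `G`
(`pairing_eq_sum`). For an automorphism of a finite abelian group, invariants and coinvariants have
the same order. So `c_T` is the index in `ℤ^S` of `tamSub`, spanned by the constants, by `G n` with
`n` of degree zero, and by `h - ε h ∘ F` (`tamagawa_eq_index`).

Let `ε = -1` and let `F` fix `r`. Modulo the norms `h + h ∘ F` the matrix decouples. The cut of an
edge fixed by an odd power of `F` is a norm on the points of even period, so there `G` may be
replaced by the form `G₀` that sees only edges in even orbits; these edges survive in `T'`. The mass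
at a point of odd period has order at most two. The meet of two leaves is the root or a branch
vertex, so (A) makes the off-diagonal entries in these columns even, and only the parity of `G s s`
matters: an odd diagonal entry lets the row of the point kill its mass, an even one lets the mass
survive. After one full row is added to `tamSub`, what remains is `𝔽₂^{A₀}` modulo the all-ones
vector, times the coinvariants of `G₀` (`index_fullSub`). Removing that row costs a factor two
exactly when `A₀` is empty and `#S` is even (`index_tamSub`); the hard half uses the nondegeneracy
of `G₀` (`even_sum_of_norm`).

On `T'` there is a sign that alternates under `F` and is constant on the branches at `*`. Twisting
by it turns `h - h ∘ F` into `h + h ∘ F` and yields the same coinvariants of `G₀`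
(`index_tamSub_option`, `prime_tamagawa`). Subdivision changes neither `S` nor `G`
(`subdivide_green`) and, by (B), removes all inversions, which provides a fixed root. With one
marked point, or on a path, the index is computed directly. -/

/-! ### Edge cuts in trees -/

namespace SimpleGraph

variable {V : Type*} {G : SimpleGraph V}

/-- An integral function on a connected graph is determined by its value at one vertex and its
increments along edges. -/
theorem Connected.eq_of_increments {M : Type*} [AddGroup M] (hG : G.Connected) {r : V} {f g : V → M}
    (h0 : f r = g r) (h : ∀ u v, G.Adj u v → f u = g u → f v = g v) : f = g := by
  funext x
  obtain ⟨p⟩ := hG.preconnected r x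
  induction p with
  | nil => exact h0
  | cons hadj _ ih => exact ih (h _ _ hadj h0)

/-- A function that is constant along all edges but `e` is constant on the components of the
graph without `e`. -/
theorem eq_of_reachable_deleteEdges {M : Type*} {e : Sym2 V} {f : V → M}
    (hf : ∀ u v, G.Adj u v → s(u, v) ≠ e → f u = f v) {x y : V}
    (h : (G.deleteEdges {e}).Reachable x y) : f x = f y := by
  obtain ⟨p⟩ := h
  induction p with
  | nil => rfl
  | cons hadj _ ih =>
    rw [deleteEdges_adj] at hadj
    exact (hf _ _ hadj.1 hadj.2).trans ih

/-- A connected graph is a tree as soon as every edge is separated by a function which is constant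
along all other edges. -/
theorem Connected.isTree_of_separating (hG : G.Connected)
    (h : ∀ u v, G.Adj u v → ∃ f : V → ℤ, f u ≠ f v ∧
      ∀ x y, G.Adj x y → s(x, y) ≠ s(u, v) → f x = f y) : G.IsTree := by
  refine ⟨hG, isAcyclic_iff_forall_adj_isBridge.2 fun u v huv hr => ?_⟩
  obtain ⟨f, h1, h2⟩ := h u v huv
  exact h1 (eq_of_reachable_deleteEdges h2 hr)

open Classical in
/-- The indicator function of the side of `e` that does not contain `r`. -/
noncomputable def cut (G : SimpleGraph V) (r : V) (e : Sym2 V) (v : V) : ℤ :=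
  if (G.deleteEdges {e}).Reachable r v then 0 else 1

theorem cut_root (r : V) (e : Sym2 V) : G.cut r e r = 0 := if_pos (Reachable.refl r)

theorem cut_eq_zero_or_one (r : V) (e : Sym2 V) (v : V) : G.cut r e v = 0 ∨ G.cut r e v = 1 := by
  unfold cut; split_ifs <;> simp

theorem cut_eq_of_adj (r : V) {e : Sym2 V} {u v : V} (h : G.Adj u v) (he : s(u, v) ≠ e) :
    G.cut r e u = G.cut r e v := by
  have h1 : (G.deleteEdges {e}).Adj u v := deleteEdges_adj.2 ⟨h, he⟩
  unfold cut
  congr 1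
  exact propext ⟨fun h => h.trans h1.reachable, fun h => h.trans h1.reachable.symm⟩

/-- An edge of a tree is a bridge, so its ends are not both on the side of `r`. If both lay beyond
it, the value `0` could spread from `r` along every edge and reach them. -/
theorem IsTree.cut_add_cut (hG : G.IsTree) (r : V) {u v : V} (h : G.Adj u v) :
    G.cut r s(u, v) u + G.cut r s(u, v) v = 1 := by
  have hb := isAcyclic_iff_forall_adj_isBridge.1 hG.2 h
  rw [isBridge_iff] at hb
  rcases cut_eq_zero_or_one (G := G) r s(u, v) u with hu | hu <;>
    rcases cut_eq_zero_or_one (G := G) r s(u, v) v with hv | hv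
  · exfalso
    unfold cut at hu hv
    simp only [ite_eq_left_iff, one_ne_zero, imp_false, not_not] at hu hv
    exact hb (hu.symm.trans hv)
  · omega
  · omega
  · exfalso
    have key : G.cut r s(u, v) = fun _ => 0 := by
      refine hG.1.eq_of_increments (cut_root r _) fun x y hxy hx => ?_
      by_cases he : s(x, y) = s(u, v)
      · rcases Sym2.eq_iff.1 he with ⟨rfl, rfl⟩ | ⟨rfl, rfl⟩ <;> simp_all
      · rw [← cut_eq_of_adj r hxy he, hx]
    simp [key] at hu

theorem IsTree.cut_ne (hG : G.IsTree) (r : V) {u v : V} (h : G.Adj u v) :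
    G.cut r s(u, v) u ≠ G.cut r s(u, v) v := by
  have := hG.cut_add_cut r h
  omega

/-- The two `0`-`1`-valued increments of a cut. -/
theorem IsTree.cut_diff_mul_self (hG : G.IsTree) (r : V) {u v : V} (h : G.Adj u v) :
    (G.cut r s(u, v) v - G.cut r s(u, v) u) * (G.cut r s(u, v) v - G.cut r s(u, v) u) = 1 := by
  have := hG.cut_add_cut r h
  rcases cut_eq_zero_or_one (G := G) r s(u, v) u with hu | hu <;>
    rw [hu] at this ⊢
  · have : G.cut r s(u, v) v = 1 := by omega
    rw [this]; rfl
  · have : G.cut r s(u, v) v = 0 := by omega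
    rw [this]; rfl

/-- Characterisation of the cut of an edge. -/
theorem IsTree.eq_cut (hG : G.IsTree) {r u v : V} (h : G.Adj u v) {f : V → ℤ} (hr : f r = 0)
    (hf : ∀ x y, G.Adj x y → s(x, y) ≠ s(u, v) → f x = f y) (hne : f u + f v = 1) (x : V) :
    f x = G.cut r s(u, v) x := by
  have hz : ∀ y, G.cut r s(u, v) y = 0 → f y = 0 := fun y hy => by
    unfold cut at hy
    simp only [ite_eq_left_iff, one_ne_zero, imp_false, not_not] at hy
    rw [← hr]
    exact (eq_of_reachable_deleteEdges hf hy).symm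
  have hc := hG.cut_add_cut r h
  have h1 : f u = G.cut r s(u, v) u ∧ f v = G.cut r s(u, v) v := by
    rcases cut_eq_zero_or_one (G := G) r s(u, v) u with hu | hu
    · have := hz u hu
      omega
    · have := hz v (by omega)
      omega
  refine congrFun (hG.1.eq_of_increments (hr.trans (cut_root r _).symm) fun x y hxy hx => ?_) x
  by_cases he : s(x, y) = s(u, v)
  · rcases Sym2.eq_iff.1 he with ⟨rfl, rfl⟩ | ⟨rfl, rfl⟩
    · exact h1.2
    · exact h1.1
  · rw [← cut_eq_of_adj r hxy he, ← hf x y hxy he, hx]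

/-- Cuts are compatible with isomorphisms. -/
theorem IsTree.cut_map (hG : G.IsTree) {r : V} (F : G ≃g G) (hr : F r = r) {e : Sym2 V}
    (he : e ∈ G.edgeSet) (x : V) : G.cut r (e.map F) (F x) = G.cut r e x := by
  induction e with | _ u v =>
  refine hG.eq_cut he (f := fun x => G.cut r s(F u, F v) (F x)) ?_ ?_ ?_ x
  · simp only [hr, cut_root]
  · intro x y hxy hne
    refine cut_eq_of_adj r (F.map_adj_iff.2 hxy) fun h => hne ?_
    exact Sym2.map.injective F.injective h
  · exact hG.cut_add_cut r (F.map_adj_iff.2 he)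

/-- The product of two cuts is a linear combination of the two. -/
theorem IsTree.cut_mul_cut (hG : G.IsTree) (r : V) {a b c d : V} (hab : G.Adj a b)
    (hcd : G.Adj c d) (hne : s(a, b) ≠ s(c, d)) (x : V) :
    G.cut r s(a, b) x * G.cut r s(c, d) x =
      G.cut r s(c, d) a * G.cut r s(a, b) x + G.cut r s(a, b) c * G.cut r s(c, d) x := by
  -- Both sides vanish at `r` and change only along the two edges; on each of these the other cut is
  -- constant. The coefficients record which edge lies beyond which, so nested and disjoint pairs
  -- are treated at once.
  have h1 := cut_eq_of_adj (G := G) r hab hne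
  have h2 := cut_eq_of_adj (G := G) r hcd hne.symm
  refine congrFun (hG.1.eq_of_increments (r := r)
    (f := fun x => G.cut r s(a, b) x * G.cut r s(c, d) x)
    (g := fun x => G.cut r s(c, d) a * G.cut r s(a, b) x + G.cut r s(a, b) c * G.cut r s(c, d) x)
    (by simp [cut_root]) fun x y hxy hx => ?_) x
  by_cases e1 : s(x, y) = s(a, b)
  · have e2 : s(x, y) ≠ s(c, d) := e1 ▸ hne
    have h3 := cut_eq_of_adj (G := G) r hxy e2
    rcases Sym2.eq_iff.1 e1 with ⟨rfl, rfl⟩ | ⟨rfl, rfl⟩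
    · rw [h3] at hx ⊢
      linear_combination hx
    · rw [h3] at hx
      linear_combination hx
  · have h3 := cut_eq_of_adj (G := G) r hxy e1
    by_cases e2 : s(x, y) = s(c, d)
    · rcases Sym2.eq_iff.1 e2 with ⟨rfl, rfl⟩ | ⟨rfl, rfl⟩
      · rw [← h3]
        linear_combination hx
      · rw [← h3, h2] at *
        linear_combination hx
    · rw [← h3, ← cut_eq_of_adj (G := G) r hxy e2, hx]

open Classical in
/-- The unit flow from `r` to `s`, as a function on oriented edges. -/
noncomputable def flow (G : SimpleGraph V) (r s : V) (u v : V) : ℤ :=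
  if G.Adj u v then (G.cut r s(u, v) v - G.cut r s(u, v) u) * G.cut r s(u, v) s else 0

theorem flow_antisymm (r s u v : V) : G.flow r s u v = -G.flow r s v u := by
  unfold flow
  rw [G.adj_comm u v, Sym2.eq_swap]
  split_ifs
  · ring
  · simp

section Flow

variable [Fintype V]

open Classical in
/-- The boundary of the unit flow. -/
theorem IsTree.sum_flow (hG : G.IsTree) (r s v : V) :
    ∑ u, G.flow r s u v = (if s = v then 1 else 0) - (if r = v then 1 else 0) := by
  refine congrFun (hG.1.eq_of_increments (r := r)
    (f := fun s => ∑ u, G.flow r s u v)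
    (g := fun s => (if s = v then (1 : ℤ) else 0) - (if r = v then 1 else 0))
    (by simp [flow, cut_root]) fun x y hxy hx => ?_) s
  -- Moving the sink from `x` to `y` alters the flow on the edge `s(x, y)` only, by one unit.
  have key : ∑ u, G.flow r y u v - ∑ u, G.flow r x u v =
      (if y = v then 1 else 0) - (if x = v then 1 else 0) := by
    rw [← Finset.sum_sub_distrib]
    by_cases hy : y = v
    · subst hy
      rw [if_pos rfl, if_neg hxy.ne, Finset.sum_eq_single x]
      · simp only [flow, if_pos hxy]
        rw [← mul_sub, hG.cut_diff_mul_self r hxy]; rfl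
      · intro u _ hu
        unfold flow
        split_ifs with h
        · rw [← mul_sub, cut_eq_of_adj r hxy, sub_self, mul_zero]
          rw [Ne, Sym2.eq_iff]; rintro (⟨rfl, -⟩ | ⟨rfl, rfl⟩)
          · exact hu rfl
          · exact hxy.ne rfl
        · simp
      · simp
    · by_cases hx' : x = v
      · subst hx'
        rw [if_pos rfl, if_neg hy, Finset.sum_eq_single y]
        · simp only [flow, if_pos hxy.symm]
          have := hG.cut_diff_mul_self r hxy.symm
          linear_combination -this
        · intro u _ hu
          unfold flow
          split_ifs with h
          · rw [← mul_sub, cut_eq_of_adj r hxy, sub_self, mul_zero]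
            rw [Ne, Sym2.eq_iff]; rintro (⟨rfl, rfl⟩ | ⟨-, rfl⟩)
            · exact hy rfl
            · exact hu rfl
          · simp
        · simp
      · rw [if_neg hy, if_neg hx', sub_zero]
        refine Finset.sum_eq_zero fun u _ => ?_
        unfold flow
        split_ifs with h
        · rw [← mul_sub, cut_eq_of_adj r hxy, sub_self, mul_zero]
          rw [Ne, Sym2.eq_iff]; rintro (⟨rfl, rfl⟩ | ⟨rfl, rfl⟩)
          · exact hy rfl
          · exact hx' rfl
        · simp
  linear_combination key + hx

/-- From a vertex `w` there is a first edge towards any other vertex `s`. -/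
theorem IsTree.exists_adj_cut_ne (hG : G.IsTree) (r : V) {w s : V} (h : s ≠ w) :
    ∃ v, G.Adj w v ∧ G.cut r s(w, v) w ≠ G.cut r s(w, v) s := by
  by_contra! hc
  -- If no edge at `w` separates `w` from `s`, the unit flows to `s` and to `w` agree on all edges
  -- at `w`, although their boundaries there differ by one.
  have h1 := hG.sum_flow r s w
  have h2 := hG.sum_flow r w w
  have h3 : ∑ u, G.flow r s u w = ∑ u, G.flow r w u w := by
    refine Finset.sum_congr rfl fun u _ => ?_
    unfold flow
    split_ifs with hu
    · have := hc u hu.symm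
      rw [Sym2.eq_swap] at this
      rw [this]
    · rfl
  rw [h1, h2, if_neg h, if_pos rfl] at h3
  omega

/-- Antisymmetric flows in a tree are determined by their boundary. -/
theorem sum_cut_mul_boundary (r : V) {c : V → V → ℤ}
    (hc : ∀ u v, c u v = -c v u) (hc' : ∀ u v, ¬ G.Adj u v → c u v = 0) {u v : V}
    (h : G.Adj u v) :
    ∑ w, G.cut r s(u, v) w * ∑ x, c x w = (G.cut r s(u, v) v - G.cut r s(u, v) u) * c u v := by
  classical
  set κ := G.cut r s(u, v)
  have h1 : ∑ w, κ w * ∑ x, c x w = ∑ w, ∑ x, κ w * c x w := by simp [Finset.mul_sum]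
  -- By antisymmetry of `c`, twice the sum involves only the increments of `κ`, and these vanish
  -- along every edge but `s(u, v)`.
  have h2 : ∑ w, ∑ x, κ w * c x w = - ∑ w, ∑ x, κ x * c x w := by
    rw [Finset.sum_comm, ← Finset.sum_neg_distrib]
    refine Finset.sum_congr rfl fun w _ => ?_
    rw [← Finset.sum_neg_distrib]
    refine Finset.sum_congr rfl fun x _ => ?_
    rw [hc w x]; ring
  have h3 : ∑ w, ∑ x, κ w * c x w + ∑ w, ∑ x, κ w * c x w =
      ∑ w, ∑ x, (κ w - κ x) * c x w := by
    nth_rewrite 2 [h2]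
    rw [← sub_eq_add_neg, ← Finset.sum_sub_distrib]
    refine Finset.sum_congr rfl fun w _ => ?_
    rw [← Finset.sum_sub_distrib]
    refine Finset.sum_congr rfl fun x _ => ?_
    ring
  have hz : ∀ w x, s(x, w) ≠ s(u, v) → (κ w - κ x) * c x w = 0 := fun w x hne => by
    by_cases ha : G.Adj x w
    · rw [show κ x = κ w from cut_eq_of_adj r ha hne]; ring
    · rw [hc' _ _ ha, mul_zero]
  have h4 : ∑ w, ∑ x, (κ w - κ x) * c x w = (κ v - κ u) * c u v + (κ u - κ v) * c v u := by
    rw [← Finset.sum_product' Finset.univ Finset.univ (fun w x => (κ w - κ x) * c x w),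
      Finset.univ_product_univ, ← Finset.sum_subset (Finset.subset_univ {(v, u), (u, v)})]
    · rw [Finset.sum_pair]
      simpa [Prod.ext_iff] using fun h' => absurd h' h.ne'
    · rintro ⟨w, x⟩ - hne
      refine hz w x fun h' => hne ?_
      rcases Sym2.eq_iff.1 h' with ⟨rfl, rfl⟩ | ⟨rfl, rfl⟩ <;> simp
  rw [hc v u] at h4
  rw [h1]
  linarith

end Flow

end SimpleGraph

/-! ### The Green form of a rooted tree -/

namespace SimpleGraph

variable {V : Type*} {G : SimpleGraph V}

/-- The weighted length of the common part of the paths from `r` to `s` and to `t`. -/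
noncomputable def green (G : SimpleGraph V) (wt : Sym2 V → ℤ) (r s t : V) : ℤ :=
  ∑ᶠ e : G.edgeSet, wt e * G.cut r e s * G.cut r e t

theorem green_comm (wt : Sym2 V → ℤ) (r s t : V) : G.green wt r s t = G.green wt r t s :=
  finsum_congr fun _ => by ring

theorem green_root (wt : Sym2 V → ℤ) (r s : V) : G.green wt r s r = 0 := by
  unfold green
  simp [cut_root]

section

variable [Finite V]

theorem green_sub (wt : Sym2 V → ℤ) (r s : V) {u v : V} (h : G.Adj u v) :
    G.green wt r s v - G.green wt r s u =
      wt s(u, v) * G.cut r s(u, v) s * (G.cut r s(u, v) v - G.cut r s(u, v) u) := by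
  classical
  have := Fintype.ofFinite G.edgeSet
  unfold green
  rw [finsum_eq_sum_of_fintype, finsum_eq_sum_of_fintype, ← Finset.sum_sub_distrib,
    Finset.sum_eq_single (⟨s(u, v), h⟩ : G.edgeSet)]
  · ring
  · intro e _ he
    rw [cut_eq_of_adj r h fun h' => he (Subtype.ext h'.symm), sub_self]
  · simp

/-- A row of the form is determined by its increments along edges. Forms of other trees can
therefore be compared on `V` edge by edge, without matching edge sets; invariance, contraction and
subdivision all use this. -/
theorem IsTree.eq_green (hG : G.IsTree) {wt : Sym2 V → ℤ} {r s : V} {f : V → ℤ} (h0 : f r = 0)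
    (h : ∀ u v, G.Adj u v →
      f v - f u = wt s(u, v) * G.cut r s(u, v) s * (G.cut r s(u, v) v - G.cut r s(u, v) u))
    (t : V) : f t = G.green wt r s t := by
  refine congrFun (hG.1.eq_of_increments (r := r) (f := f) (g := G.green wt r s)
    (h0.trans (green_root wt r s).symm) fun u v huv hu => ?_) t
  have h1 := h u v huv
  rw [← green_sub wt r s huv] at h1
  linarith

theorem IsTree.green_map (hG : G.IsTree) {wt : Sym2 V → ℤ} {r : V} (F : G ≃g G) (hr : F r = r)
    (hwt : ∀ e ∈ G.edgeSet, wt (e.map F) = wt e) (s t : V) :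
    G.green wt r (F s) (F t) = G.green wt r s t := by
  refine hG.eq_green (f := fun t => G.green wt r (F s) (F t)) ?_ (fun u v h => ?_) t
  · simp only [hr, green_root]
  · have h1 := hG.cut_map F hr (e := s(u, v)) h
    have h2 := hwt s(u, v) h
    rw [Sym2.map_mk] at h2
    rw [green_sub wt r (F s) (F.map_adj_iff.2 h), ← h1 s, ← h1 u, ← h1 v, ← h2]
    rfl

theorem sum_mul_green [Fintype V] (wt : Sym2 V → ℤ) (r : V) (w : V → ℤ) (t : V) :
    ∑ s, w s * G.green wt r s t =
      ∑ᶠ e : G.edgeSet, wt e * (∑ s, w s * G.cut r e s) * G.cut r e t := by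
  classical
  have := Fintype.ofFinite G.edgeSet
  simp only [green, finsum_eq_sum_of_fintype, Finset.mul_sum, Finset.sum_mul]
  rw [Finset.sum_comm]
  refine Finset.sum_congr rfl fun _ _ => Finset.sum_congr rfl fun _ _ => ?_
  ring

/-- The cut sums diagonalise the form, with the weights of the edges as coefficients. Both its
positivity and its agreement with the length pairing follow. -/
theorem sum_mul_sum_mul_green [Fintype V] (wt : Sym2 V → ℤ) (r : V) (w w' : V → ℤ) :
    ∑ t, w' t * ∑ s, w s * G.green wt r s t =
      ∑ᶠ e : G.edgeSet, wt e * (∑ s, w s * G.cut r e s) * ∑ t, w' t * G.cut r e t := by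
  classical
  have := Fintype.ofFinite G.edgeSet
  simp only [sum_mul_green, finsum_eq_sum_of_fintype, Finset.mul_sum]
  rw [Finset.sum_comm]
  refine Finset.sum_congr rfl fun _ _ => Finset.sum_congr rfl fun _ _ => ?_
  ring

/-- The form `green` is positive definite on functions supported away from `r` and away from the
edges of weight zero. -/
theorem IsTree.green_nondegenerate [Fintype V] (hG : G.IsTree) {wt : Sym2 V → ℤ} {r : V}
    (hwt : ∀ e ∈ G.edgeSet, 0 ≤ wt e) {w : V → ℤ}
    (h : ∀ t, w t ≠ 0 → ∑ s, w s * G.green wt r s t = 0) {v : V} (hv : v ≠ r)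
    (hpos : ∀ u, G.Adj u v → 0 < wt s(u, v)) : w v = 0 := by
  classical
  have := Fintype.ofFinite G.edgeSet
  have h1 := sum_mul_sum_mul_green (G := G) wt r w w
  rw [Finset.sum_eq_zero (fun t _ => by
    by_cases ht : w t = 0
    · rw [ht, zero_mul]
    · rw [h t ht, mul_zero]), finsum_eq_sum_of_fintype] at h1
  have h2 := (Finset.sum_eq_zero_iff_of_nonneg (fun e _ => by
    rw [mul_assoc]; exact mul_nonneg (hwt e.1 e.2) (mul_self_nonneg _))).1 h1.symm
  -- Every edge at `v` has positive weight, so the combination of unit flows with coefficients `w`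
  -- vanishes on it. The boundary of that combination at `v` is `w v`.
  have h3 : ∑ s, w s * ∑ u, G.flow r s u v = 0 := by
    simp only [Finset.mul_sum]
    rw [Finset.sum_comm]
    refine Finset.sum_eq_zero fun u _ => ?_
    unfold flow
    by_cases huv : G.Adj u v
    · simp only [if_pos huv]
      have h4 := h2 ⟨s(u, v), huv⟩ (Finset.mem_univ _)
      have h5 : ∑ s, w s * G.cut r s(u, v) s = 0 := by
        have := hpos u huv
        rw [mul_assoc] at h4
        rcases mul_eq_zero.1 h4 with h' | h'
        · exact absurd h' this.ne'
        · exact mul_self_eq_zero.1 h'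
      rw [← mul_zero (G.cut r s(u, v) v - G.cut r s(u, v) u), ← h5, Finset.mul_sum]
      exact Finset.sum_congr rfl fun _ _ => by ring
    · simp [huv]
  simpa [hG.sum_flow, hv.symm] using h3

end

/-! ### Meets -/

/-- An edge `e` separating `r` from `y`, with endpoint `a`: all edges separating `r` from `a` also
separate `r` from `y`. -/
theorem IsTree.cut_eq_one_of_edge (hG : G.IsTree) (r : V) {a b y : V} (hab : G.Adj a b)
    (hy : G.cut r s(a, b) y = 1) {f : Sym2 V} (hf : f ∈ G.edgeSet) (ha : G.cut r f a = 1) :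
    G.cut r f y = 1 := by
  by_cases hne : s(a, b) = f
  · rw [← hne, hy]
  · induction f with | _ c d =>
    have h := hG.cut_mul_cut r hab hf hne y
    rw [hy, ha] at h
    rcases cut_eq_zero_or_one (G := G) r s(c, d) y with h0 | h0
    · rw [h0] at h; omega
    · exact h0

/-- Any two vertices of a rooted tree have a meet. -/
theorem IsTree.exists_meet (hG : G.IsTree) (r x y : V) :
    ∃ w, ∀ e ∈ G.edgeSet, G.cut r e w = G.cut r e x * G.cut r e y := by
  obtain ⟨p⟩ := hG.1.preconnected x r
  induction p with
  | @nil r => exact ⟨r, fun e _ => by simp [cut_root]⟩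
  | @cons a b r hab _ ih =>
    obtain ⟨w, hw⟩ := ih
    -- If `y` lies beyond the edge, every edge separating `r` from `a` also separates `r` from `y`,
    -- so `a` is the meet. Otherwise passing from `a` to `b` only changes a factor that is
    -- multiplied by `0`.
    by_cases hy : G.cut r s(a, b) y = 1
    · refine ⟨a, fun f hf => ?_⟩
      rcases cut_eq_zero_or_one (G := G) _ f a with h0 | h0
      · rw [h0, zero_mul]
      · rw [h0, hG.cut_eq_one_of_edge _ hab hy hf h0, one_mul]
    · refine ⟨w, fun f hf => ?_⟩
      rw [hw f hf]
      by_cases hf' : s(a, b) = f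
      · have : G.cut r s(a, b) y = 0 := (cut_eq_zero_or_one _ _ _).resolve_right hy
        rw [← hf', this, mul_zero, mul_zero]
      · rw [cut_eq_of_adj _ hab hf']

/-- The meet of two distinct vertices of degree at most one, neither of them the root, is the root
or has at least three neighbours. -/
theorem IsTree.exists_meet_of_leaf [Finite V] (hG : G.IsTree) {r x y : V} (hxy : x ≠ y)
    (hx : x ≠ r) (hy : y ≠ r) (hx1 : ∀ u v, G.Adj x u → G.Adj x v → u = v)
    (hy1 : ∀ u v, G.Adj y u → G.Adj y v → u = v) :
    ∃ w, (w = r ∨ 3 ≤ (G.neighborSet w).ncard) ∧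
      ∀ e ∈ G.edgeSet, G.cut r e w = G.cut r e x * G.cut r e y := by
  have := Fintype.ofFinite V
  obtain ⟨w, hw⟩ := hG.exists_meet r x y
  refine ⟨w, or_iff_not_imp_left.2 fun hwr => ?_, hw⟩
  have below : ∀ {z}, z ≠ w → (∀ e ∈ G.edgeSet, G.cut r e w = 1 → G.cut r e z = 1) →
      ∃ v, G.Adj w v ∧ G.cut r s(w, v) w = 0 ∧ G.cut r s(w, v) z = 1 := fun {z} hz hwz => by
    obtain ⟨v, h1, h2⟩ := hG.exists_adj_cut_ne r hz
    refine ⟨v, h1, ?_⟩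
    have := hwz s(w, v) h1
    rcases cut_eq_zero_or_one (G := G) r s(w, v) w with h | h <;>
      rcases cut_eq_zero_or_one (G := G) r s(w, v) z with h' | h' <;> simp_all
  have hwx : ∀ e ∈ G.edgeSet, G.cut r e w = 1 → G.cut r e x = 1 := fun e he h => by
    rw [hw e he] at h
    exact (cut_eq_zero_or_one _ _ _).resolve_left fun h' => by simp [h'] at h
  have hwy : ∀ e ∈ G.edgeSet, G.cut r e w = 1 → G.cut r e y = 1 := fun e he h => by
    rw [hw e he] at h
    exact (cut_eq_zero_or_one _ _ _).resolve_left fun h' => by simp [h'] at h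
  have parent : ∀ {z}, z ≠ r → ∃ v, G.Adj z v ∧ G.cut r s(z, v) z = 1 := fun {z} hz => by
    obtain ⟨v, h1, h2⟩ := hG.exists_adj_cut_ne r hz.symm
    rw [cut_root] at h2
    exact ⟨v, h1, (cut_eq_zero_or_one _ _ _).resolve_left h2⟩
  -- A leaf equal to the meet would have one neighbour towards the root and another one away from
  -- it.
  have hwx' : x ≠ w := by
    rintro rfl
    obtain ⟨v, h1, h2, -⟩ := below hxy.symm hwy
    obtain ⟨v', h1', h2'⟩ := parent hx
    rw [hx1 v v' h1 h1'] at h2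
    omega
  have hwy' : y ≠ w := by
    rintro rfl
    obtain ⟨v, h1, h2, -⟩ := below hxy hwx
    obtain ⟨v', h1', h2'⟩ := parent hy
    rw [hy1 v v' h1 h1'] at h2
    omega
  -- The three neighbours lead to `r`, `x` and `y`. The last two differ because an edge with both
  -- `x` and `y` beyond it also has the meet beyond it.
  obtain ⟨a, ha, ha1⟩ := parent hwr
  obtain ⟨b, hb, hb1, hb2⟩ := below hwx' hwx
  obtain ⟨c, hc, hc1, hc2⟩ := below hwy' hwy
  have hbc : b ≠ c := by
    rintro rfl
    have := hw s(w, b) hb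
    rw [hb1, hb2, hc2] at this
    omega
  have hab : a ≠ b := by rintro rfl; omega
  have hac : a ≠ c := by rintro rfl; omega
  rw [← Set.ncard_eq_three.2 ⟨a, b, c, hab, hac, hbc, rfl⟩]
  refine Set.ncard_le_ncard ?_ (Set.toFinite _)
  rintro _ (rfl | rfl | rfl)
  exacts [ha, hb, hc]

end SimpleGraph

/-! ### Signs alternating along orbits -/

/-- The orbit of `a` under `f` is periodic of odd period. -/
def IsOddPt {α : Type*} (f : α → α) (a : α) : Prop := ∃ k, Odd k ∧ f^[k] a = a

section IsOddPt

variable {α : Type*}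

theorem isOddPt_apply_iff {f : α → α} (hf : f.Injective) (a : α) :
    IsOddPt f (f a) ↔ IsOddPt f a := by
  refine exists_congr fun k => and_congr_right fun _ => ?_
  rw [← Function.iterate_succ_apply, Function.iterate_succ_apply']
  exact hf.eq_iff

/-- The orbit size is the minimal period, which divides every period. -/
theorem odd_iterOrbit_iff [Finite α] {f : α → α} (hf : f.Injective) (a : α) :
    Odd (iterOrbit f a).ncard ↔ IsOddPt f a := by
  have hper : a ∈ Function.periodicPts f := hf.mem_periodicPts a
  have h1 : iterOrbit f a = (f^[·] a) '' Set.Iio (Function.minimalPeriod f a) := by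
    ext b
    constructor
    · rintro ⟨n, rfl⟩
      exact ⟨n % Function.minimalPeriod f a,
        Nat.mod_lt _ (Function.minimalPeriod_pos_of_mem_periodicPts hper),
        Function.iterate_mod_minimalPeriod_eq⟩
    · rintro ⟨n, -, rfl⟩
      exact ⟨n, rfl⟩
  have h2 : (iterOrbit f a).ncard = Function.minimalPeriod f a := by
    rw [h1, Function.iterate_injOn_Iio_minimalPeriod.ncard_image]
    rw [← Finset.coe_Iio, Set.ncard_coe_finset, Nat.card_Iio]
  rw [h2]
  constructor
  · intro h
    exact ⟨_, h, Function.iterate_minimalPeriod⟩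
  · rintro ⟨k, hk, h⟩
    exact hk.of_dvd_nat (Function.IsPeriodicPt.minimalPeriod_dvd h)

/-- A sign that alternates along all orbits of even size. -/
theorem exists_alternating [Finite α] {f : α → α} (hf : f.Injective) :
    ∃ τ : α → ℤ, (∀ a, τ a = 1 ∨ τ a = -1) ∧ ∀ a, ¬ IsOddPt f a → τ (f a) = -τ a := by
  classical
  have hper : ∀ a, a ∈ Function.periodicPts f := hf.mem_periodicPts
  have hback : ∀ a b, (∃ k, f^[k] a = b) → ∃ k, f^[k] b = a := by
    rintro a _ ⟨k, rfl⟩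
    obtain ⟨n, hn, h⟩ := hper a
    refine ⟨n * k - k, ?_⟩
    rw [← Function.iterate_add_apply, Nat.sub_add_cancel (Nat.le_mul_of_pos_left k hn)]
    exact (Function.IsPeriodicPt.mul_const h k)
  let s : Setoid α :=
    { r := fun a b => ∃ k, f^[k] a = b
      iseqv := ⟨fun a => ⟨0, rfl⟩, fun h => hback _ _ h, by
        rintro a _ _ ⟨k, rfl⟩ ⟨l, rfl⟩
        exact ⟨l + k, Function.iterate_add_apply _ _ _ _⟩⟩ }
  have hrep : ∀ a, ∃ k, f^[k] (Quotient.mk s a).out = a := fun a => Quotient.mk_out (s := s) a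
  choose k hk using hrep
  -- `k a` is a number of steps from the chosen representative of the orbit to `a`. On an orbit of
  -- even size its parity is well defined, since two counts of opposite parity would differ by an
  -- odd period.
  refine ⟨fun a => (-1) ^ k a, fun a => neg_one_pow_eq_or ℤ _, fun a ha => ?_⟩
  have hq : Quotient.mk s (f a) = Quotient.mk s a :=
    (Quotient.sound (s := s) (a := a) (b := f a) ⟨1, rfl⟩).symm
  have h1 := hk (f a)
  rw [hq] at h1
  have h2 : f^[k a + 1] (Quotient.mk s a).out = f a := by
    rw [Function.iterate_succ_apply', hk a]
  set y := (Quotient.mk s a).out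
  have hodd : ∀ n, ¬ (Odd n ∧ f^[n] y = y) := fun n hn => ha ⟨n, hn.1, by
    conv_lhs => rw [← hk a]
    rw [← Function.iterate_add_apply, add_comm, Function.iterate_add_apply, hn.2, hk a]⟩
  have h3 : Even (k (f a)) ↔ Even (k a + 1) := by
    by_contra hne
    rcases le_total (k (f a)) (k a + 1) with hle | hle
    · refine hodd (k a + 1 - k (f a)) ⟨?_, ?_⟩
      · rw [Nat.odd_sub hle]
        simp only [← Nat.not_even_iff_odd]; tauto
      · apply hf.iterate (k (f a))
        rw [← Function.iterate_add_apply, Nat.add_sub_cancel' hle, h1, h2]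
    · refine hodd (k (f a) - (k a + 1)) ⟨?_, ?_⟩
      · rw [Nat.odd_sub hle]
        simp only [← Nat.not_even_iff_odd]; tauto
      · apply hf.iterate (k a + 1)
        rw [← Function.iterate_add_apply, Nat.add_sub_cancel' hle, h1, h2]
  have h4 : (-1 : ℤ) ^ k (f a) = (-1) ^ (k a + 1) := by
    by_cases he : Even (k (f a))
    · rw [he.neg_one_pow, (h3.1 he).neg_one_pow]
    · rw [(Nat.not_even_iff_odd.1 he).neg_one_pow,
        (Nat.not_even_iff_odd.1 (mt h3.2 he)).neg_one_pow]
  simp only [h4, pow_succ, mul_neg, mul_one]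

theorem alternating_iterate {f : α → α} (hf : f.Injective) {τ : α → ℤ}
    (hτ : ∀ a, ¬ IsOddPt f a → τ (f a) = -τ a) {a : α} (ha : ¬ IsOddPt f a) (k : ℕ) :
    τ (f^[k] a) = (-1) ^ k * τ a := by
  induction k with
  | zero => simp
  | succ k ih =>
    have h : ¬ IsOddPt f (f^[k] a) := by
      clear ih
      induction k with
      | zero => exact ha
      | succ k ih => rwa [Function.iterate_succ_apply', isOddPt_apply_iff hf]
    rw [Function.iterate_succ_apply', hτ _ h, ih, pow_succ]
    ring

end IsOddPt

/-! ### Norm-like elements -/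

section NormSub

variable {S : Type*} (f : Equiv.Perm S)

/-- The functions of the form `h + h ∘ f`. -/
def normSub : AddSubgroup (S → ℤ) where
  carrier := {x | ∃ h : S → ℤ, ∀ t, x t = h t + h (f t)}
  zero_mem' := ⟨0, fun _ => rfl⟩
  add_mem' := by
    rintro a b ⟨h, hh⟩ ⟨h', hh'⟩
    exact ⟨h + h', fun t => by simp only [Pi.add_apply, hh, hh']; ring⟩
  neg_mem' := by
    rintro a ⟨h, hh⟩
    exact ⟨-h, fun t => by simp only [Pi.neg_apply, hh]; ring⟩

variable {f}

/-- Modulo `normSub f`, composition with `f` is multiplication by `-1`, and hence so is composition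
with any odd iterate. -/
theorem add_comp_iterate_mem_normSub (h : S → ℤ) {k : ℕ} (hk : Odd k) :
    (fun t => h t + h (f^[k] t)) ∈ normSub f := by
  obtain ⟨m, rfl⟩ := hk
  induction m with
  | zero => exact ⟨h, fun _ => rfl⟩
  | succ m ih =>
    have h1 : (fun t => h (f^[2 * m + 1] t) + h (f^[2 * m + 1] (f t))) ∈ normSub f :=
      ⟨fun t => h (f^[2 * m + 1] t), fun _ => rfl⟩
    have h2 : (fun t => h (f^[2 * m + 2] t) + h (f^[2 * m + 2] (f t))) ∈ normSub f :=
      ⟨fun t => h (f^[2 * m + 2] t), fun _ => rfl⟩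
    convert (normSub f).add_mem ((normSub f).sub_mem ih h1) h2 using 1
    funext t
    change h t + h (f^[2 * m + 3] t) = h t + h (f^[2 * m + 1] t) -
      (h (f^[2 * m + 1] t) + h (f^[2 * m + 2] t)) + (h (f^[2 * m + 2] t) + h (f^[2 * m + 3] t))
    ring

variable [DecidableEq S]

/-- An odd iterate fixes `s`, so the class of the point mass equals its own negative. -/
theorem two_mul_single_mem_normSub {s : S} (hs : IsOddPt f s) :
    (2 • Pi.single s (1 : ℤ) : S → ℤ) ∈ normSub f := by
  obtain ⟨k, hk, hks⟩ := hs
  convert add_comp_iterate_mem_normSub (f := f) (Pi.single s (1 : ℤ)) hk using 1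
  funext t
  have : f^[k] t = s ↔ t = s := by
    conv_lhs => rw [← hks]
    exact (f.injective.iterate k).eq_iff
  simp only [Pi.single_apply, this, Pi.smul_apply]
  split_ifs <;> rfl

theorem single_add_single_mem_normSub (s : S) :
    (Pi.single s (1 : ℤ) + Pi.single (f s) 1 : S → ℤ) ∈ normSub f := by
  refine ⟨Pi.single (f s) 1, fun t => ?_⟩
  simp only [Pi.add_apply, Pi.single_apply, f.injective.eq_iff]
  ring

/-- The class of the point mass changes sign at each step along the orbit, and signs are invisible
for classes of order two. -/
theorem single_sub_single_mem_normSub {s : S} (hs : IsOddPt f s) (k : ℕ) :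
    (Pi.single s (1 : ℤ) - Pi.single (f^[k] s) 1 : S → ℤ) ∈ normSub f := by
  induction k with
  | zero => simp [(normSub f).zero_mem]
  | succ k ih =>
    have hodd : IsOddPt f (f^[k] s) := by
      clear ih
      induction k with
      | zero => exact hs
      | succ k ih => rwa [Function.iterate_succ_apply', isOddPt_apply_iff f.injective]
    rw [Function.iterate_succ_apply']
    have h1 := single_add_single_mem_normSub (f := f) (f^[k] s)
    have h2 := two_mul_single_mem_normSub hodd
    convert (normSub f).sub_mem ((normSub f).add_mem ih h2) h1 using 1
    rw [two_nsmul]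
    abel

/-- An even-valued function supported on points of odd period. -/
theorem even_mem_normSub [Fintype S] {x : S → ℤ} (h : ∀ s, Even (x s))
    (h0 : ∀ s, ¬ IsOddPt f s → x s = 0) : x ∈ normSub f := by
  choose y hy using h
  have h1 : x = ∑ s, y s • (2 • Pi.single s (1 : ℤ) : S → ℤ) := by
    funext t
    simp only [Finset.sum_apply, Pi.smul_apply, Pi.single_apply, smul_eq_mul]
    rw [Finset.sum_eq_single t] <;> simp +contextual [hy t]
    · ring
    · intro b hb h'; exact absurd h'.symm hb
  rw [h1]
  refine AddSubgroup.sum_mem _ fun s _ => ?_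
  by_cases hs : IsOddPt f s
  · exact (normSub f).zsmul_mem (two_mul_single_mem_normSub hs) _
  · have : y s = 0 := by have := h0 s hs; have := hy s; omega
    rw [this, zero_smul]
    exact (normSub f).zero_mem

omit [DecidableEq S] in
/-- A function invariant under an odd power of `f` and vanishing at the points of odd period. -/
theorem indicator_mem_normSub [Finite S] {b : S → ℤ} {k : ℕ} (hk : Odd k)
    (hb : ∀ t, b (f^[k] t) = b t) (h0 : ∀ s, IsOddPt f s → b s = 0) : b ∈ normSub f := by
  -- Keep `b` on the half of each even orbit where `τ = 1`. The odd iterate exchanges the two halves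
  -- and preserves `b`, so this half and its translate add up to `b`.
  obtain ⟨τ, h1, h2⟩ := exists_alternating f.injective
  convert add_comp_iterate_mem_normSub (f := f) (fun t => if τ t = 1 then b t else 0) hk using 1
  funext t
  by_cases ht : IsOddPt f t
  · simp [hb, h0 t ht]
  · have := alternating_iterate f.injective h2 ht k
    rw [hk.neg_one_pow] at this
    rcases h1 t with h | h <;> simp [this, h, hb]

omit [DecidableEq S] in
theorem even_sum_of_mem_normSub [Fintype S] {x : S → ℤ} (hx : x ∈ normSub f) :
    Even (∑ s, x s) := by
  obtain ⟨h, hh⟩ := hx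
  refine ⟨∑ s, h s, ?_⟩
  rw [Finset.sum_congr rfl fun s _ => hh s, Finset.sum_add_distrib, Equiv.sum_comp f h]

end NormSub

/-! ### An index computation -/

section Index

variable {S : Type*} [Fintype S]

/-- The functions `a + G n + (h - ε h ∘ f)` with `a` constant and `n` of degree zero. -/
def tamSub (f : Equiv.Perm S) (ε : ℤ) (G : S → S → ℤ) : AddSubgroup (S → ℤ) where
  carrier := {x | ∃ (a : ℤ) (n h : S → ℤ), ∑ s, n s = 0 ∧
    ∀ t, x t = a + ∑ s, n s * G s t + (h t - ε * h (f t))}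
  zero_mem' := ⟨0, 0, 0, by simp, by simp⟩
  add_mem' := by
    rintro x y ⟨a, n, h, h1, h2⟩ ⟨a', n', h', h1', h2'⟩
    refine ⟨a + a', n + n', h + h', by simp [Finset.sum_add_distrib, h1, h1'], fun t => ?_⟩
    simp only [Pi.add_apply, h2, h2', add_mul, Finset.sum_add_distrib]
    ring
  neg_mem' := by
    rintro x ⟨a, n, h, h1, h2⟩
    refine ⟨-a, -n, -h, by simp [h1], fun t => ?_⟩
    simp only [Pi.neg_apply, h2, neg_mul, Finset.sum_neg_distrib]
    ring

/-- The functions `G n + (h + h ∘ f)`. -/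
def coinvSub (f : Equiv.Perm S) (G : S → S → ℤ) : AddSubgroup (S → ℤ) where
  carrier := {x | ∃ n h : S → ℤ, ∀ t, x t = ∑ s, n s * G s t + (h t + h (f t))}
  zero_mem' := ⟨0, 0, by simp⟩
  add_mem' := by
    rintro x y ⟨n, h, h2⟩ ⟨n', h', h2'⟩
    refine ⟨n + n', h + h', fun t => ?_⟩
    simp only [Pi.add_apply, h2, h2', add_mul, Finset.sum_add_distrib]
    ring
  neg_mem' := by
    rintro x ⟨n, h, h2⟩
    refine ⟨-n, -h, fun t => ?_⟩
    simp only [Pi.neg_apply, h2, neg_mul, Finset.sum_neg_distrib]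
    ring

/-- The permutation of the points of even period. -/
def evenPerm (f : Equiv.Perm S) : Equiv.Perm {s // ¬ IsOddPt f s} :=
  f.subtypePerm fun s => not_congr (isOddPt_apply_iff f.injective s)

omit [Fintype S] in
theorem not_isOddPt_evenPerm (f : Equiv.Perm S) (s : {s // ¬ IsOddPt f s}) :
    ¬ IsOddPt (evenPerm f) s := by
  rintro ⟨k, hk, h⟩
  refine s.2 ⟨k, hk, ?_⟩
  have h1 : ∀ k : ℕ, ((evenPerm f)^[k] s : S) = f^[k] s := fun k => by
    induction k with
    | zero => rfl
    | succ k ih => rw [Function.iterate_succ_apply', Function.iterate_succ_apply', ← ih]; rfl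
  rw [← h1, h]

open Classical in
/-- A pair of invariant forms `G`, `G₀`, where `G₀` is the part of `G` that lives on the points of
even period, such that `G` and `G₀` agree up to norms. -/
structure IsGreenPair (f : Equiv.Perm S) (G G₀ : S → S → ℤ) : Prop where
  map : ∀ s t, G (f s) (f t) = G s t
  map_zero : ∀ s t, G₀ (f s) (f t) = G₀ s t
  left_zero : ∀ s t, IsOddPt f s → G₀ s t = 0
  right_zero : ∀ s t, IsOddPt f t → G₀ s t = 0
  norm : ∀ s, (fun t => if IsOddPt f t then 0 else G s t - G₀ s t) ∈ normSub f
  even : ∀ s t, s ≠ t → IsOddPt f t → Even (G s t)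
  nondeg : ∀ w : S → ℤ, (∀ s, IsOddPt f s → w s = 0) →
    (∀ t, ¬ IsOddPt f t → ∑ s, w s * G₀ s t = 0) → w = 0

namespace IsGreenPair

variable {f : Equiv.Perm S} {G G₀ : S → S → ℤ}

open Classical in
-- On even periods the discrepancy is a norm by hypothesis. On odd periods `G₀` vanishes and the
-- off-diagonal entries are even, hence trivial modulo norms; only the diagonal entry is left.
theorem row (hG : IsGreenPair f G G₀) (s : S) :
    (fun t => G s t - G₀ s t - if IsOddPt f s then G s s * (Pi.single s 1 : S → ℤ) t else 0) ∈
      normSub f := by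
  have h1 : (fun t => if IsOddPt f t then
      G s t - (if IsOddPt f s then G s s * (Pi.single s 1 : S → ℤ) t else 0) else 0) ∈ normSub f := by
    refine even_mem_normSub (fun t => ?_) fun t ht => if_neg ht
    by_cases ht : IsOddPt f t
    · simp only [if_pos ht]
      by_cases hst : s = t
      · subst hst; simp [ht]
      · simp [Ne.symm hst, hG.even s t hst ht]
    · simp [ht]
  convert (normSub f).add_mem (hG.norm s) h1 using 1
  funext t
  by_cases ht : IsOddPt f t
  · simp [ht, hG.right_zero s t ht]
  · by_cases hs : IsOddPt f s
    · have : t ≠ s := by rintro rfl; exact ht hs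
      simp [ht, hs, Pi.single_apply, this]
    · simp [ht, hs]

theorem norm_le (f : Equiv.Perm S) (G : S → S → ℤ) : normSub f ≤ tamSub f (-1) G := by
  rintro x ⟨h, hh⟩
  exact ⟨0, 0, h, by simp, fun t => by simp [hh]⟩

open Classical in
theorem row_sub_row_mem (f : Equiv.Perm S) (ε : ℤ) (G : S → S → ℤ) (s s' : S) :
    G s - G s' ∈ tamSub f ε G := by
  refine ⟨0, Pi.single s 1 - Pi.single s' 1, 0, by simp, fun t => ?_⟩
  simp [sub_mul, Finset.sum_sub_distrib, Pi.single_apply]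

open Classical in
-- By invariance `G s + G (f s)` is the norm attached to `G (f s)`, while `G s - G (f s)` is a
-- combination of rows of degree zero.
theorem two_row_mem (hG : IsGreenPair f G G₀) (s : S) : 2 • G s ∈ tamSub f (-1) G := by
  have h1 := row_sub_row_mem f (-1) G s (f s)
  have h2 : G s + G (f s) ∈ tamSub f (-1) G := by
    refine norm_le f G ⟨G (f s), fun t => ?_⟩
    rw [hG.map, Pi.add_apply, add_comm]
  convert add_mem h1 h2 using 1
  rw [two_nsmul]; abel

variable (f G) in
/-- Points of odd period with an even diagonal value. -/
def EvenDiag (s : S) : Prop := IsOddPt f s ∧ Even (G s s)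

theorem evenDiag_map (hG : IsGreenPair f G G₀) (s : S) : EvenDiag f G (f s) ↔ EvenDiag f G s := by
  unfold EvenDiag
  rw [isOddPt_apply_iff f.injective, hG.map]

theorem evenDiag_iterate (hG : IsGreenPair f G G₀) (s : S) (k : ℕ) :
    EvenDiag f G (f^[k] s) ↔ EvenDiag f G s := by
  induction k with
  | zero => rfl
  | succ k ih => rw [Function.iterate_succ_apply', hG.evenDiag_map, ih]

variable {B : Type*} {orb : S → B}

variable (f G orb) in
open Classical in
/-- Sums modulo two over the orbits of odd size with even diagonal values. -/
noncomputable def orbSum : (S → ℤ) →+ ((orb '' {s | EvenDiag f G s} : Set B) → ZMod 2) where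
  toFun x a := ∑ s, if EvenDiag f G s ∧ orb s = a then (x s : ZMod 2) else 0
  map_zero' := by ext; simp
  map_add' x y := by
    ext a
    simp only [Pi.add_apply, Int.cast_add, ← Finset.sum_add_distrib]
    refine Finset.sum_congr rfl fun s _ => ?_
    split_ifs <;> simp

variable (f) in
/-- Restriction to the points of even period. -/
def restrictEven : (S → ℤ) →+ ({s // ¬ IsOddPt f s} → ℤ) where
  toFun x s := x s
  map_zero' := rfl
  map_add' _ _ := rfl

omit [Fintype S] in
theorem restrictEven_mem_normSub {x : S → ℤ} (hx : x ∈ normSub f) :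
    restrictEven f x ∈ normSub (evenPerm f) := by
  obtain ⟨h, hh⟩ := hx
  exact ⟨restrictEven f h, fun t => hh t⟩

open Classical in
/-- The form restricted to the points of even period. -/
abbrev res (f : Equiv.Perm S) (G₀ : S → S → ℤ) :
    {s // ¬ IsOddPt f s} → {s // ¬ IsOddPt f s} → ℤ := fun s t => G₀ s t

open Classical in
theorem normSub_le_coinvSub : normSub (evenPerm f) ≤ coinvSub (evenPerm f) (res f G₀) := by
  rintro x ⟨h, hh⟩
  exact ⟨0, h, fun t => by simp [hh]⟩

open Classical in
variable (f G G₀ orb) in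
/-- The map whose fibres compute the index. -/
noncomputable def indexMap : (S → ℤ) →+ (({s // ¬ IsOddPt f s} → ℤ) ⧸ coinvSub (evenPerm f)
    (res f G₀)) × ((orb '' {s | EvenDiag f G s} : Set B) → ZMod 2) :=
  ((QuotientAddGroup.mk' _).comp (restrictEven f)).prod (orbSum f G orb)

/-- Over an orbit `h` and `h ∘ f` have the same sum, so a norm has an even one. -/
theorem orbSum_normSub (hG : IsGreenPair f G G₀)
    (horb : ∀ s t, orb s = orb t ↔ ∃ k, f^[k] s = t) {x : S → ℤ} (hx : x ∈ normSub f) :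
    orbSum f G orb x = 0 := by
  classical
  obtain ⟨h, hh⟩ := hx
  ext a
  simp only [orbSum, AddMonoidHom.coe_mk, ZeroHom.coe_mk, Pi.zero_apply]
  have h1 : ∀ s, orb (f s) = orb s := fun s => ((horb s (f s)).2 ⟨1, rfl⟩).symm
  have h2 : ∑ s, (if EvenDiag f G s ∧ orb s = a then ((h (f s) : ℤ) : ZMod 2) else 0) =
      ∑ s, if EvenDiag f G s ∧ orb s = a then ((h s : ℤ) : ZMod 2) else 0 := by
    rw [← Equiv.sum_comp f fun s => if EvenDiag f G s ∧ orb s = a then ((h s : ℤ) : ZMod 2) else 0]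
    refine Finset.sum_congr rfl fun s _ => ?_
    rw [hG.evenDiag_map, h1]
  calc _ = ∑ s, ((if EvenDiag f G s ∧ orb s = a then ((h s : ℤ) : ZMod 2) else 0) +
        if EvenDiag f G s ∧ orb s = a then ((h (f s) : ℤ) : ZMod 2) else 0) :=
        Finset.sum_congr rfl fun s _ => by rw [hh]; split_ifs <;> simp
    _ = 0 := by rw [Finset.sum_add_distrib, h2, CharTwo.add_self_eq_zero]

theorem indexMap_normSub (hG : IsGreenPair f G G₀)
    (horb : ∀ s t, orb s = orb t ↔ ∃ k, f^[k] s = t) {x : S → ℤ} (hx : x ∈ normSub f) :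
    indexMap f G G₀ orb x = 0 :=
  Prod.ext ((QuotientAddGroup.eq_zero_iff _).2
    (normSub_le_coinvSub (restrictEven_mem_normSub hx))) (hG.orbSum_normSub horb hx)

open Classical in
-- By `row` two terms have to be killed. The row of `G₀` dies in the quotient by `coinvSub` and
-- vanishes on odd periods. The diagonal term sits at one point of odd period, where it is either
-- even or ignored by the orbit sums.
theorem indexMap_row (hG : IsGreenPair f G G₀)
    (horb : ∀ s t, orb s = orb t ↔ ∃ k, f^[k] s = t) (s : S) :
    indexMap f G G₀ orb (G s) = 0 := by
  have h1 := hG.indexMap_normSub horb (hG.row s)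
  have h2 : indexMap f G G₀ orb (G₀ s) = 0 := by
    refine Prod.ext ((QuotientAddGroup.eq_zero_iff _).2 ?_) ?_
    · by_cases hs : IsOddPt f s
      · convert (coinvSub (evenPerm f) (res f G₀)).zero_mem
        ext t
        exact hG.left_zero s t hs
      · refine ⟨Pi.single ⟨s, hs⟩ 1, 0, fun t => ?_⟩
        simp [Pi.single_apply, restrictEven]
    · ext a
      simp only [indexMap, AddMonoidHom.prod_apply, orbSum, AddMonoidHom.coe_mk, ZeroHom.coe_mk]
      refine Finset.sum_eq_zero fun t _ => ?_
      split_ifs with h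
      · rw [hG.right_zero s t h.1.1, Int.cast_zero]
      · rfl
  have h3 : indexMap f G G₀ orb
      (fun t => if IsOddPt f s then G s s * (Pi.single s 1 : S → ℤ) t else 0) = 0 := by
    refine Prod.ext ((QuotientAddGroup.eq_zero_iff _).2 ?_) ?_
    · convert (coinvSub (evenPerm f) (res f G₀)).zero_mem
      ext t
      simp only [restrictEven, AddMonoidHom.coe_mk, ZeroHom.coe_mk, Pi.zero_apply]
      split_ifs with hs
      · have : (t : S) ≠ s := fun h => t.2 (h ▸ hs)
        simp [this]
      · rfl
    · ext a
      simp only [indexMap, AddMonoidHom.prod_apply, orbSum, AddMonoidHom.coe_mk, ZeroHom.coe_mk]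
      refine Finset.sum_eq_zero fun t _ => ?_
      split_ifs with h h'
      · by_cases hts : t = s
        · subst hts
          simp [(ZMod.intCast_eq_zero_iff_even (n := G t t)).2 h.1.2]
        · simp [hts]
      · simp
      · rfl
  have h4 : G s = (fun t => G s t - G₀ s t -
      if IsOddPt f s then G s s * (Pi.single s 1 : S → ℤ) t else 0) + G₀ s +
      (fun t => if IsOddPt f s then G s s * (Pi.single s 1 : S → ℤ) t else 0) := by
    ext t
    simp only [Pi.add_apply]
    ring
  rw [h4, map_add, map_add, h1, h2, h3, add_zero, add_zero]

end IsGreenPair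

end Index

/-! ### Index of the subgroup enlarged by one row -/

namespace IsGreenPair

variable {S : Type*} [Fintype S] {f : Equiv.Perm S} {G G₀ : S → S → ℤ} {B : Type*} {orb : S → B}

/-- The subgroup generated by `tamSub` and one row of `G`. -/
def fullSub (f : Equiv.Perm S) (G : S → S → ℤ) (s₀ : S) : AddSubgroup (S → ℤ) :=
  tamSub f (-1) G ⊔ AddSubgroup.zmultiples (G s₀)

theorem row_mem_fullSub (s₀ s : S) : G s ∈ fullSub f G s₀ := by
  have h1 : G s - G s₀ ∈ fullSub f G s₀ :=
    AddSubgroup.mem_sup_left (row_sub_row_mem f (-1) G s s₀)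
  have h2 : G s₀ ∈ fullSub f G s₀ :=
    AddSubgroup.mem_sup_right (AddSubgroup.mem_zmultiples _)
  simpa using! add_mem h1 h2

theorem normSub_le_fullSub (s₀ : S) : normSub f ≤ fullSub f G s₀ :=
  (norm_le f G).trans le_sup_left

open Classical in
theorem row_zero_mem_fullSub (hG : IsGreenPair f G G₀) (s₀ : S) {s : S} (hs : ¬ IsOddPt f s) :
    G₀ s ∈ fullSub f G s₀ := by
  have h := normSub_le_fullSub (G := G) s₀ (hG.row s)
  simp only [if_neg hs, sub_zero] at h
  have := sub_mem (row_mem_fullSub (f := f) s₀ s) h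
  convert this using 1
  ext t
  simp

open Classical in
-- Modulo norms the row of `s` is `G s s` times the point mass at `s`. This coefficient is odd, and
-- twice the point mass is a norm.
theorem single_mem_fullSub (hG : IsGreenPair f G G₀) (s₀ : S) {s : S} (hs : IsOddPt f s)
    (hs' : ¬ EvenDiag f G s) : (Pi.single s 1 : S → ℤ) ∈ fullSub f G s₀ := by
  have h := normSub_le_fullSub (G := G) s₀ (hG.row s)
  simp only [if_pos hs, hG.left_zero s _ hs, sub_zero] at h
  have hodd : Odd (G s s) := Int.not_even_iff_odd.1 fun h => hs' ⟨hs, h⟩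
  obtain ⟨c, hc⟩ := hodd
  have h2 := normSub_le_fullSub (G := G) s₀ (two_mul_single_mem_normSub hs)
  have := sub_mem (sub_mem (row_mem_fullSub (f := f) (G := G) s₀ s) h)
    (zsmul_mem h2 c)
  convert this using 1
  ext t
  simp only [Pi.sub_apply, Pi.smul_apply, hc, smul_eq_mul]
  simp only [two_nsmul]
  ring

open Classical in
/-- A function supported on the points with even diagonal value, with even sums over orbits. -/
theorem mem_normSub_of_orbSum [Nonempty S]
    (horb : ∀ s t, orb s = orb t ↔ ∃ k, f^[k] s = t) {x : S → ℤ} (hx : orbSum f G orb x = 0) :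
    (∑ s, if EvenDiag f G s then x s • (Pi.single s 1 : S → ℤ) else 0) ∈ normSub f := by
  set Q := {s | EvenDiag f G s}
  -- Moving the values on an orbit to one representative costs only norms; what is collected there
  -- is the orbit sum, which is even.
  let rep : S → S := fun s => Function.invFunOn orb Q (orb s)
  have hrep1 : ∀ s, EvenDiag f G s → EvenDiag f G (rep s) := fun s hs =>
    Function.invFunOn_apply_mem (f := orb) (s := Q) hs
  have hrep2 : ∀ s, EvenDiag f G s → orb (rep s) = orb s := fun s hs =>
    Function.invFunOn_apply_eq (f := orb) (s := Q) hs
  have h1 : (∑ s, if EvenDiag f G s then x s • ((Pi.single s 1 : S → ℤ) - Pi.single (rep s) 1)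
      else 0) ∈ normSub f := by
    refine AddSubgroup.sum_mem _ fun s _ => ?_
    split_ifs with hs
    · refine (normSub f).zsmul_mem ?_ _
      obtain ⟨k, hk⟩ := (horb s (rep s)).1 (hrep2 s hs).symm
      rw [← hk]
      exact single_sub_single_mem_normSub hs.1 k
    · exact zero_mem _
  have h2 : (∑ s, if EvenDiag f G s then x s • (Pi.single (rep s) 1 : S → ℤ) else 0) ∈
      normSub f := by
    have happ : ∀ t, (∑ s, if EvenDiag f G s then x s • (Pi.single (rep s) 1 : S → ℤ) else 0) t =
        ∑ s, if EvenDiag f G s ∧ rep s = t then x s else 0 := fun t => by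
      rw [Finset.sum_apply]
      refine Finset.sum_congr rfl fun s _ => ?_
      by_cases hs : EvenDiag f G s <;> by_cases ht : rep s = t <;>
        simp [hs, ht, eq_comm, Pi.single_apply]
    refine even_mem_normSub (fun t => ?_) fun t ht => ?_
    · rw [happ]
      by_cases hex : ∃ s', EvenDiag f G s' ∧ rep s' = t
      · obtain ⟨s', hs', rfl⟩ := hex
        have h3 := congrFun hx ⟨orb s', s', hs', rfl⟩
        simp only [orbSum, AddMonoidHom.coe_mk, ZeroHom.coe_mk, Pi.zero_apply] at h3
        rw [← ZMod.intCast_eq_zero_iff_even, ← h3, Int.cast_sum]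
        refine Finset.sum_congr rfl fun s _ => ?_
        rw [apply_ite (Int.cast : ℤ → ZMod 2), Int.cast_zero]
        refine if_congr (and_congr_right fun hs => ⟨fun h => ?_, fun h => ?_⟩) rfl rfl
        · rw [← hrep2 s hs, h, hrep2 s' hs']
        · exact congrArg (Function.invFunOn orb Q) h
      · rw [Finset.sum_eq_zero]
        · exact Even.zero
        · intro s _
          exact if_neg fun h => hex ⟨s, h⟩
    · rw [happ]
      refine Finset.sum_eq_zero fun s _ => if_neg ?_
      rintro ⟨h, rfl⟩
      exact ht (hrep1 s h).1
  convert (normSub f).add_mem h1 h2 using 1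
  rw [← Finset.sum_add_distrib]
  refine Finset.sum_congr rfl fun s _ => ?_
  split_ifs
  · rw [← smul_add, sub_add_cancel]
  · rw [add_zero]

open Classical in
-- A kernel element splits by type of point. On even periods it is a combination of rows of `G₀`
-- plus a norm; point masses with odd diagonal lie in `fullSub`; at the remaining points the even
-- orbit sums make it a norm.
theorem ker_indexMap_le (hG : IsGreenPair f G G₀)
    (horb : ∀ s t, orb s = orb t ↔ ∃ k, f^[k] s = t) (s₀ : S) :
    (indexMap f G G₀ orb).ker ≤ fullSub f G s₀ := by
  intro x hx
  have : Nonempty S := ⟨s₀⟩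
  rw [AddMonoidHom.mem_ker] at hx
  have hx1 : restrictEven f x ∈ coinvSub (evenPerm f) (res f G₀) :=
    (QuotientAddGroup.eq_zero_iff _).1 (congrArg Prod.fst hx)
  have hx2 : orbSum f G orb x = 0 := congrArg Prod.snd hx
  obtain ⟨n, h, hn⟩ := hx1
  let h' : S → ℤ := fun s => if hs : ¬ IsOddPt f s then h ⟨s, hs⟩ else 0
  have h1 : (∑ s : {s // ¬ IsOddPt f s}, n s • G₀ s) ∈ fullSub f G s₀ :=
    AddSubgroup.sum_mem _ fun s _ => zsmul_mem (hG.row_zero_mem_fullSub s₀ s.2) _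
  have h2 : (fun t => h' t + h' (f t)) ∈ fullSub f G s₀ :=
    normSub_le_fullSub s₀ ⟨h', fun _ => rfl⟩
  have h3 : (∑ s, if IsOddPt f s ∧ ¬ EvenDiag f G s then x s • (Pi.single s 1 : S → ℤ) else 0) ∈
      fullSub f G s₀ := by
    refine AddSubgroup.sum_mem _ fun s _ => ?_
    split_ifs with hs
    · exact zsmul_mem (hG.single_mem_fullSub s₀ hs.1 hs.2) _
    · exact zero_mem _
  have h4 := normSub_le_fullSub (G := G) s₀ (mem_normSub_of_orbSum horb hx2)
  convert add_mem (add_mem h1 h2) (add_mem h3 h4) using 1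
  ext t
  simp only [Pi.add_apply, Finset.sum_apply, Pi.smul_apply, smul_eq_mul]
  have h5 : ∀ (P : S → Prop) [DecidablePred P],
      ∑ s, (if P s then x s • (Pi.single s 1 : S → ℤ) else 0) t = if P t then x t else 0 := by
    intro P _
    rw [Finset.sum_eq_single t]
    · split_ifs <;> simp
    · intro s _ hs
      split_ifs <;> simp [Ne.symm hs]
    · simp
  rw [h5, h5]
  by_cases ht : IsOddPt f t
  · have ht' : IsOddPt f (f t) := (isOddPt_apply_iff f.injective t).2 ht
    rw [Finset.sum_eq_zero fun s _ => by rw [hG.right_zero _ _ ht, mul_zero]]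
    by_cases hq : EvenDiag f G t <;> simp [h', ht, ht', hq]
  · have ht' : ¬ IsOddPt f (f t) := mt (isOddPt_apply_iff f.injective t).1 ht
    have := hn ⟨t, ht⟩
    have hq : ¬ EvenDiag f G t := fun h => ht h.1
    simp only [h', ht, ht', hq, not_false_eq_true, dite_true, false_and, if_false, add_zero]
    exact this

open Classical in
theorem fullSub_eq (hG : IsGreenPair f G G₀)
    (horb : ∀ s t, orb s = orb t ↔ ∃ k, f^[k] s = t) (s₀ : S) :
    tamSub f (-1) G ⊔ (indexMap f G G₀ orb).ker = fullSub f G s₀ := by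
  apply le_antisymm
  · exact sup_le le_sup_left (hG.ker_indexMap_le horb s₀)
  · refine sup_le le_sup_left (le_sup_of_le_right ?_)
    rw [AddSubgroup.zmultiples_le]
    exact hG.indexMap_row horb s₀

open Classical in
theorem indexMap_surjective [Nonempty S] : Function.Surjective (indexMap f G G₀ orb) := by
  rintro ⟨y, z⟩
  obtain ⟨y, rfl⟩ := QuotientAddGroup.mk_surjective y
  let rep : B → S := Function.invFunOn orb {s | EvenDiag f G s}
  have hrep : ∀ a ∈ orb '' {s | EvenDiag f G s}, EvenDiag f G (rep a) ∧ orb (rep a) = a :=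
    fun a ha =>
    Function.invFunOn_pos (f := orb) (s := {s | EvenDiag f G s}) ha
  -- Each prescribed orbit sum is concentrated at the chosen representative of its orbit.
  refine ⟨fun s => if hs : ¬ IsOddPt f s then y ⟨s, hs⟩ else
    if hs' : EvenDiag f G s ∧ rep (orb s) = s then
      ((z ⟨orb s, s, hs'.1, rfl⟩).val : ℤ) else 0, Prod.ext ?_ ?_⟩
  · refine congrArg (QuotientAddGroup.mk) ?_
    ext t
    exact dif_pos t.2
  · ext a
    simp only [indexMap, AddMonoidHom.prod_apply, orbSum, AddMonoidHom.coe_mk, ZeroHom.coe_mk]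
    have ha := hrep a a.2
    rw [Finset.sum_eq_single (rep a)]
    · rw [if_pos ha, dif_neg (not_not.2 ha.1.1), dif_pos ⟨ha.1, by rw [ha.2]⟩]
      simp [ha.2]
    · intro s _ hs
      split_ifs with h1 h2 h3
      · exact absurd (h3.2.symm.trans (congrArg rep h1.2)) hs
      · simp
      · exact absurd h1.1.1 h2
      · rfl
    · simp

open Classical in
theorem one_mem_normSub_evenPerm : (1 : {s // ¬ IsOddPt f s} → ℤ) ∈ normSub (evenPerm f) :=
  indicator_mem_normSub (k := 1) odd_one (fun _ => rfl) fun s hs =>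
    absurd hs (not_isOddPt_evenPerm f s)

open Classical in
-- On even periods the constant `1` is a norm, and each orbit that is counted has odd size.
theorem indexMap_one (hG : IsGreenPair f G G₀)
    (horb : ∀ s t, orb s = orb t ↔ ∃ k, f^[k] s = t) :
    indexMap f G G₀ orb 1 = (0, 1) := by
  refine Prod.ext ((QuotientAddGroup.eq_zero_iff _).2
    (normSub_le_coinvSub one_mem_normSub_evenPerm)) ?_
  ext ⟨a, s₀, hs₀, rfl⟩
  simp only [indexMap, AddMonoidHom.prod_apply, orbSum, AddMonoidHom.coe_mk, ZeroHom.coe_mk,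
    Pi.one_apply, Int.cast_one]
  rw [Finset.sum_boole, ← Nat.cast_one, ZMod.natCast_eq_natCast_iff', Nat.one_mod,
    ← Nat.odd_iff]
  have h1 : ((Finset.univ.filter fun s => EvenDiag f G s ∧ orb s = orb s₀ : Finset S) : Set S) =
      iterOrbit f s₀ := by
    ext s
    simp only [Finset.coe_filter, Finset.mem_univ, true_and, Set.mem_ofPred_eq, iterOrbit,
      Set.mem_range]
    constructor
    · rintro ⟨-, h⟩
      exact (horb s₀ s).1 h.symm
    · rintro ⟨k, rfl⟩
      exact ⟨(hG.evenDiag_iterate s₀ k).2 hs₀, ((horb _ _).2 ⟨k, rfl⟩).symm⟩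
  rw [← Set.ncard_coe_finset, h1]
  exact (odd_iterOrbit_iff f.injective s₀).2 hs₀.1

open Classical in
-- `fullSub` is `tamSub` enlarged by the kernel of the surjective `indexMap`, so its index is that
-- of the image of `tamSub`. Rows and norms die there, leaving only the multiples of `(0, 1)` that
-- come from the constants.
theorem index_fullSub (hG : IsGreenPair f G G₀)
    (horb : ∀ s t, orb s = orb t ↔ ∃ k, f^[k] s = t) (s₀ : S) :
    (fullSub f G s₀).index = (coinvSub (evenPerm f) (res f G₀)).index *
      (if 1 ≤ (orb '' {s | EvenDiag f G s}).ncard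
        then 2 ^ ((orb '' {s | EvenDiag f G s}).ncard - 1) else 1) := by
  have : Nonempty S := ⟨s₀⟩
  have h1 : (tamSub f (-1) G).map (indexMap f G G₀ orb) =
      (⊥ : AddSubgroup _).prod (AddSubgroup.zmultiples 1) := by
    ext ⟨y, z⟩
    rw [AddSubgroup.mem_prod, AddSubgroup.mem_map, AddSubgroup.mem_bot,
      AddSubgroup.mem_zmultiples_iff]
    constructor
    · rintro ⟨x, ⟨a, n, h, hn, hx⟩, hxy⟩
      have h2 : x = a • (1 : S → ℤ) + ∑ s, n s • G s + fun t => h t + h (f t) := by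
        ext t
        simp [hx, Finset.sum_apply]
      rw [h2, map_add, map_add, map_zsmul, hG.indexMap_one horb, map_sum,
        hG.indexMap_normSub horb ⟨h, fun _ => rfl⟩,
        Finset.sum_eq_zero fun s _ => by rw [map_zsmul, hG.indexMap_row horb, smul_zero],
        add_zero, add_zero] at hxy
      have h3 := congrArg Prod.fst hxy
      have h4 := congrArg Prod.snd hxy
      simp only [Prod.smul_mk, smul_zero] at h3 h4
      exact ⟨h3.symm, a, h4⟩
    · rintro ⟨h, a, rfl⟩
      dsimp only at h
      have h1 : (1 : S → ℤ) ∈ tamSub f (-1) G := ⟨1, 0, 0, by simp, by simp⟩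
      refine ⟨a • 1, zsmul_mem h1 a, ?_⟩
      rw [map_zsmul, hG.indexMap_one horb, h]
      simp
  have h2 := AddSubgroup.index_map (tamSub f (-1) G) (indexMap f G G₀ orb)
  rw [h1, hG.fullSub_eq horb s₀, AddMonoidHom.range_eq_top_of_surjective _ indexMap_surjective,
    AddSubgroup.index_top, mul_one, AddSubgroup.index_prod] at h2
  rw [← h2, AddSubgroup.index_bot]
  congr 1
  set A := orb '' {s | EvenDiag f G s}
  have h3 := AddSubgroup.index_mul_card (AddSubgroup.zmultiples (1 : A → ZMod 2))
  have : Fintype A := Fintype.ofFinite A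
  rw [Nat.card_fun, Nat.card_zmod, Nat.card_coe_set_eq] at h3
  rw [Nat.card_zmultiples] at h3
  -- The all-ones vector has order two, unless there are no orbits and the whole factor is trivial.
  split_ifs with hA
  · have hne : Nonempty A := by
      rw [← Nat.card_coe_set_eq] at hA
      exact (Nat.card_pos_iff.1 hA).1
    have h4 : addOrderOf (1 : A → ZMod 2) = 2 := by
      refine addOrderOf_eq_prime ?_ one_ne_zero
      ext a
      exact CharTwo.two_nsmul (1 : ZMod 2)
    rw [h4] at h3
    obtain ⟨m, hm⟩ := Nat.exists_eq_add_of_le hA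
    rw [hm, pow_add, pow_one, mul_comm] at h3
    rw [hm, Nat.add_sub_cancel_left]
    exact Nat.eq_of_mul_eq_mul_left two_pos h3
  · rw [show A.ncard = 0 by omega, pow_zero] at h3
    exact Nat.eq_one_of_mul_eq_one_right h3

end IsGreenPair

/-! ### Whether a row already lies in the subgroup -/

namespace IsGreenPair

variable {S : Type*} [Fintype S] {f : Equiv.Perm S} {G G₀ : S → S → ℤ} {B : Type*} {orb : S → B}

theorem index_tamSub_of_mem {s₀ : S} (h : G s₀ ∈ tamSub f (-1) G) :
    (tamSub f (-1) G).index = (fullSub f G s₀).index := by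
  rw [fullSub, sup_eq_left.2 (AddSubgroup.zmultiples_le.2 h)]

/-- The quotient of `fullSub` by `tamSub` is generated by the class of `G s₀`, whose double vanishes
by `two_row_mem`. -/
theorem index_tamSub_of_notMem (hG : IsGreenPair f G G₀) {s₀ : S}
    (h : G s₀ ∉ tamSub f (-1) G) :
    (tamSub f (-1) G).index = 2 * (fullSub f G s₀).index := by
  have hle : tamSub f (-1) G ≤ fullSub f G s₀ := le_sup_left
  rw [← AddSubgroup.relIndex_mul_index hle]
  congr 1
  rw [AddSubgroup.relIndex_eq_two_iff]
  refine ⟨G s₀, row_mem_fullSub s₀ s₀, fun b hb => ?_⟩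
  obtain ⟨p, hp, q, hq, rfl⟩ := AddSubgroup.mem_sup.1 hb
  obtain ⟨k, rfl⟩ := AddSubgroup.mem_zmultiples_iff.1 hq
  have h2 : ∀ c : ℤ, c • 2 • G s₀ ∈ tamSub f (-1) G := fun c => zsmul_mem (hG.two_row_mem s₀) c
  rcases Int.even_or_odd' k with ⟨c, rfl | rfl⟩
  · have h3 : p + (2 * c) • G s₀ ∈ tamSub f (-1) G := by
      convert add_mem hp (h2 c) using 2
      rw [mul_comm, mul_smul]; rfl
    exact Or.inr ⟨h3, fun h4 => h (by simpa using sub_mem h4 h3)⟩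
  · have h3 : p + (2 * c + 1) • G s₀ + G s₀ ∈ tamSub f (-1) G := by
      convert add_mem hp (h2 (c + 1)) using 1
      rw [add_assoc]
      congr 1
      simp only [add_smul, one_smul, two_nsmul, mul_smul, two_zsmul, smul_add]
      abel
    refine Or.inl ⟨h3, fun h4 => h (by simpa using sub_mem h3 h4)⟩

open Classical in
-- The diagonal term left over by `row` is now even, hence a norm.
theorem row_mem_of_evenDiag (hG : IsGreenPair f G G₀) {s : S} (hs : EvenDiag f G s) :
    G s ∈ tamSub f (-1) G := by
  have h1 := hG.row s
  simp only [if_pos hs.1, hG.left_zero s _ hs.1, sub_zero] at h1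
  have h2 : (fun t => G s s * (Pi.single s 1 : S → ℤ) t) ∈ normSub f :=
    even_mem_normSub (fun t => hs.2.mul_right _) fun t ht => by
      have : t ≠ s := by rintro rfl; exact ht hs.1
      simp [this]
  convert norm_le f G (add_mem h1 h2) using 1
  ext t
  simp

open Classical in
theorem even_sum_even (f : Equiv.Perm S) :
    Even (∑ s, if IsOddPt f s then (0 : ℤ) else 1) :=
  even_sum_of_mem_normSub (f := f) (indicator_mem_normSub odd_one
    (fun t => by simp [isOddPt_apply_iff f.injective]) fun s hs => if_pos hs)

open Classical in
theorem sum_odd_add_sum_even (f : Equiv.Perm S) (m : S → ℤ) :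
    (∑ s, if IsOddPt f s then m s else 0) + (∑ s, if IsOddPt f s then 0 else m s) = ∑ s, m s := by
  rw [← Finset.sum_add_distrib]
  exact Finset.sum_congr rfl fun s _ => by split_ifs <;> simp

open Classical in
-- All diagonal entries at odd periods are odd, so the rows of these points add up, modulo norms, to
-- their indicator, which is congruent to the constant `1`. There are oddly many of them, so an odd
-- multiple of `G s₀` lies in `tamSub`, and so does `2 • G s₀`.
theorem row_mem_of_odd_card (hG : IsGreenPair f G G₀) (hA : ∀ s, ¬ EvenDiag f G s)
    (hS : ¬ Even (Fintype.card S)) (s₀ : S) : G s₀ ∈ tamSub f (-1) G := by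
  have h1 : (∑ s, if IsOddPt f s then (fun t => G s t - G₀ s t -
      if IsOddPt f s then G s s * (Pi.single s 1 : S → ℤ) t else 0) else 0) ∈ normSub f :=
    AddSubgroup.sum_mem _ fun s _ => by
      by_cases hs : IsOddPt f s
      · rw [if_pos hs]; exact hG.row s
      · rw [if_neg hs]; exact zero_mem _
  have h2 : (fun t => if IsOddPt f t then G t t - 1 else 0) ∈ normSub f :=
    even_mem_normSub (fun t => by
      by_cases ht : IsOddPt f t
      · rw [if_pos ht]
        exact (Int.not_even_iff_odd.1 fun h => hA t ⟨ht, h⟩).sub_odd odd_one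
      · simp [ht]) fun t ht => if_neg ht
  have h3 : (fun t => if IsOddPt f t then (0 : ℤ) else 1) ∈ normSub f :=
    indicator_mem_normSub odd_one
      (fun t => by simp [isOddPt_apply_iff f.injective]) fun s hs => if_pos hs
  have hone : (1 : S → ℤ) ∈ tamSub f (-1) G := ⟨1, 0, 0, by simp, by simp⟩
  have h4 : (∑ s, if IsOddPt f s then G s else 0) ∈ tamSub f (-1) G := by
    convert add_mem (norm_le f G (sub_mem (add_mem h1 h2) h3)) hone using 1
    ext t
    simp only [Finset.sum_apply, Pi.add_apply, Pi.sub_apply, Pi.one_apply]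
    have h5 : ∑ s, (if IsOddPt f s then (fun t => G s t - G₀ s t -
        if IsOddPt f s then G s s * (Pi.single s 1 : S → ℤ) t else 0) else 0) t =
        ∑ s, (if IsOddPt f s then G s else 0) t -
          ∑ s, if IsOddPt f s then G s s * (Pi.single s 1 : S → ℤ) t else 0 := by
      rw [← Finset.sum_sub_distrib]
      refine Finset.sum_congr rfl fun s _ => ?_
      by_cases hs : IsOddPt f s
      · simp [hs, hG.left_zero s t hs]
      · simp [hs]
    have h6 : (∑ s, if IsOddPt f s then G s s * (Pi.single s 1 : S → ℤ) t else 0) =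
        if IsOddPt f t then G t t else 0 := by
      rw [Finset.sum_eq_single t]
      · simp
      · intro s _ hs
        simp [Ne.symm hs]
      · simp
    rw [h5, h6]
    split_ifs <;> ring
  have h5 : (∑ s, if IsOddPt f s then G s - G s₀ else 0) ∈ tamSub f (-1) G :=
    AddSubgroup.sum_mem _ fun s _ => by
      by_cases hs : IsOddPt f s
      · rw [if_pos hs]; exact row_sub_row_mem f (-1) G s s₀
      · rw [if_neg hs]; exact zero_mem _
  set m : ℤ := ∑ s, if IsOddPt f s then 1 else 0 with hm
  have h6 : m • G s₀ ∈ tamSub f (-1) G := by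
    convert sub_mem h4 h5 using 1
    rw [← Finset.sum_sub_distrib, hm, Finset.sum_smul]
    refine Finset.sum_congr rfl fun s _ => ?_
    split_ifs <;> simp
  have hodd : Odd m := by
    have h7 := sum_odd_add_sum_even f (fun _ => 1)
    have h8 := even_sum_even f
    rw [Finset.sum_const, Finset.card_univ, nsmul_one] at h7
    rw [← Int.not_even_iff_odd]
    intro h9
    apply hS
    have := h9.add h8
    rw [h7] at this
    exact_mod_cast this
  obtain ⟨c, hc⟩ := hodd
  have h9 := zsmul_mem (hG.two_row_mem s₀) c
  convert sub_mem h6 h9 using 1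
  rw [hc]
  ext t
  simp only [Pi.sub_apply, Pi.smul_apply, smul_eq_mul, two_nsmul, Pi.add_apply]
  ring

theorem iterate_zero (hG : IsGreenPair f G G₀) (k : ℕ) (s t : S) :
    G₀ (f^[k] s) (f^[k] t) = G₀ s t := by
  induction k with
  | zero => rfl
  | succ k ih => rw [Function.iterate_succ_apply', Function.iterate_succ_apply', hG.map_zero, ih]

omit [Fintype S] in
theorem isOddPt_iterate (k : ℕ) (s : S) : IsOddPt f (f^[k] s) ↔ IsOddPt f s := by
  induction k with
  | zero => rfl
  | succ k ih => rw [Function.iterate_succ_apply', isOddPt_apply_iff f.injective, ih]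

theorem sum_comp_iterate (k : ℕ) (g : S → ℤ) : ∑ s, g (f^[k] s) = ∑ s, g s := by
  rw [Equiv.Perm.iterate_eq_pow]
  exact Equiv.sum_comp (f ^ k) g

open Classical in
/-- If `G₀ m` is a norm then the degree of `m` on the points of even period is even. -/
theorem even_sum_of_norm (hG : IsGreenPair f G G₀) {m : S → ℤ}
    (hm : (fun t => ∑ s, m s * G₀ s t) ∈ normSub f) :
    Even (∑ s, if IsOddPt f s then 0 else m s) := by
  obtain ⟨h, hh⟩ := hm
  dsimp only at hh
  set M := orderOf f
  have hM : 0 < M := orderOf_pos f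
  have hper : ∀ t, f^[2 * M] t = t := fun t => by
    rw [Equiv.Perm.iterate_eq_pow, mul_comm, pow_mul, pow_orderOf_eq_one, one_pow]; rfl
  -- In an alternating sum of translates the function `h + h ∘ f` telescopes, and it closes up to
  -- zero because `2 * M` is an even period of every point. Nondegeneracy then kills `A` on the
  -- points of even period.
  let A : S → ℤ := fun s => ∑ i ∈ Finset.range (2 * M), (-1) ^ i * m (f^[i] s)
  have h1 : ∀ t, ∑ s, A s * G₀ s t = 0 := fun t => by
    calc ∑ s, A s * G₀ s t
        = ∑ i ∈ Finset.range (2 * M), (-1) ^ i * ∑ s, m (f^[i] s) * G₀ (f^[i] s) (f^[i] t) := by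
          simp only [A, Finset.sum_mul, Finset.mul_sum, hG.iterate_zero]
          rw [Finset.sum_comm]
          refine Finset.sum_congr rfl fun i _ => Finset.sum_congr rfl fun s _ => ?_
          ring
      _ = ∑ i ∈ Finset.range (2 * M),
            ((-1) ^ i * h (f^[i] t) - (-1) ^ (i + 1) * h (f^[i + 1] t)) := by
          refine Finset.sum_congr rfl fun i _ => ?_
          rw [sum_comp_iterate i fun s => m s * G₀ s (f^[i] t), hh, Function.iterate_succ_apply',
            pow_succ]
          ring
      _ = 0 := by
          rw [Finset.sum_range_sub' fun i => (-1) ^ i * h (f^[i] t), hper]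
          simp
  have h2 : (fun s => if IsOddPt f s then 0 else A s) = 0 := by
    refine hG.nondeg _ (fun s hs => if_pos hs) fun t _ => ?_
    rw [← h1 t]
    refine Finset.sum_congr rfl fun s _ => ?_
    by_cases hs : IsOddPt f s
    · simp [hs, hG.left_zero s t hs]
    · simp [hs]
  -- Pairing `A` with an alternating sign gives `2 * M` times the sum of `τ m` over the even
  -- periods. That sum is therefore zero, and it has the parity of the sum of `m`.
  obtain ⟨τ, hτ1, hτ2⟩ := exists_alternating f.injective
  let g : S → ℤ := fun s => if IsOddPt f s then 0 else τ s * m s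
  have h3 : ∑ s, τ s * (if IsOddPt f s then 0 else A s) = (2 * M : ℕ) * ∑ s, g s := by
    calc ∑ s, τ s * (if IsOddPt f s then 0 else A s)
        = ∑ s, ∑ i ∈ Finset.range (2 * M), g (f^[i] s) := by
          refine Finset.sum_congr rfl fun s _ => ?_
          by_cases hs : IsOddPt f s
          · simp [g, hs, isOddPt_iterate]
          · simp only [if_neg hs, A, g, isOddPt_iterate, Finset.mul_sum]
            refine Finset.sum_congr rfl fun i _ => ?_
            rw [alternating_iterate f.injective hτ2 hs]
            ring
      _ = (2 * M : ℕ) * ∑ s, g s := by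
          rw [Finset.sum_comm]
          simp only [sum_comp_iterate _ g, Finset.sum_const, Finset.card_range, nsmul_eq_mul]
  have h4 : ∑ s, g s = 0 := by
    have : ∑ s, τ s * (if IsOddPt f s then 0 else A s) = 0 :=
      Finset.sum_eq_zero fun s _ => by rw [show (if IsOddPt f s then 0 else A s) = 0 from
        congrFun h2 s, mul_zero]
    rw [this] at h3
    rcases mul_eq_zero.1 h3.symm with h' | h'
    · exfalso
      have : 2 * M = 0 := by exact_mod_cast h'
      omega
    · exact h'
  have h5 : ∑ s, (if IsOddPt f s then 0 else m s) =
      ∑ s, ((if IsOddPt f s then 0 else m s) - g s) := by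
    rw [Finset.sum_sub_distrib, h4, sub_zero]
  rw [h5]
  refine Finset.even_sum _ fun s _ => ?_
  simp only [g]
  split_ifs
  · simp
  · rcases hτ1 s with h' | h' <;> rw [h'] <;> simp

open Classical in
-- Otherwise some `m` of degree one would have `G m` equal to a constant plus a norm, and this
-- splits by period. On odd periods the diagonal entries are odd, the number of points is even and
-- norms have even total, so `m` has even degree there. On even periods its degree is even by
-- `even_sum_of_norm`.
theorem row_notMem_of_even_card (hG : IsGreenPair f G G₀) (hA : ∀ s, ¬ EvenDiag f G s)
    (hS : Even (Fintype.card S)) (s₀ : S) : G s₀ ∉ tamSub f (-1) G := by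
  rintro ⟨a, n, h, hn, hx⟩
  set m : S → ℤ := Pi.single s₀ 1 - n with hm
  have hm1 : ∑ s, m s = 1 := by simp [hm, hn]
  have hm2 : ∀ t, ∑ s, m s * G s t = a + (h t + h (f t)) := fun t => by
    simp only [hm, Pi.sub_apply, sub_mul, Finset.sum_sub_distrib]
    rw [Finset.sum_eq_single s₀ (fun s _ hs => by simp [hs]) (by simp), Pi.single_eq_same, one_mul,
      hx t]
    ring
  have h1 : (∑ s, m s • fun t => G s t - G₀ s t -
      if IsOddPt f s then G s s * (Pi.single s 1 : S → ℤ) t else 0) ∈ normSub f :=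
    AddSubgroup.sum_mem _ fun s _ => zsmul_mem (hG.row s) _
  have h2 : (fun t => h t + h (f t)) ∈ normSub f := ⟨h, fun _ => rfl⟩
  have h3 : (fun t => if IsOddPt f t then (0 : ℤ) else 1) ∈ normSub f :=
    indicator_mem_normSub odd_one
      (fun t => by simp [isOddPt_apply_iff f.injective]) fun s hs => if_pos hs
  have h4 : (fun t => ∑ s, m s * G₀ s t + if IsOddPt f t then m t * G t t - a else 0) ∈
      normSub f := by
    convert sub_mem (add_mem (zsmul_mem h3 a) h2) h1 using 1
    ext t
    simp only [Finset.sum_apply, Pi.add_apply, Pi.sub_apply, Pi.smul_apply, smul_eq_mul]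
    have h6 : (∑ s, m s * if IsOddPt f s then G s s * (Pi.single s 1 : S → ℤ) t else 0) =
        if IsOddPt f t then m t * G t t else 0 := by
      rw [Finset.sum_eq_single t]
      · split_ifs <;> simp
      · intro s _ hs
        simp [Ne.symm hs]
      · simp
    simp only [mul_sub, Finset.sum_sub_distrib, h6, hm2]
    split_ifs <;> ring
  obtain ⟨k, hk⟩ := h4
  have h5 : (fun t => ∑ s, m s * G₀ s t) ∈ normSub f := by
    refine ⟨fun t => if IsOddPt f t then 0 else k t, fun t => ?_⟩
    simp only [isOddPt_apply_iff f.injective]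
    by_cases ht : IsOddPt f t
    · simp [ht, hG.right_zero _ t ht]
    · simpa [ht] using hk t
  have h6 : (fun t => if IsOddPt f t then m t * G t t - a else 0) ∈ normSub f := by
    refine ⟨fun t => if IsOddPt f t then k t else 0, fun t => ?_⟩
    simp only [isOddPt_apply_iff f.injective]
    by_cases ht : IsOddPt f t
    · simpa [ht, hG.right_zero _ t ht] using hk t
    · simp [ht]
  have h7 := hG.even_sum_of_norm h5
  have h8 := even_sum_of_mem_normSub h6
  have h9 : Even (∑ s, if IsOddPt f s then (1 : ℤ) else 0) := by
    have e1 := sum_odd_add_sum_even f (fun _ => 1)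
    rw [Finset.sum_const, Finset.card_univ, nsmul_one] at e1
    rw [eq_sub_of_add_eq e1]
    exact Even.sub (by exact_mod_cast hS) (even_sum_even f)
  have h10 : Even (∑ s, if IsOddPt f s then m s else 0) := by
    have e1 : (∑ s, if IsOddPt f s then m s else 0) =
        (∑ s, if IsOddPt f s then m s * G s s - a else 0) +
        a * (∑ s, if IsOddPt f s then (1 : ℤ) else 0) -
        ∑ s, if IsOddPt f s then m s * (G s s - 1) else 0 := by
      rw [Finset.mul_sum, ← Finset.sum_add_distrib, ← Finset.sum_sub_distrib]
      refine Finset.sum_congr rfl fun s _ => ?_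
      split_ifs <;> ring
    rw [e1]
    refine (h8.add (h9.mul_left a)).sub (Finset.even_sum _ fun s _ => ?_)
    split_ifs with hs
    · exact ((Int.not_even_iff_odd.1 fun h => hA s ⟨hs, h⟩).sub_odd odd_one).mul_left _
    · exact Even.zero
  have h11 := h10.add h7
  rw [sum_odd_add_sum_even, hm1] at h11
  exact Int.not_even_one h11

open Classical in
theorem index_tamSub [Nonempty S] (hG : IsGreenPair f G G₀)
    (horb : ∀ s t, orb s = orb t ↔ ∃ k, f^[k] s = t) :
    (tamSub f (-1) G).index =
      (if 1 ≤ (orb '' {s | EvenDiag f G s}).ncard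
        then 2 ^ ((orb '' {s | EvenDiag f G s}).ncard - 1)
        else if Even (Fintype.card S) then 2 else 1) *
      (coinvSub (evenPerm f) (res f G₀)).index := by
  by_cases hA : 1 ≤ (orb '' {s | EvenDiag f G s}).ncard
  · obtain ⟨_, s, hs, -⟩ := Set.nonempty_of_ncard_ne_zero (Nat.one_le_iff_ne_zero.1 hA)
    rw [index_tamSub_of_mem (hG.row_mem_of_evenDiag hs), hG.index_fullSub horb s, if_pos hA,
      if_pos hA, mul_comm]
  · have hA' : ∀ s, ¬ EvenDiag f G s := fun s hs => hA <| by
      exact (Set.ncard_pos (Set.toFinite _)).2 ⟨_, s, hs, rfl⟩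
    obtain ⟨s⟩ := ‹Nonempty S›
    rw [if_neg hA]
    by_cases hS : Even (Fintype.card S)
    · rw [index_tamSub_of_notMem hG (hG.row_notMem_of_even_card hA' hS s),
        hG.index_fullSub horb s, if_neg hA, if_pos hS, mul_one]
    · rw [index_tamSub_of_mem (hG.row_mem_of_odd_card hA' hS s),
        hG.index_fullSub horb s, if_neg hA, if_neg hS, mul_one, one_mul]

end IsGreenPair

/-- The length of an edge, as an integer. -/
def BYPair.lenZ {V : Type*} (X : BYPair V) (e : Sym2 V) : ℤ := X.len e

/-! ### The lattice in terms of boundaries -/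

namespace BYGraph

variable {V : Type*} [Finite V] (T : BYGraph V)

/-- The boundary of a relative cycle. -/
noncomputable def bd (c : T.lattice) (v : V) : ℤ := ∑ᶠ u, c.1 u v

variable {T}

theorem bd_eq_sum [Fintype V] (c : T.lattice) (v : V) : T.bd c v = ∑ u, c.1 u v :=
  finsum_eq_sum_of_fintype _

theorem bd_eq_zero (c : T.lattice) {v : V} (hv : v ∉ T.S.verts) : T.bd c v = 0 := c.2.2.2 v hv

theorem lattice_eq_zero_of_not_adj (c : T.lattice) {u v : V} (h : ¬ T.graph.Adj u v) :
    c.1 u v = 0 := c.2.2.1 u v fun h' => h h'.1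

theorem bd_add (a b : T.lattice) (v : V) : T.bd (a + b) v = T.bd a v + T.bd b v :=
  finsum_add_distrib (Set.toFinite _) (Set.toFinite _)

theorem bd_smul (k : ℤ) (a : T.lattice) (v : V) : T.bd (k • a) v = k • T.bd a v :=
  (smul_finsum k _).symm

theorem sum_bd [Fintype V] (c : T.lattice) : ∑ v, T.bd c v = 0 := by
  have h : ∑ v, T.bd c v = -∑ v, T.bd c v := by
    simp only [bd_eq_sum]
    conv_lhs => rw [Finset.sum_comm]
    rw [← Finset.sum_neg_distrib]
    refine Finset.sum_congr rfl fun v _ => ?_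
    rw [← Finset.sum_neg_distrib]
    exact Finset.sum_congr rfl fun u _ => c.2.1 v u
  omega

theorem sum_cut_mul_bd [Fintype V] (r : V) (c : T.lattice) {u v : V} (h : T.graph.Adj u v) :
    ∑ w, T.bd c w * T.graph.cut r s(u, v) w =
      (T.graph.cut r s(u, v) v - T.graph.cut r s(u, v) u) * c.1 u v := by
  rw [← SimpleGraph.sum_cut_mul_boundary r c.2.1 (fun _ _ h => lattice_eq_zero_of_not_adj c h) h]
  refine Finset.sum_congr rfl fun w _ => ?_
  rw [bd_eq_sum, mul_comm]

/-- Summing the boundary over the vertices beyond an edge recovers the coefficient of that edge up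
to sign. -/
theorem eq_of_bd_eq (hT : T.graph.IsTree) {a b : T.lattice} (h : ∀ v, T.bd a v = T.bd b v) :
    a = b := by
  have := Fintype.ofFinite V
  ext u v
  by_cases huv : T.graph.Adj u v
  · have h1 := sum_cut_mul_bd u a huv
    have h2 := sum_cut_mul_bd u b huv
    simp only [h] at h1
    rw [h1] at h2
    exact mul_left_cancel₀ (sub_ne_zero.2 (hT.cut_ne u huv).symm) h2
  · rw [lattice_eq_zero_of_not_adj a huv, lattice_eq_zero_of_not_adj b huv]

/-- The coefficient on an edge is, up to sign, the boundary summed beyond it. The signs cancel in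
products, so the diagonalised Green form becomes the length pairing. -/
theorem pairing_eq_sum [Fintype V] (hT : T.graph.IsTree) (r : V) (a b : T.lattice) :
    T.pairing a b = ∑ t, T.bd b t * ∑ s, T.bd a s * T.graph.green T.lenZ r s t := by
  classical
  have := Fintype.ofFinite T.graph.edgeSet
  rw [SimpleGraph.sum_mul_sum_mul_green, pairing_apply, finsum_eq_sum_of_fintype,
    finsum_eq_sum_of_fintype]
  symm
  refine Fintype.sum_of_injective (Subtype.val : T.graph.edgeSet → Sym2 V)
    Subtype.val_injective _ _ (fun e he => ?_) ?_
  · induction e with | _ u v =>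
    have h : ¬ T.graph.Adj u v := fun h => he ⟨⟨s(u, v), h⟩, rfl⟩
    simp [edgeProd, lattice_eq_zero_of_not_adj a h]
  · rintro ⟨e, he⟩
    induction e with | _ u v =>
    rw [sum_cut_mul_bd r a he, sum_cut_mul_bd r b he]
    have h := hT.cut_diff_mul_self r he
    simp only [edgeProd, Sym2.lift_mk, BYPair.lenZ]
    linear_combination (T.len s(u, v) * a.1 u v * b.1 u v : ℤ) * h

theorem pairing_injective : Function.Injective T.pairing := by
  classical
  have := Fintype.ofFinite V
  rw [injective_iff_map_eq_zero]
  intro a ha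
  have h1 := T.pairing_apply a a
  rw [ha, finsum_eq_sum_of_fintype, LinearMap.zero_apply] at h1
  have h2 := (Finset.sum_eq_zero_iff_of_nonneg (fun e _ => by
    induction e with | _ u v =>
    exact mul_nonneg (Int.natCast_nonneg _) (mul_self_nonneg (a.1 u v)))).1 h1.symm
  ext u v
  by_cases huv : T.graph.Adj u v
  · have h3 := h2 s(u, v) (Finset.mem_univ _)
    rcases mul_eq_zero.1 h3 with h | h
    · exact absurd (T.len_pos s(u, v) huv) (by simpa using h)
    · exact mul_self_eq_zero.1 h
  · exact lattice_eq_zero_of_not_adj a huv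

/-- Positive definiteness makes the image of `Λ_T` a sublattice of full rank in its dual. -/
theorem finite_geomComponentGroup : Finite T.GeomComponentGroup := by
  apply Submodule.finiteQuotientOfFreeOfRankEq
  rw [LinearMap.finrank_range_of_inj (pairing_injective)]
  exact (Module.Free.chooseBasis ℤ T.lattice).toDualEquiv.finrank_eq

/-- Kernel and cokernel of an endomorphism of a finite abelian group have the same order. The
cokernel is preferable because it can be computed by lifting to functions on `S`. -/
theorem tamagawa_eq_index_range :
    T.tamagawa = (T.quotAct - LinearMap.id).toAddMonoidHom.range.index := by
  have := finite_geomComponentGroup (T := T)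
  set φ := (T.quotAct - LinearMap.id).toAddMonoidHom
  have h1 := AddSubgroup.index_ker φ
  have h2 := φ.ker.index_mul_card
  have h3 := φ.range.index_mul_card
  have h4 : T.tamagawa = Nat.card φ.ker := by
    refine Nat.card_congr (Equiv.subtypeEquivRight fun x => ?_)
    rw [AddMonoidHom.mem_ker]
    exact sub_eq_zero.symm
  rw [h4]
  rw [h1, ← h3, mul_comm] at h2
  exact Nat.eq_of_mul_eq_mul_right Nat.card_pos h2

/-! ### The dual lattice as functions modulo constants -/

section Coordinates

variable {ι : Type*} [Fintype ι] {j : ι → V}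

/-- The functional on `Λ_T` attached to a function on the marked points. -/
noncomputable def functional (T : BYGraph V) (j : ι → V) : (ι → ℤ) →+ Module.Dual ℤ T.lattice where
  toFun h :=
    { toFun := fun c => ∑ i, h i * T.bd c (j i)
      map_add' := fun a b => by simp only [bd_add, mul_add, Finset.sum_add_distrib]
      map_smul' := fun k a => by
        simp only [bd_smul, smul_eq_mul, Finset.mul_sum, RingHom.id_apply]
        exact Finset.sum_congr rfl fun _ _ => by ring }
  map_zero' := by ext; simp
  map_add' h h' := by ext; simp [add_mul, Finset.sum_add_distrib]

theorem functional_apply (h : ι → ℤ) (c : T.lattice) :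
    functional T j h c = ∑ i, h i * T.bd c (j i) := rfl

theorem sum_eq_sum_marked [Fintype V] (hj : j.Injective) (hr : Set.range j = T.S.verts)
    (c : T.lattice) (g : V → ℤ) : ∑ v, T.bd c v * g v = ∑ i, T.bd c (j i) * g (j i) := by
  symm
  refine Fintype.sum_of_injective j hj _ _ (fun v hv => ?_) fun _ => rfl
  rw [hr] at hv
  rw [bd_eq_zero c hv, zero_mul]

/-- A combination of unit flows out of an auxiliary vertex `r`; the boundary contributed at `r`
itself cancels because the total degree is zero. -/
theorem exists_bd_eq (hT : T.graph.IsTree) (hS : ∀ u v, ¬ T.S.Adj u v) (hj : j.Injective)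
    (hr : Set.range j = T.S.verts) (n : ι → ℤ) (hn : ∑ i, n i = 0) :
    ∃ c : T.lattice, ∀ i, T.bd c (j i) = n i := by
  classical
  have := Fintype.ofFinite V
  obtain ⟨r⟩ := hT.1.nonempty
  have key : ∀ v, ∑ u, ∑ i, n i * T.graph.flow r (j i) u v = ∑ i, if j i = v then n i else 0 := by
    intro v
    rw [Finset.sum_comm]
    simp only [← Finset.mul_sum, hT.sum_flow, mul_sub, Finset.sum_sub_distrib, ← Finset.sum_mul,
      hn, zero_mul, sub_zero]
    exact Finset.sum_congr rfl fun i _ => by simp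
  refine ⟨⟨fun u v => ∑ i, n i * T.graph.flow r (j i) u v, fun u v => ?_, fun u v h => ?_,
    fun v hv => ?_⟩, fun i => ?_⟩
  · rw [← Finset.sum_neg_distrib]
    refine Finset.sum_congr rfl fun i _ => ?_
    rw [SimpleGraph.flow_antisymm]; ring
  · have h' : ¬ T.graph.Adj u v := fun h' => h ⟨h', hS u v⟩
    simp [SimpleGraph.flow, h']
  · rw [finsum_eq_sum_of_fintype, key]
    refine Finset.sum_eq_zero fun i _ => if_neg ?_
    rintro rfl
    exact hv (hr ▸ ⟨i, rfl⟩)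
  · rw [bd_eq_sum, key, Finset.sum_eq_single i]
    · simp
    · intro k _ hk
      exact if_neg fun h => hk (hj h)
    · simp

/-- Testing on cycles that run between two marked points forces equal values there; conversely,
boundaries have total zero. -/
theorem functional_eq_zero_iff (hT : T.graph.IsTree) (hS : ∀ u v, ¬ T.S.Adj u v)
    (hj : j.Injective) (hr : Set.range j = T.S.verts) (h : ι → ℤ) :
    functional T j h = 0 ↔ ∃ a, ∀ i, h i = a := by
  classical
  have := Fintype.ofFinite V
  constructor
  · intro h0
    rcases isEmpty_or_nonempty ι with hι | ⟨⟨i₀⟩⟩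
    · exact ⟨0, fun i => hι.elim i⟩
    · refine ⟨h i₀, fun i => ?_⟩
      obtain ⟨c, hc⟩ := exists_bd_eq hT hS hj hr (Pi.single i 1 - Pi.single i₀ 1) (by simp)
      have := LinearMap.congr_fun h0 c
      simp only [functional_apply, hc, Pi.sub_apply, mul_sub, Finset.sum_sub_distrib,
        LinearMap.zero_apply] at this
      simpa [Pi.single_apply, sub_eq_zero] using this
  · rintro ⟨a, ha⟩
    ext c
    have h1 := sum_eq_sum_marked hj hr c 1
    simp only [Pi.one_apply, mul_one, sum_bd] at h1
    simp only [functional_apply, ha, ← Finset.mul_sum, ← h1, mul_zero, LinearMap.zero_apply]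

/-- The cycles from one marked point `i₀` to the others span the lattice, so the values on them
determine a functional. -/
theorem functional_surjective (hT : T.graph.IsTree) (hS : ∀ u v, ¬ T.S.Adj u v)
    (hj : j.Injective) (hr : Set.range j = T.S.verts) : Function.Surjective (functional T j) := by
  classical
  have := Fintype.ofFinite V
  intro ψ
  rcases isEmpty_or_nonempty ι with hι | ⟨⟨i₀⟩⟩
  · refine ⟨0, LinearMap.ext fun c => ?_⟩
    have hc : c = 0 := eq_of_bd_eq hT fun v => by
      have hv : v ∉ T.S.verts := by
        rw [← hr]
        rintro ⟨i, -⟩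
        exact hι.elim i
      rw [bd_eq_zero c hv, bd_eq_zero 0 hv]
    rw [hc, map_zero, map_zero]
  · choose c hc using fun i => exists_bd_eq hT hS hj hr
      (Pi.single i 1 - Pi.single i₀ 1 : ι → ℤ) (by simp)
    refine ⟨fun i => ψ (c i), LinearMap.ext fun x => ?_⟩
    have hsum : ∑ i, T.bd x (j i) = 0 := by
      have h1 := sum_eq_sum_marked hj hr x 1
      simpa only [Pi.one_apply, mul_one, sum_bd, eq_comm] using h1
    have hx : x = ∑ i, T.bd x (j i) • c i := by
      refine eq_of_bd_eq hT fun v => ?_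
      by_cases hv : v ∈ T.S.verts
      · rw [← hr] at hv
        obtain ⟨k, rfl⟩ := hv
        have h2 : ∀ s : Finset ι, T.bd (∑ i ∈ s, T.bd x (j i) • c i) (j k) =
            ∑ i ∈ s, T.bd x (j i) * T.bd (c i) (j k) := fun s => by
          induction s using Finset.induction_on with
          | empty => simp [bd]
          | insert a s ha ih => rw [Finset.sum_insert ha, Finset.sum_insert ha, bd_add, bd_smul, ih,
              smul_eq_mul]
        rw [h2]
        simp only [hc, Pi.sub_apply, mul_sub, Finset.sum_sub_distrib, ← Finset.sum_mul, hsum,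
          zero_mul, sub_zero]
        simp [Pi.single_apply]
      · rw [bd_eq_zero _ hv, bd_eq_zero _ hv]
    conv_rhs => rw [hx]
    rw [map_sum, functional_apply]
    refine Finset.sum_congr rfl fun i _ => ?_
    rw [map_smul, smul_eq_mul, mul_comm]

theorem pairing_eq_functional (hT : T.graph.IsTree) (hj : j.Injective)
    (hr : Set.range j = T.S.verts) (r : V) (a : T.lattice) :
    T.pairing a = functional T j fun t =>
      ∑ s, T.bd a (j s) * T.graph.green T.lenZ r (j s) (j t) := by
  have := Fintype.ofFinite V
  ext b
  rw [pairing_eq_sum hT r, sum_eq_sum_marked hj hr b, functional_apply]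
  refine Finset.sum_congr rfl fun i _ => ?_
  rw [sum_eq_sum_marked hj hr a, mul_comm]

theorem bd_act_symm {ε : ℤˣ} (hε : ∀ C, T.sign C = ε) (c : T.lattice) (v : V) :
    T.bd (T.act.symm c) v = ε * T.bd c (T.F v) := by
  have := Fintype.ofFinite V
  rw [bd_eq_sum, bd_eq_sum, Finset.mul_sum,
    ← Equiv.sum_comp T.F.toEquiv fun u => (ε : ℤ) * c.1 u (T.F v)]
  refine Finset.sum_congr rfl fun u _ => ?_
  change T.edgeSign s(u, v) * c.1 (T.F u) (T.F v) = ε * c.1 (T.F u) (T.F v)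
  by_cases h : T.graph.Adj u v ∧ ¬ T.S.Adj u v
  · have h' : s(u, v) ∈ T.graph.edgeSet \ T.S.edgeSet := h
    rw [edgeSign, dif_pos h', hε]
  · rw [c.2.2.1 _ _ (by rw [← T.sAdj_symm_iff]; simpa using h), mul_zero, mul_zero]

theorem dualAct_functional {ε : ℤˣ} (hε : ∀ C, T.sign C = ε) (f : Equiv.Perm ι)
    (hf : ∀ i, T.F (j i) = j (f i)) (h : ι → ℤ) :
    T.dualAct (functional T j fun i => h (f i)) = functional T j fun i => ε * h i := by
  ext c
  change functional T j (fun i => h (f i)) (T.act.symm c) = _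
  rw [functional_apply, functional_apply, ← Equiv.sum_comp f fun i => ε * h i * T.bd c (j i)]
  refine Finset.sum_congr rfl fun i _ => ?_
  rw [bd_act_symm hε, hf]
  ring

/-- The Tamagawa number as an index in the lattice of functions on the marked points. -/
theorem tamagawa_eq_index (hT : T.graph.IsTree) (hS : ∀ u v, ¬ T.S.Adj u v) {ε : ℤˣ}
    (hε : ∀ C, T.sign C = ε) (r : V) (hj : j.Injective) (hr : Set.range j = T.S.verts)
    (f : Equiv.Perm ι) (hf : ∀ i, T.F (j i) = j (f i)) :
    T.tamagawa =
      (tamSub f ε fun s t => T.graph.green T.lenZ r (j s) (j t)).index := by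
  have := Fintype.ofFinite V
  rw [tamagawa_eq_index_range]
  set φ := (T.quotAct - LinearMap.id).toAddMonoidHom
  let θ : (ι → ℤ) →+ T.GeomComponentGroup :=
    (LinearMap.range T.pairing).mkQ.toAddMonoidHom.comp (functional T j)
  have hθ : Function.Surjective θ :=
    (Submodule.mkQ_surjective _).comp (functional_surjective hT hS hj hr)
  rw [← AddSubgroup.index_comap_of_surjective φ.range hθ]
  congr 1
  have hεε : (ε : ℤ) * ε = 1 := by rw [← Units.val_mul, Int.units_mul_self, Units.val_one]
  ext x
  rw [AddSubgroup.mem_comap]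
  constructor
  · rintro ⟨y, hy⟩
    obtain ⟨ψ, rfl⟩ := Submodule.mkQ_surjective _ y
    obtain ⟨h, rfl⟩ := functional_surjective hT hS hj hr ψ
    have h1 : (LinearMap.range T.pairing).mkQ
        (T.dualAct (functional T j h) - functional T j h) =
        (LinearMap.range T.pairing).mkQ (functional T j x) := by rw [map_sub]; exact hy
    rw [← sub_eq_zero, ← map_sub, ← LinearMap.mem_ker, Submodule.ker_mkQ] at h1
    obtain ⟨c, hc⟩ := h1
    have h2 := dualAct_functional hε f hf fun i => h (f.symm i)
    simp only [Equiv.symm_apply_apply] at h2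
    rw [pairing_eq_functional hT hj hr r, h2, ← map_sub, ← map_sub, ← sub_eq_zero, ← map_sub,
      functional_eq_zero_iff hT hS hj hr] at hc
    obtain ⟨a, ha⟩ := hc
    -- `dualAct` composes with `f⁻¹`. For `h' = ε h ∘ f⁻¹` one has `h' - ε h' ∘ f = ε h ∘ f⁻¹ - h`.
    refine ⟨-(-a), fun i => -T.bd c (j i), fun i => ε * h (f.symm i), ?_, fun t => ?_⟩
    · have h1 := sum_eq_sum_marked hj hr c 1
      simp only [Pi.one_apply, mul_one, sum_bd] at h1
      rw [Finset.sum_neg_distrib, ← h1, neg_zero]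
    · have := ha t
      simp only [Pi.sub_apply, neg_mul, Finset.sum_neg_distrib, Equiv.symm_apply_apply] at this ⊢
      linear_combination this + h t * hεε
  · rintro ⟨a, n, h, hn, hx⟩
    obtain ⟨c, hc⟩ := exists_bd_eq hT hS hj hr n hn
    -- Since `ε * ε = 1`, `dualAct` carries this functional to the one attached to `h`.
    let y := functional T j fun i => ε * h (f i)
    refine ⟨(LinearMap.range T.pairing).mkQ y, ?_⟩
    change (LinearMap.range T.pairing).mkQ (T.dualAct y) - (LinearMap.range T.pairing).mkQ y =
      (LinearMap.range T.pairing).mkQ (functional T j x)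
    rw [← map_sub, ← sub_eq_zero, ← map_sub, ← LinearMap.mem_ker, Submodule.ker_mkQ]
    refine ⟨-c, ?_⟩
    rw [dualAct_functional hε f hf fun i => ε * h i, map_neg, pairing_eq_functional hT hj hr r,
      ← map_sub, ← map_sub, eq_comm, ← sub_eq_zero, ← map_neg, ← map_sub,
      functional_eq_zero_iff hT hS hj hr]
    refine ⟨-a, fun i => ?_⟩
    simp only [Pi.sub_apply, Pi.neg_apply, hx, hc]
    linear_combination h i * hεε

end Coordinates

end BYGraph

/-! ### Heights above the root -/

namespace SimpleGraph

variable {V : Type*} {G : SimpleGraph V}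

/-- The weighted distance to the root. -/
noncomputable def height (G : SimpleGraph V) (wt : Sym2 V → ℤ) (r v : V) : ℤ :=
  ∑ᶠ e : G.edgeSet, wt e * G.cut r e v

theorem height_root (wt : Sym2 V → ℤ) (r : V) : G.height wt r r = 0 := by
  simp [height, cut_root]

theorem green_self (wt : Sym2 V → ℤ) (r v : V) : G.green wt r v v = G.height wt r v :=
  finsum_congr fun e => by
    rcases cut_eq_zero_or_one (G := G) r e v with h | h <;> rw [h] <;> ring

theorem height_sub [Finite V] (wt : Sym2 V → ℤ) (r : V) {u v : V} (h : G.Adj u v) :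
    G.height wt r v - G.height wt r u =
      wt s(u, v) * (G.cut r s(u, v) v - G.cut r s(u, v) u) := by
  classical
  have := Fintype.ofFinite G.edgeSet
  unfold height
  rw [finsum_eq_sum_of_fintype, finsum_eq_sum_of_fintype, ← Finset.sum_sub_distrib,
    Finset.sum_eq_single (⟨s(u, v), h⟩ : G.edgeSet)]
  · ring
  · intro e _ he
    rw [cut_eq_of_adj r h fun h' => he (Subtype.ext h'.symm), sub_self]
  · simp

/-- The height of the meet is the length of the common part. -/
theorem green_eq_height_of_meet (wt : Sym2 V → ℤ) (r : V) {x y w : V}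
    (hw : ∀ e ∈ G.edgeSet, G.cut r e w = G.cut r e x * G.cut r e y) :
    G.green wt r x y = G.height wt r w :=
  finsum_congr fun e => by rw [hw e e.2, mul_assoc]

end SimpleGraph

/-! ### The path metric, its parity, and leaves -/

namespace BYPair

variable {V : Type*} {X : BYPair V}

theorem walkLen_cons {u v w : V} (h : X.graph.Adj u v) (p : X.graph.Walk v w) :
    X.walkLen (.cons h p) = X.len s(u, v) + X.walkLen p := by
  simp [walkLen]

theorem exists_walkLen_eq_dist (hX : X.graph.Connected) (u v : V) :
    ∃ p : X.graph.Walk u v, X.walkLen p = X.dist u v := by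
  obtain ⟨p⟩ := hX.preconnected u v
  exact Nat.sInf_mem (s := {n | ∃ p : X.graph.Walk u v, X.walkLen p = n}) ⟨_, p, rfl⟩

/-- A function to `ZMod 2` whose increments along the edges are their lengths. -/
def IsParity (X : BYPair V) (p : V → ZMod 2) : Prop :=
  ∀ u v, X.graph.Adj u v → p u = X.len s(u, v) + p v

theorem IsParity.dist_eq (hX : X.graph.Connected) {p : V → ZMod 2} (hp : X.IsParity p) (u v : V) :
    (X.dist u v : ZMod 2) = p u + p v := by
  obtain ⟨q, hq⟩ := exists_walkLen_eq_dist hX u v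
  rw [← hq]
  clear hq
  induction q with
  | nil => simp [walkLen, CharTwo.add_self_eq_zero]
  | cons h q ih => rw [walkLen_cons, Nat.cast_add, ih, hp _ _ h, add_assoc]

theorem IsParity.even_dist_iff (hX : X.graph.Connected) {p : V → ZMod 2} (hp : X.IsParity p)
    (u v : V) : Even (X.dist u v) ↔ p u = p v := by
  rw [← ZMod.natCast_eq_zero_iff_even, hp.dist_eq hX, CharTwo.add_eq_zero]

/-- Along an edge the height changes by plus or minus the length, and the sign disappears in `ZMod
2`. -/
theorem isParity_height [Finite V] (hX : X.graph.IsTree) (r : V) :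
    X.IsParity fun v => (X.graph.height (fun e => X.len e) r v : ZMod 2) := by
  intro u v h
  have h1 := SimpleGraph.height_sub (fun e => (X.len e : ℤ)) r h
  have h2 := hX.cut_add_cut r h
  have h3 : X.graph.height (fun e => X.len e) r u =
      X.len s(u, v) + X.graph.height (fun e => X.len e) r v -
        2 * (X.len s(u, v) * X.graph.cut r s(u, v) v) := by
    linear_combination -h1 + (X.len s(u, v) : ℤ) * h2
  dsimp only
  rw [h3]
  push_cast
  rw [show (2 : ZMod 2) = 0 from rfl, zero_mul, sub_zero]

/-- Follow edges towards the root: each lowers the height by exactly its length. -/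
theorem exists_walkLen_eq_height [Finite V] (hX : X.graph.IsTree) (r v : V) :
    ∃ p : X.graph.Walk v r, (X.walkLen p : ℤ) = X.graph.height (fun e => X.len e) r v := by
  have hnn : ∀ v, 0 ≤ X.graph.height (fun e => X.len e) r v := fun v =>
    finsum_nonneg fun e => mul_nonneg (Int.natCast_nonneg _) (by
      rcases SimpleGraph.cut_eq_zero_or_one (G := X.graph) r e v with h | h <;> simp [h])
  obtain ⟨n, hn⟩ : ∃ n : ℕ, X.graph.height (fun e => X.len e) r v = n :=
    ⟨_, (Int.toNat_of_nonneg (hnn v)).symm⟩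
  induction n using Nat.strong_induction_on generalizing v with
  | _ n ih =>
  by_cases hv : v = r
  · subst hv
    exact ⟨.nil, by simp [walkLen, SimpleGraph.height_root]⟩
  · have := Fintype.ofFinite V
    obtain ⟨u, h1, h2⟩ := hX.exists_adj_cut_ne r (Ne.symm hv)
    rw [SimpleGraph.cut_root] at h2
    have h3 := (SimpleGraph.cut_eq_zero_or_one _ _ _).resolve_left h2
    have h4 := hX.cut_add_cut r h1
    have h5 := SimpleGraph.height_sub (fun e => (X.len e : ℤ)) r h1
    have h6 : X.graph.cut r s(v, u) u = 0 := by omega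
    rw [h3, h6] at h5
    have h7 := X.len_pos s(v, u) h1
    obtain ⟨m, hm⟩ : ∃ m : ℕ, X.graph.height (fun e => X.len e) r u = m :=
      ⟨_, (Int.toNat_of_nonneg (hnn u)).symm⟩
    obtain ⟨p, hp⟩ := ih m (by omega) u hm
    refine ⟨.cons h1 p, ?_⟩
    rw [walkLen_cons, Nat.cast_add, hp]
    linarith

theorem height_le_walkLen [Finite V] {r v : V} (p : X.graph.Walk v r) :
    X.graph.height (fun e => X.len e) r v ≤ X.walkLen p := by
  have key : ∀ {v w : V} (p : X.graph.Walk v w), X.graph.height (fun e => X.len e) r v ≤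
      X.walkLen p + X.graph.height (fun e => X.len e) r w := fun p => by
    induction p with
    | nil => simp [walkLen]
    | @cons a b c h p ih =>
      rw [walkLen_cons]
      have h1 := SimpleGraph.height_sub (fun e => (X.len e : ℤ)) r h
      push_cast
      rcases SimpleGraph.cut_eq_zero_or_one (G := X.graph) r s(a, b) a with h2 | h2 <;>
      rcases SimpleGraph.cut_eq_zero_or_one (G := X.graph) r s(a, b) b with h3 | h3 <;>
      · rw [h2, h3] at h1
        have := Int.natCast_nonneg (X.len s(a, b))
        linarith
  simpa [SimpleGraph.height_root] using key p

theorem dist_eq_height [Finite V] (hX : X.graph.IsTree) (r v : V) :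
    (X.dist v r : ℤ) = X.graph.height (fun e => X.len e) r v := by
  apply le_antisymm
  · obtain ⟨p, hp⟩ := exists_walkLen_eq_height hX r v
    rw [← hp]
    exact_mod_cast Nat.sInf_le (s := {n | ∃ p : X.graph.Walk v r, X.walkLen p = n}) ⟨p, rfl⟩
  · obtain ⟨p, hp⟩ := exists_walkLen_eq_dist hX.1 v r
    rw [← hp]
    exact height_le_walkLen p

/-- The marked points of a simple BY tree have degree at most one. -/
theorem IsSimple.eq_of_adj (hX : X.graph.IsTree) (h : X.IsSimple) {s u u' : V}
    (hs : s ∈ X.S.verts) (hu : X.graph.Adj s u) (hu' : X.graph.Adj s u') : u = u' := by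
  classical
  by_contra hne
  obtain ⟨hS, -, hcard⟩ := h
  have hsub := (Nat.card_eq_one_iff_unique.1 hcard).1
  set κ := X.graph.cut s s(s, u)
  -- Every open edge other than `s(s, u)` has the same cut value at both ends. The edge `s(s, u)`
  -- gets the value at `u`, since its other end is marked and does not belong to the complement. So
  -- `c` is constant on components.
  let c : X.Cell → ℤ := Sum.elim (fun v => κ v.1) fun e =>
    if e.1 = s(s, u) then κ u else κ (Quot.out e.1).1
  have hc : ∀ (v : V) (hv : v ∉ X.S.verts) (e : Sym2 V) (he : e ∈ X.graph.edgeSet \ X.S.edgeSet),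
      v ∈ e → c (.inl ⟨v, hv⟩) = c (.inr ⟨e, he⟩) := by
    intro v hv e he hve
    by_cases h' : e = s(s, u)
    · subst h'
      rcases Sym2.mem_iff.1 hve with rfl | rfl
      · exact absurd hs hv
      · simp [c]
    · have h1 : s((Quot.out e).1, (Quot.out e).2) = e := Quot.out_eq e
      change κ v = if e = s(s, u) then κ u else κ (Quot.out e).1
      rw [if_neg h']
      rw [← h1] at hve
      rcases Sym2.mem_iff.1 hve with h2 | h2
      · rw [h2]
      · rw [h2]
        refine (SimpleGraph.cut_eq_of_adj s ?_ ?_).symm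
        · rw [← SimpleGraph.mem_edgeSet, h1]; exact he.1
        · rwa [h1]
  have hr : ∀ a b, X.incidence.Reachable a b → c a = c b := by
    rintro a b ⟨p⟩
    induction p with
    | nil => rfl
    | @cons a b _ hab _ ih =>
      refine Eq.trans ?_ ih
      rcases a with ⟨a, ha⟩ | ⟨a, ha⟩ <;> rcases b with ⟨b, hb⟩ | ⟨b, hb⟩
      · exact hab.elim
      · exact hc a ha b hb hab
      · exact (hc b hb a ha hab).symm
      · exact hab.elim
  have he : s(s, u) ∈ X.graph.edgeSet \ X.S.edgeSet := ⟨hu, hS _ _⟩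
  have he' : s(s, u') ∈ X.graph.edgeSet \ X.S.edgeSet := ⟨hu', hS _ _⟩
  have h1 := hr (.inr ⟨_, he⟩) (.inr ⟨_, he'⟩)
    (SimpleGraph.ConnectedComponent.eq.1 (Subsingleton.elim _ _))
  have hne' : s(s, u') ≠ s(s, u) := fun h => hne (Sym2.congr_right.1 h).symm
  -- The edge `s(s, u')` carries the value at `s`, which differs from the value at `u` carried by
  -- `s(s, u)`.
  have h2 : c (.inr ⟨_, he'⟩) = κ s := by
    change (if s(s, u') = s(s, u) then κ u else κ (Quot.out s(s, u')).1) = κ s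
    rw [if_neg hne']
    have h1 : s((Quot.out s(s, u')).1, (Quot.out s(s, u')).2) = s(s, u') := Quot.out_eq _
    rcases Sym2.eq_iff.1 h1 with ⟨h3, -⟩ | ⟨h3, -⟩
    · rw [h3]
    · rw [h3]
      exact (SimpleGraph.cut_eq_of_adj s hu' hne').symm
  have h3 : c (.inr ⟨_, he⟩) = κ u := by simp [c]
  rw [h2, h3] at h1
  exact hX.cut_ne s hu h1.symm

end BYPair

/-! ### One marked point, and paths -/

namespace BYGraph

variable {V : Type*} [Finite V] {T : BYGraph V}

theorem tamagawa_of_card_eq_one (hT : T.graph.IsTree) (hS : ∀ u v, ¬ T.S.Adj u v) {ε : ℤˣ}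
    (hε : ∀ C, T.sign C = ε) (h : T.S.verts.ncard = 1) : T.tamagawa = 1 := by
  obtain ⟨x, hx⟩ := Set.ncard_eq_one.1 h
  have hF : T.F x = x := by
    have := (T.verts_F x).2 (hx ▸ rfl)
    rwa [hx] at this
  rw [tamagawa_eq_index hT hS hε x (j := fun _ : Unit => x) (fun _ _ _ => rfl)
    (by rw [hx, Set.range_const]) 1 fun _ => hF, AddSubgroup.index_eq_one, eq_top_iff]
  intro y _
  exact ⟨y (), 0, 0, by simp, by simp⟩

section Path

variable {x y : V}

theorem index_tamSub_of_comap {f : Equiv.Perm Bool} {ε : ℤ} {G : Bool → Bool → ℤ} {d : ℤ}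
    (h : ∀ a : Bool → ℤ, a ∈ tamSub f ε G ↔ ∃ k : ℤ, a true - a false = k * d) :
    (tamSub f ε G).index = d.natAbs := by
  let π : (Bool → ℤ) →+ ℤ :=
    { toFun := fun a => a true - a false
      map_zero' := rfl
      map_add' := fun a b => by simp only [Pi.add_apply]; ring }
  have hπ : Function.Surjective π := fun k => ⟨fun b => if b then k else 0, by simp [π]⟩
  rw [← Int.index_zmultiples, ← AddSubgroup.index_comap_of_surjective _ hπ]
  congr 1
  ext a
  rw [h, AddSubgroup.mem_comap, AddSubgroup.mem_zmultiples_iff]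
  exact exists_congr fun k => eq_comm

/-- The root is the end `x`, which `F` need not fix. The only nonzero entry of the Green form is
then the length, at the pair `(y, y)`. -/
theorem tamagawa_path (hT : T.graph.IsTree) (hS : ∀ u v, ¬ T.S.Adj u v)
    (hε : ∀ C, T.sign C = -1) (hxy : x ≠ y) (h : T.S.verts = {x, y}) (f : Equiv.Perm Bool)
    (hfx : T.F x = if f false then y else x) (hfy : T.F y = if f true then y else x) :
    T.tamagawa = (tamSub f (-1) fun i k => if i && k then T.dist x y else 0).index := by
  have hdist : T.graph.green T.lenZ x y y = T.dist x y := by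
    rw [SimpleGraph.green_self, show T.lenZ = fun e => (T.len e : ℤ) from rfl,
      ← T.dist_eq_height hT x y]
    have hp := T.exists_walkLen_eq_height hT x y
    have := T.dist_eq_height hT x y
    have hrev : ∀ u v, T.dist u v ≤ T.dist v u := fun u v => by
      obtain ⟨p, hp⟩ := T.exists_walkLen_eq_dist hT.1 v u
      rw [← hp]
      refine Nat.sInf_le ⟨p.reverse, ?_⟩
      simp [BYPair.walkLen]
    exact_mod_cast le_antisymm (hrev _ _) (hrev _ _)
  rw [tamagawa_eq_index hT hS hε x (j := fun b : Bool => if b then y else x) ?_ ?_ f ?_]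
  · congr 2
    funext i k
    cases i <;> cases k <;>
      simp [SimpleGraph.green_root, hdist, SimpleGraph.green_comm T.lenZ x x y]
  · intro a b
    cases a <;> cases b <;> simp [hxy, hxy.symm]
  · rw [h]
    ext v
    simp [eq_comm]
  · intro b
    cases b
    · simpa using hfx
    · simpa using hfy

/-- When nothing moves the norms are the even-valued functions, so modulo constants the index is the
gcd of `2` and the length. -/
theorem tamagawa_path_fixed (hT : T.graph.IsTree) (hS : ∀ u v, ¬ T.S.Adj u v)
    (hε : ∀ C, T.sign C = -1) (hxy : x ≠ y) (h : T.S.verts = {x, y}) (hF : ∀ v, T.F v = v) :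
    T.tamagawa = if Even (T.dist x y) then 2 else 1 := by
  rw [tamagawa_path hT hS hε hxy h 1 (by simp [hF]) (by simp [hF]),
    index_tamSub_of_comap (d := if Even (T.dist x y) then 2 else 1)]
  · split_ifs <;> rfl
  intro a
  constructor
  · rintro ⟨c, n, k, hn, ha⟩
    rw [Fintype.sum_bool] at hn
    have h1 := ha true
    have h2 := ha false
    simp only [Fintype.sum_bool, Equiv.Perm.coe_one, id] at h1 h2
    simp only [Bool.and_true, Bool.and_false, if_true, Bool.false_eq_true, if_false] at h1 h2
    split_ifs with he
    · obtain ⟨m, hm⟩ := he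
      rw [hm] at h1
      push_cast at h1
      exact ⟨n true * m + k true - k false, by linarith⟩
    · exact ⟨a true - a false, by ring⟩
  · rintro ⟨k, hk⟩
    split_ifs at hk with he
    · refine ⟨a false, 0, fun b => if b then k else 0, by simp, fun t => ?_⟩
      cases t
      · simp
      · simp; linarith
    · obtain ⟨m, hm⟩ := Nat.not_even_iff_odd.1 he
      refine ⟨a false, fun b => if b then k else -k, fun b => if b then - k * m else 0, by simp,
        -- For length `2 * m + 1`, the row contributes `k * (2 * m + 1)` and the norm `-2 * k * m`,
        -- which leaves `k`.
        fun t => ?_⟩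
      cases t
      · simp
      · simp [hm]; linarith

/-- When the two points are exchanged every norm is constant, so modulo constants only the multiples
of the length remain. -/
theorem tamagawa_path_reversed (hT : T.graph.IsTree) (hS : ∀ u v, ¬ T.S.Adj u v)
    (hε : ∀ C, T.sign C = -1) (hxy : x ≠ y) (h : T.S.verts = {x, y}) (hF : T.F x = y) :
    T.tamagawa = T.dist x y := by
  have hF' : T.F y = x := by
    have h1 : T.F y ∈ T.S.verts := (T.verts_F y).2 (by simp [h])
    rw [h] at h1
    rcases h1 with h1 | h1
    · exact h1
    · exact absurd (T.F.injective (hF.trans h1.symm)) hxy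
  rw [tamagawa_path hT hS hε hxy h (Equiv.swap false true) (by simp [hF]) (by simp [hF']),
    index_tamSub_of_comap (d := T.dist x y)]
  · rfl
  intro a
  constructor
  · rintro ⟨c, n, k, hn, ha⟩
    have h1 := ha true
    have h2 := ha false
    simp at h1 h2
    exact ⟨n true, by linarith⟩
  · rintro ⟨k, hk⟩
    refine ⟨a false, fun b => if b then k else -k, 0, by simp, fun t => ?_⟩
    cases t
    · simp
    · simp; linarith

end Path

end BYGraph

/-! ### Automorphisms of finite trees -/

namespace SimpleGraph

variable {V : Type*} {G : SimpleGraph V}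

/-- Induction on vertices of a tree from the root `r` outwards. -/
theorem IsTree.induction_from_root [Finite V] (hG : G.IsTree) (r : V) {P : V → Prop} (h0 : P r)
    (h : ∀ v u, G.Adj v u → G.cut r s(v, u) v = 1 → P u → P v) (v : V) : P v := by
  have := Fintype.ofFinite V
  have hnn : ∀ v, 0 ≤ G.height 1 r v := fun v =>
    finsum_nonneg fun e => mul_nonneg zero_le_one (by
      rcases cut_eq_zero_or_one (G := G) r e v with h | h <;> simp [h])
  obtain ⟨n, hn⟩ : ∃ n : ℕ, G.height 1 r v = n := ⟨_, (Int.toNat_of_nonneg (hnn v)).symm⟩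
  induction n using Nat.strong_induction_on generalizing v with
  | _ n ih =>
  by_cases hv : v = r
  · exact hv ▸ h0
  · obtain ⟨u, h1, h2⟩ := hG.exists_adj_cut_ne r (Ne.symm hv)
    rw [cut_root] at h2
    have h3 := (cut_eq_zero_or_one _ _ _).resolve_left h2
    have h4 := hG.cut_add_cut r h1
    have h5 := height_sub (G := G) 1 r h1
    rw [h3, show G.cut r s(v, u) u = 0 by omega] at h5
    simp only [Pi.one_apply] at h5
    obtain ⟨m, hm⟩ : ∃ m : ℕ, G.height 1 r u = m := ⟨_, (Int.toNat_of_nonneg (hnn u)).symm⟩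
    exact h v u h1 h3 (ih m (by omega) u hm)

/-- The fixed locus of an automorphism of a tree is convex. -/
theorem IsTree.fixed_of_cut_eq_one [Finite V] (hG : G.IsTree) {r s : V} (φ : G ≃g G)
    (hr : φ r = r) (hs : φ s = s) {u v : V} (h : G.Adj u v) (hc : G.cut r s(u, v) s = 1) :
    φ u = u ∧ φ v = v := by
  have := Fintype.ofFinite V
  have hmap := hG.cut_map φ hr (e := s(u, v)) h
  rw [Sym2.map_mk] at hmap
  -- The image edge also separates `r` from `s`, so the two far sides are nested. They have equally
  -- many vertices and hence coincide, which is absurd for distinct edges.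
  have hc' : G.cut r s(φ u, φ v) s = 1 := by rw [← hc, ← hmap, hs]
  have hφ : G.Adj (φ u) (φ v) := φ.map_adj_iff.2 h
  have he : s(u, v) = s(φ u, φ v) := by
    by_contra hne
    have h1 := hG.cut_mul_cut r h hφ hne
    have h2 := h1 s
    rw [hc, hc'] at h2
    have h3 : ∑ x, G.cut r s(φ u, φ v) x = ∑ x, G.cut r s(u, v) x := by
      rw [← Equiv.sum_comp φ.toEquiv]
      exact Finset.sum_congr rfl fun x _ => hmap x
    have h4 : ∑ x, G.cut r s(u, v) x * G.cut r s(φ u, φ v) x = ∑ x, G.cut r s(u, v) x := by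
      rcases cut_eq_zero_or_one (G := G) r s(φ u, φ v) u with h5 | h5
      · rw [← h3]
        refine Finset.sum_congr rfl fun x _ => ?_
        rw [h1 x, h5, show G.cut r s(u, v) (φ u) = 1 by omega]
        ring
      · refine Finset.sum_congr rfl fun x _ => ?_
        rw [h1 x, h5, show G.cut r s(u, v) (φ u) = 0 by omega]
        ring
    have hsq : ∀ e x, G.cut r e x * G.cut r e x = G.cut r e x := fun e x => by
      rcases cut_eq_zero_or_one (G := G) r e x with h | h <;> rw [h] <;> rfl
    have h5 : ∑ x, (G.cut r s(u, v) x - G.cut r s(φ u, φ v) x) *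
        (G.cut r s(u, v) x - G.cut r s(φ u, φ v) x) = 0 := by
      have : ∀ x, (G.cut r s(u, v) x - G.cut r s(φ u, φ v) x) *
          (G.cut r s(u, v) x - G.cut r s(φ u, φ v) x) = G.cut r s(u, v) x +
          G.cut r s(φ u, φ v) x - 2 * (G.cut r s(u, v) x * G.cut r s(φ u, φ v) x) := fun x => by
        linear_combination hsq s(u, v) x + hsq s(φ u, φ v) x
      simp only [this, Finset.sum_sub_distrib, Finset.sum_add_distrib, ← Finset.mul_sum, h4, h3]
      ring
    have h6 := (Finset.sum_eq_zero_iff_of_nonneg fun x _ => mul_self_nonneg _).1 h5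
    have h7 : ∀ x, G.cut r s(u, v) x = G.cut r s(φ u, φ v) x := fun x =>
      sub_eq_zero.1 (mul_self_eq_zero.1 (h6 x (Finset.mem_univ x)))
    refine hG.cut_ne r h ?_
    rw [h7, h7]
    exact cut_eq_of_adj r h hne
  rcases Sym2.eq_iff.1 he with ⟨h1, h2⟩ | ⟨h1, h2⟩
  · exact ⟨h1.symm, h2.symm⟩
  -- `φ` fixes `r`, hence preserves the side on which each end lies, and cannot reverse the edge.
  · exfalso
    have h3 := hmap u
    rw [← h2, Sym2.eq_swap, ← h1] at h3
    exact hG.cut_ne r h h3.symm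

/-- The iterates of an automorphism are automorphisms. -/
theorem exists_iso_iterate (F : G ≃g G) (k : ℕ) : ∃ φ : G ≃g G, ∀ v, φ v = F^[k] v := by
  induction k with
  | zero => exact ⟨Iso.refl, fun _ => rfl⟩
  | succ k ih =>
    obtain ⟨φ, hφ⟩ := ih
    exact ⟨F.trans φ, fun v => hφ (F v)⟩

/-- An automorphism of a finite tree fixes a vertex or inverts an edge. -/
theorem IsTree.exists_fixed [Finite V] (hG : G.IsTree) (F : G ≃g G)
    (hF : ∀ u v, G.Adj u v → F u = v → F v ≠ u) : ∃ v, F v = v := by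
  classical
  have := Fintype.ofFinite V
  by_contra! hne
  obtain ⟨r⟩ := hG.1.nonempty
  -- Each vertex points along the first edge towards its image. There are fewer edges than vertices,
  -- so the two ends of some edge point at each other. Their images then lie on opposite sides of
  -- this edge, so the edge is mapped to itself.
  choose w hw hw' using fun v => hG.exists_adj_cut_ne r (hne v)
  let e : V → G.edgeSet := fun v => ⟨s(v, w v), hw v⟩
  have hcard : Fintype.card G.edgeSet < Fintype.card V := by
    rw [← hG.card_edgeFinset, SimpleGraph.edgeFinset_card]
    exact Nat.lt_succ_self _
  obtain ⟨v, v', hvv', he⟩ := Fintype.exists_ne_map_eq_of_card_lt e hcard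
  have he' : s(v, w v) = s(v', w v') := congrArg Subtype.val he
  rcases Sym2.eq_iff.1 he' with ⟨h, -⟩ | ⟨h1, h2⟩
  · exact hvv' h
  have a1 := hw' v
  have a2 := hw' v'
  have a3 := hG.cut_ne r (hw v)
  have hadj := hw v
  rw [← he'] at a2
  rw [h2] at a1 a2 a3 hadj
  have a4 : G.cut r s(v, v') (F v) ≠ G.cut r s(v, v') (F v') := by
    rcases cut_eq_zero_or_one (G := G) r s(v, v') v with b1 | b1 <;>
    rcases cut_eq_zero_or_one (G := G) r s(v, v') v' with b2 | b2 <;>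
    rcases cut_eq_zero_or_one (G := G) r s(v, v') (F v) with b3 | b3 <;>
    rcases cut_eq_zero_or_one (G := G) r s(v, v') (F v') with b4 | b4 <;> simp_all
  have a5 : s(F v, F v') = s(v, v') := by
    by_contra h
    exact a4 (cut_eq_of_adj r (F.map_adj_iff.2 hadj) h)
  rcases Sym2.eq_iff.1 a5 with ⟨h, -⟩ | ⟨h3, h4⟩
  · exact hne v h
  · exact hF v v' hadj h3 h4

/-- A sign on a tree rooted at a fixed vertex, alternating along orbits and constant on branches
at the root, provided no other vertex has odd period. -/
theorem IsTree.exists_branch_sign [Finite V] (hG : G.IsTree) {r : V} (F : G ≃g G) (hr : F r = r)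
    (hodd : ∀ v, IsOddPt F v → v = r) :
    ∃ σ : V → ℤ, (∀ v, σ v = 1 ∨ σ v = -1) ∧ (∀ v, v ≠ r → σ (F v) = -σ v) ∧
      ∀ e ∈ G.edgeSet, ∀ a b, G.cut r e a = 1 → G.cut r e b = 1 → σ a = σ b := by
  classical
  have := Fintype.ofFinite V
  obtain ⟨τ, hτ1, hτ2⟩ := exists_alternating F.injective
  -- The sign of `v` will be the alternating sign of the neighbour of `r` that leads to `v`. `F`
  -- permutes these neighbours, and none of them has odd period.
  have hex : ∀ v, ∃ u, v ≠ r → G.Adj r u ∧ G.cut r s(r, u) v = 1 := fun v => by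
    by_cases hv : v = r
    · exact ⟨r, fun h => absurd hv h⟩
    · obtain ⟨u, h1, h2⟩ := hG.exists_adj_cut_ne r hv
      rw [cut_root] at h2
      exact ⟨u, fun _ => ⟨h1, (cut_eq_zero_or_one _ _ _).resolve_left h2.symm⟩⟩
  choose t ht using hex
  have huniq : ∀ v u u', G.Adj r u → G.Adj r u' → G.cut r s(r, u) v = 1 →
      G.cut r s(r, u') v = 1 → u = u' := by
    intro v u u' h1 h2 h3 h4
    by_contra hne
    have h := hG.cut_mul_cut r h1 h2 (fun h => hne (Sym2.congr_right.1 h)) v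
    rw [h3, h4, cut_root, cut_root] at h
    omega
  refine ⟨fun v => τ (t v), fun v => hτ1 _, fun v hv => ?_, fun e he a b ha hb => ?_⟩
  · have hFv : F v ≠ r := fun h => hv (F.injective (h.trans hr.symm))
    obtain ⟨h1, h2⟩ := ht v hv
    obtain ⟨h3, h4⟩ := ht (F v) hFv
    have h5 : G.Adj r (F (t v)) := by
      have := F.map_adj_iff.2 h1
      rwa [hr] at this
    have h6 := hG.cut_map F hr (e := s(r, t v)) h1 v
    rw [Sym2.map_mk, hr, h2] at h6
    have h7 := huniq _ _ _ h3 h5 h4 h6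
    dsimp only
    rw [h7]
    exact hτ2 _ fun h => h1.ne (hodd _ h).symm
  · have hra : ∀ a, G.cut r e a = 1 → a ≠ r := by
      rintro _ h rfl
      rw [cut_root] at h
      omega
    obtain ⟨h1, h2⟩ := ht a (hra a ha)
    obtain ⟨h3, h4⟩ := ht b (hra b hb)
    have h5 : G.cut r s(r, t a) b = 1 := by
      by_cases hne : s(r, t a) = e
      · rw [hne, hb]
      · induction e with | _ c d =>
        have e1 := hG.cut_mul_cut r h1 he hne a
        have e2 := hG.cut_mul_cut r h1 he hne b
        rw [ha, h2, cut_root] at e1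
        rw [hb, cut_root] at e2
        omega
    exact congrArg τ (huniq b _ _ h1 h3 h5 h4)

end SimpleGraph

theorem Sym2.map_iterate {α : Type*} (f : α → α) (k : ℕ) (u v : α) :
    (Sym2.map f)^[k] s(u, v) = s(f^[k] u, f^[k] v) := by
  induction k generalizing u v with
  | zero => rfl
  | succ k ih => exact ih (f u) (f v)

/-! ### Contracting the edges in odd orbits -/

namespace BYPair

variable {V : Type*} {X : BYPair V}

/-- The permutation of the marked points. -/
def markedPerm (X : BYPair V) : Equiv.Perm X.S.verts := 
  Equiv.Perm.subtypePerm (X.F.toEquiv : Equiv.Perm V) X.verts_F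

theorem markedPerm_iterate (s : X.S.verts) (k : ℕ) : (X.markedPerm^[k] s : V) = X.F^[k] s := by
  induction k with
  | zero => rfl
  | succ k ih => rw [Function.iterate_succ_apply', Function.iterate_succ_apply', ← ih]; rfl

theorem isOddPt_markedPerm (s : X.S.verts) : IsOddPt X.markedPerm s ↔ IsOddPt X.F s := by
  refine exists_congr fun k => and_congr_right fun _ => ?_
  rw [← markedPerm_iterate, Subtype.ext_iff]

theorem oddVertex_iff [Finite V] (v : V) : X.OddVertex v ↔ IsOddPt X.F v :=
  odd_iterOrbit_iff X.F.injective v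

theorem oddEdge_iff [Finite V] (e : Sym2 V) : X.OddEdge e ↔ IsOddPt (Sym2.map X.F) e :=
  odd_iterOrbit_iff (Sym2.map.injective X.F.injective) e

/-- The length of an edge in an even orbit, and zero on edges in odd orbits. -/
noncomputable def evenLen (X : BYPair V) (e : Sym2 V) : ℤ :=
  open Classical in if X.OddEdge e then 0 else X.len e

theorem lenZ_map (e : Sym2 V) (he : e ∈ X.graph.edgeSet) : X.lenZ (e.map X.F) = X.lenZ e :=
  congrArg Nat.cast (X.len_F e he)

theorem evenLen_map (e : Sym2 V) (he : e ∈ X.graph.edgeSet) :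
    X.evenLen (e.map X.F) = X.evenLen e := by
  unfold evenLen
  rw [X.len_F e he]
  classical exact if_congr (X.oddEdge_map_iff e) rfl rfl

section NoInversion

variable [Finite V] (hX : X.graph.IsTree) (hinv : ∀ e, ¬ X.IsInverted e) {r : V} (hr : X.F r = r)

include hinv in
theorem fixed_of_oddEdge {u v : V} (h : X.graph.Adj u v) (he : X.OddEdge s(u, v)) :
    ∃ k, Odd k ∧ X.F^[k] u = u ∧ X.F^[k] v = v := by
  obtain ⟨k, hk, h1⟩ := (oddEdge_iff _).1 he
  rw [Sym2.map_iterate] at h1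
  rcases Sym2.eq_iff.1 h1 with ⟨h2, h3⟩ | ⟨h2, h3⟩
  · exact ⟨k, hk, h2, h3⟩
  · exact absurd ⟨h, k, u, v, rfl, h2, h3⟩ (hinv s(u, v))

theorem oddEdge_of_fixed {u v : V} {k : ℕ} (hk : Odd k) (hu : X.F^[k] u = u)
    (hv : X.F^[k] v = v) : X.OddEdge s(u, v) :=
  (oddEdge_iff _).2 ⟨k, hk, by rw [Sym2.map_iterate, hu, hv]⟩

omit [Finite V] in
theorem iterate_root (hr : X.F r = r) (k : ℕ) : X.F^[k] r = r := Function.iterate_fixed hr k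

include hX hr in
-- An odd iterate that fixes both `s` and the root fixes the path between them.
theorem oddEdge_of_cut {s u v : V} (hs : IsOddPt X.F s) (h : X.graph.Adj u v)
    (hc : X.graph.cut r s(u, v) s = 1) : X.OddEdge s(u, v) := by
  obtain ⟨k, hk, hks⟩ := hs
  obtain ⟨φ, hφ⟩ := SimpleGraph.exists_iso_iterate X.F k
  obtain ⟨h1, h2⟩ := hX.fixed_of_cut_eq_one φ ((hφ r).trans (iterate_root hr k))
    ((hφ s).trans hks) h hc
  rw [hφ] at h1 h2
  exact oddEdge_of_fixed hk h1 h2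

include hX hr hinv in
-- The path from the root to such a vertex consists of edges in odd orbits, all of which are
-- contracted.
theorem toC_eq_root {v : V} (hv : IsOddPt X.F v) : X.toC v = X.toC r := by
  refine hX.induction_from_root r (P := fun v => IsOddPt X.F v → X.toC v = X.toC r)
    (fun _ => rfl) (fun v u h hc ih hv => ?_) v hv
  have he := oddEdge_of_cut hX hr hv h hc
  obtain ⟨k, hk, -, hu⟩ := fixed_of_oddEdge hinv h he
  rw [← ih ⟨k, hk, hu⟩]
  exact SimpleGraph.ConnectedComponent.eq.2
    (SimpleGraph.Adj.reachable (show X.oddPart.Adj v u from ⟨h, he⟩))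

include hinv in
-- Without inversions both ends of a contracted edge have odd period, so a vertex of even period is
-- alone in its class.
theorem eq_of_toC_eq {u v : V} (hv : ¬ IsOddPt X.F v) (h : X.toC v = X.toC u) : v = u := by
  obtain ⟨p⟩ := SimpleGraph.ConnectedComponent.eq.1 h
  cases p with
  | nil => rfl
  | cons h _ =>
    obtain ⟨k, hk, h1, -⟩ := fixed_of_oddEdge hinv h.1 h.2
    exact absurd ⟨k, hk, h1⟩ hv

omit [Finite V] in
theorem cF_iterate (v : V) (k : ℕ) : X.cF^[k] (X.toC v) = X.toC (X.F^[k] v) := by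
  induction k generalizing v with
  | zero => rfl
  | succ k ih => exact ih (X.F v)

include hX hr hinv in
theorem eq_root_of_isOddPt_cF {a : X.CVert} (ha : IsOddPt X.cF a) : a = X.toC r := by
  induction a using SimpleGraph.ConnectedComponent.ind with | _ v =>
  by_cases hv : IsOddPt X.F v
  · exact toC_eq_root hX hinv hr hv
  · obtain ⟨k, hk, h⟩ := ha
    rw [cF_iterate] at h
    exact absurd ⟨k, hk, (eq_of_toC_eq hinv hv h.symm).symm⟩ hv

include hX hr hinv in
theorem oddEdge_iff_toC_eq {u v : V} (h : X.graph.Adj u v) :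
    X.OddEdge s(u, v) ↔ X.toC u = X.toC v := by
  constructor
  · intro he
    exact SimpleGraph.ConnectedComponent.eq.2
      (SimpleGraph.Adj.reachable (show X.oddPart.Adj u v from ⟨h, he⟩))
  · intro he
    have hu : IsOddPt X.F u := by
      by_contra hu
      exact h.ne (eq_of_toC_eq hinv hu he)
    have hv : IsOddPt X.F v := by
      by_contra hv
      exact h.ne (eq_of_toC_eq hinv hv he.symm).symm
    have hc := hX.cut_add_cut r h
    rcases SimpleGraph.cut_eq_zero_or_one (G := X.graph) r s(u, v) u with h1 | h1
    · exact oddEdge_of_cut hX hr hv h (by omega)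
    · exact oddEdge_of_cut hX hr hu h h1

omit [Finite V] in
/-- Cuts of edges in even orbits are constant on the classes of the contraction. -/
theorem cut_eq_of_toC_eq {e : Sym2 V} (he : ¬ X.OddEdge e) {x y : V} (h : X.toC x = X.toC y) :
    X.graph.cut r e x = X.graph.cut r e y := by
  obtain ⟨p⟩ := SimpleGraph.ConnectedComponent.eq.1 h
  induction p with
  | nil => rfl
  | cons hadj p ih =>
    rw [SimpleGraph.cut_eq_of_adj r hadj.1 fun h => he (by rw [← h]; exact hadj.2)]
    exact ih (SimpleGraph.ConnectedComponent.eq.2 ⟨p⟩)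

include hX hr hinv in
-- The cut of an edge in an even orbit is constant on classes and separates the two classes at its
-- ends. It could not be constant along a second edge joining them.
theorem edge_unique {u v u' v' : V} (h : X.graph.Adj u v) (hne : X.toC u ≠ X.toC v)
    (h' : X.graph.Adj u' v') (he : s(X.toC u', X.toC v') = s(X.toC u, X.toC v)) :
    s(u', v') = s(u, v) := by
  have hodd := mt (oddEdge_iff_toC_eq hX hinv hr h).1 hne
  by_contra hcon
  have h1 := SimpleGraph.cut_eq_of_adj r h' hcon
  have h2 := hX.cut_ne r h
  rcases Sym2.eq_iff.1 he with ⟨h3, h4⟩ | ⟨h3, h4⟩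
  · rw [cut_eq_of_toC_eq hodd h3, cut_eq_of_toC_eq hodd h4] at h1
    exact h2 h1
  · rw [cut_eq_of_toC_eq hodd h3, cut_eq_of_toC_eq hodd h4] at h1
    exact h2 h1.symm

omit [Finite V] in
theorem prime_adj_toC {u v : V} (h : X.graph.Adj u v) (hne : X.toC u ≠ X.toC v) :
    X.prime.graph.Adj (X.toC u) (X.toC v) := ⟨hne, u, v, h, rfl, rfl⟩

/-- The cut of an edge in an even orbit, on the vertices of the contraction. -/
noncomputable def cutC (X : BYPair V) (r : V) (e : Sym2 V) (a : X.CVert) : ℤ :=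
  X.graph.cut r e (Quot.out a)

omit [Finite V] in
theorem cutC_toC {e : Sym2 V} (he : ¬ X.OddEdge e) (x : V) :
    X.cutC r e (X.toC x) = X.graph.cut r e x :=
  cut_eq_of_toC_eq he (Quot.out_eq (X.toC x))

include hX hr hinv in
theorem cutC_eq_of_adj {u v : V} (h : X.graph.Adj u v) (hne : X.toC u ≠ X.toC v)
    {a b : X.CVert} (hab : X.prime.graph.Adj a b) (he : s(a, b) ≠ s(X.toC u, X.toC v)) :
    X.cutC r s(u, v) a = X.cutC r s(u, v) b := by
  have hodd := mt (oddEdge_iff_toC_eq hX hinv hr h).1 hne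
  obtain ⟨-, u', v', h', rfl, rfl⟩ := hab
  rw [cutC_toC hodd, cutC_toC hodd]
  refine SimpleGraph.cut_eq_of_adj r h' fun h => he ?_
  exact congrArg (Sym2.map X.toC) h

include hX hr hinv in
-- The cut of each surviving edge descends to the contraction and still separates that edge.
theorem prime_isTree : X.prime.graph.IsTree := by
  refine SimpleGraph.Connected.isTree_of_separating ?_ ?_
  · have : Nonempty X.CVert := ⟨X.toC r⟩
    refine ⟨fun a b => ?_⟩
    induction a using SimpleGraph.ConnectedComponent.ind with | _ u =>
    induction b using SimpleGraph.ConnectedComponent.ind with | _ v =>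
    obtain ⟨p⟩ := hX.1.preconnected u v
    induction p with
    | nil => exact SimpleGraph.Reachable.refl _
    | @cons u v _ h p ih =>
      by_cases hne : X.toC u = X.toC v
      · change X.prime.graph.Reachable (X.toC u) _
        rw [hne]; exact ih
      · exact (prime_adj_toC h hne).reachable.trans ih
  · rintro _ _ ⟨hne, u, v, h, rfl, rfl⟩
    have hodd := mt (oddEdge_iff_toC_eq hX hinv hr h).1 hne
    refine ⟨X.cutC r s(u, v), ?_, fun a b hab he => cutC_eq_of_adj hX hinv hr h hne hab he⟩
    rw [cutC_toC hodd, cutC_toC hodd]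
    exact hX.cut_ne r h

include hX hr hinv in
theorem prime_cut {u v : V} (h : X.graph.Adj u v) (hne : X.toC u ≠ X.toC v) (x : V) :
    X.prime.graph.cut (X.toC r) s(X.toC u, X.toC v) (X.toC x) = X.graph.cut r s(u, v) x := by
  have hodd := mt (oddEdge_iff_toC_eq hX hinv hr h).1 hne
  rw [← cutC_toC hodd x]
  refine ((prime_isTree hX hinv hr).eq_cut (prime_adj_toC h hne) ?_
    (fun a b hab he => cutC_eq_of_adj hX hinv hr h hne hab he) ?_ (X.toC x)).symm
  · rw [cutC_toC hodd, SimpleGraph.cut_root]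
  · rw [cutC_toC hodd, cutC_toC hodd, hX.cut_add_cut r h]

include hX hr hinv in
-- By `edge_unique` the infimum defining the contracted length runs over a single value.
theorem prime_len {u v : V} (h : X.graph.Adj u v) (hne : X.toC u ≠ X.toC v) :
    X.prime.len s(X.toC u, X.toC v) = X.len s(u, v) := by
  have : {n | ∃ e ∈ X.graph.edgeSet, e.map X.toC = s(X.toC u, X.toC v) ∧ X.len e = n} =
      {X.len s(u, v)} := by
    ext n
    constructor
    · rintro ⟨e, he, he', rfl⟩
      induction e with | _ u' v' =>
      rw [edge_unique hX hinv hr h hne he he']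
      rfl
    · rintro rfl
      exact ⟨s(u, v), h, rfl, rfl⟩
  change sInf {n | ∃ e ∈ X.graph.edgeSet, e.map X.toC = s(X.toC u, X.toC v) ∧ X.len e = n} = _
  rw [this, csInf_singleton]

include hX hr hinv in
-- Contracting an edge and giving it weight zero have the same effect on the increments of the form.
theorem prime_green (s t : V) :
    X.prime.graph.green X.prime.lenZ (X.toC r) (X.toC s) (X.toC t) =
      X.graph.green X.evenLen r s t := by
  refine hX.eq_green
    (f := fun t => X.prime.graph.green X.prime.lenZ (X.toC r) (X.toC s) (X.toC t)) ?_
    (fun u v h => ?_) t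
  · exact SimpleGraph.green_root _ _ _
  · by_cases hne : X.toC u = X.toC v
    · rw [evenLen, if_pos ((oddEdge_iff_toC_eq hX hinv hr h).2 hne), hne, sub_self, zero_mul,
        zero_mul]
    · rw [SimpleGraph.green_sub X.prime.lenZ (X.toC r) (X.toC s) (prime_adj_toC h hne),
        prime_cut hX hinv hr h hne, prime_cut hX hinv hr h hne, prime_cut hX hinv hr h hne,
        evenLen, if_neg (mt (oddEdge_iff_toC_eq hX hinv hr h).1 hne), lenZ,
        prime_len hX hinv hr h hne]

include hX hr hinv in
-- If an end comes from a vertex of odd period, it is the fixed class and cannot be exchanged with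
-- another. Otherwise both classes are singletons and the inversion already takes place in the tree
-- itself.
theorem prime_not_isInverted (e : Sym2 X.CVert) : ¬ X.prime.IsInverted e := by
  rintro ⟨he, n, a, b, rfl, h1, h2⟩
  have hab : a ≠ b := he.1
  change X.cF^[n] a = b at h1
  change X.cF^[n] b = a at h2
  have hroot : X.cF^[n] (X.toC r) = X.toC r := by rw [cF_iterate, iterate_root hr]
  obtain ⟨-, u, v, h, rfl, rfl⟩ := he
  have hu : ¬ IsOddPt X.F u := fun hu => by
    rw [toC_eq_root hX hinv hr hu] at h1 hab
    exact hab (hroot.symm.trans h1)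
  have hv : ¬ IsOddPt X.F v := fun hv => by
    rw [toC_eq_root hX hinv hr hv] at h2 hab
    exact hab (h2.symm.trans hroot)
  rw [cF_iterate] at h1 h2
  exact hinv s(u, v) ⟨h, n, u, v, rfl, (eq_of_toC_eq hinv hv h1.symm).symm,
    (eq_of_toC_eq hinv hu h2.symm).symm⟩

include hX hr hinv in
theorem prime_hasUniqueFixedPoint : X.prime.HasUniqueFixedPoint := by
  refine ⟨⟨X.toC r, congrArg X.toC hr, fun a ha =>
    eq_root_of_isOddPt_cF hX hinv hr ⟨1, odd_one, ha⟩⟩, fun e he hmap => ?_⟩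
  induction e with | _ a b =>
  rw [Sym2.map_mk] at hmap
  rcases Sym2.eq_iff.1 hmap with ⟨h1, h2⟩ | ⟨h1, h2⟩
  · have ha := eq_root_of_isOddPt_cF hX hinv hr ⟨1, odd_one, h1⟩
    have hb := eq_root_of_isOddPt_cF hX hinv hr ⟨1, odd_one, h2⟩
    exact he.1 (ha.trans hb.symm)
  · exact prime_not_isInverted hX hinv hr _ ⟨he, 1, a, b, rfl, h1, h2⟩

include hX hr hinv in
theorem prime_parityB : X.prime.ParityB := fun e he =>
  absurd he (prime_not_isInverted hX hinv hr e)

end NoInversion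

end BYPair

/-- Entries at `none` vanish, so its coefficient absorbs the degree condition, and subtracting the
value at `none` absorbs the constants. Multiplication by `σ` turns `h - h ∘ g` into `h + h ∘ g`, and
it commutes with `G` because `G` couples only points of equal sign. -/
theorem index_tamSub_option {S : Type*} [Fintype S] (g : Equiv.Perm S) {G : S → S → ℤ}
    {G' : Option S → Option S → ℤ} (h0 : ∀ s, G' none s = 0) (h1 : ∀ s, G' s none = 0)
    (hG : ∀ s t, G' (some s) (some t) = G s t) {σ : S → ℤ} (hσ : ∀ s, σ s = 1 ∨ σ s = -1)
    (hg : ∀ s, σ (g s) = -σ s) (hσG : ∀ s t, G s t ≠ 0 → σ s = σ t) :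
    (tamSub (Equiv.optionCongr g) 1 G').index = (coinvSub g G).index := by
  have hσσ : ∀ s, σ s * σ s = 1 := fun s => by rcases hσ s with h | h <;> rw [h] <;> rfl
  let π : (Option S → ℤ) →+ (S → ℤ) :=
    { toFun := fun x s => σ s * (x (some s) - x none)
      map_zero' := by ext; simp
      map_add' := fun a b => by ext; simp only [Pi.add_apply]; ring }
  have hπ : Function.Surjective π := fun y =>
    ⟨fun o => o.elim 0 fun s => σ s * y s, by
      ext s
      change σ s * (σ s * y s - 0) = y s
      linear_combination y s * hσσ s⟩
  have hmul : ∀ s t, σ s * G s t = σ t * G s t := fun s t => by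
    by_cases h : G s t = 0
    · rw [h, mul_zero, mul_zero]
    · rw [hσG s t h]
  rw [← AddSubgroup.index_comap_of_surjective _ hπ]
  congr 1
  ext x
  rw [AddSubgroup.mem_comap]
  constructor
  · rintro ⟨a, n, h, -, hx⟩
    refine ⟨fun s => σ s * n (some s), fun s => σ s * h (some s), fun t => ?_⟩
    have h2 := hx none
    have h3 := hx (some t)
    simp only [h1, mul_zero, Finset.sum_const_zero] at h2
    rw [Fintype.sum_option, h0, mul_zero, zero_add] at h3
    simp only [hG, Equiv.optionCongr_apply, Option.map_none, Option.map_some] at h2 h3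
    have h4 : ∑ s, σ s * n (some s) * G s t = σ t * ∑ s, n (some s) * G s t := by
      rw [Finset.mul_sum]
      exact Finset.sum_congr rfl fun s _ => by linear_combination n (some s) * hmul s t
    change σ t * (x (some t) - x none) = _
    rw [h4, h2, h3]
    linear_combination -h (some (g t)) * hg t
  · rintro ⟨n, h, hx⟩
    refine ⟨x none, fun o => o.elim (-∑ s, σ s * n s) fun s => σ s * n s,
      fun o => o.elim 0 fun s => σ s * h s, ?_, fun t => ?_⟩
    · simp [Fintype.sum_option]
    · cases t with
      | none => simp [h1]
      | some t =>
        have h2 : σ t * (x (some t) - x none) = _ := hx t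
        have h4 : ∑ s, σ s * n s * G s t = σ t * ∑ s, n s * G s t := by
          rw [Finset.mul_sum]
          exact Finset.sum_congr rfl fun s _ => by linear_combination n s * hmul s t
        simp only [Fintype.sum_option, h0, hG, Equiv.optionCongr_apply, Option.map_some,
          Option.elim, h4, hg]
        linear_combination σ t * h2 - (x (some t) - x none) * hσσ t

/-! ### Green forms of the tree and of its contraction -/

namespace BYPair

variable {V : Type*} {X : BYPair V} [Finite V]

open Classical in
-- Here `none` stands for the class of the root. A nonzero entry means that the two paths from the
-- root share an edge, so both points lie in one branch, where the sign of `exists_branch_sign` is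
-- constant.
theorem prime_tamagawa (hX : X.graph.IsTree) (hinv : ∀ e, ¬ X.IsInverted e) {r : V}
    (hr : X.F r = r) [Fintype X.S.verts] :
    X.prime.tamagawa = (coinvSub (evenPerm X.markedPerm) (IsGreenPair.res X.markedPerm
      fun s t => X.graph.green X.evenLen r s t)).index := by
  have hodd : ∀ s : {s : X.S.verts // ¬ IsOddPt X.markedPerm s}, ¬ IsOddPt X.F s := fun s h =>
    s.2 ((isOddPt_markedPerm _).2 h)
  have hroot : ∀ s : {s : X.S.verts // ¬ IsOddPt X.markedPerm s}, X.toC s ≠ X.toC r :=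
    fun s h => hodd s ⟨1, odd_one, by rw [eq_of_toC_eq hinv (hodd s) h]; exact hr⟩
  have hP := prime_isTree hX hinv hr
  obtain ⟨σ, hσ1, hσ2, hσ3⟩ := hP.exists_branch_sign X.prime.F (r := X.toC r) (congrArg X.toC hr)
    fun a ha => eq_root_of_isOddPt_cF hX hinv hr ha
  let j : Option {s : X.S.verts // ¬ IsOddPt X.markedPerm s} → X.CVert :=
    fun o => o.elim (X.toC r) fun s => X.toC s
  rw [BYGraph.tamagawa_eq_index hP (fun _ _ h => h) (ε := 1) (fun _ => rfl) (X.toC r) (j := j) ?_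
    ?_ (Equiv.optionCongr (evenPerm X.markedPerm)) ?_]
  · refine index_tamSub_option (evenPerm X.markedPerm) (σ := fun s => σ (X.toC s)) ?_ ?_ ?_ ?_ ?_ ?_
    · intro s
      rw [SimpleGraph.green_comm]
      exact SimpleGraph.green_root _ _ _
    · intro s
      exact SimpleGraph.green_root _ _ _
    · intro s t
      exact prime_green hX hinv hr _ _
    · exact fun s => hσ1 _
    · exact fun s => hσ2 _ (hroot s)
    · intro s t h
      change X.graph.green X.evenLen r s t ≠ 0 at h
      rw [← prime_green hX hinv hr] at h
      obtain ⟨e, he⟩ : ∃ e : X.prime.graph.edgeSet, X.prime.lenZ e *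
          X.prime.graph.cut (X.toC r) e (X.toC s) * X.prime.graph.cut (X.toC r) e (X.toC t) ≠ 0 := by
        by_contra! h'
        exact h (finsum_eq_zero_of_forall_eq_zero h')
      refine hσ3 e e.2 _ _ ?_ ?_
      · exact (SimpleGraph.cut_eq_zero_or_one _ _ _).resolve_left fun h0 => he (by rw [h0]; ring)
      · exact (SimpleGraph.cut_eq_zero_or_one _ _ _).resolve_left fun h0 => he (by rw [h0]; ring)
  · rintro (_ | s) (_ | t) h
    · rfl
    · exact absurd h.symm (hroot t)
    · exact absurd h (hroot s)
    · rw [Subtype.ext (Subtype.ext (eq_of_toC_eq hinv (hodd s) h))]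
  · ext a
    constructor
    · rintro ⟨_ | s, rfl⟩
      · exact Or.inr (congrArg X.toC hr)
      · exact Or.inl ⟨s, s.1.2, fun h => hodd s ((oddVertex_iff _).1 h), rfl⟩
    · rintro (⟨s, hs, h, rfl⟩ | h)
      · exact ⟨some ⟨⟨s, hs⟩, fun h' => h ((oddVertex_iff _).2 ((isOddPt_markedPerm _).1 h'))⟩, rfl⟩
      · exact ⟨none, (eq_root_of_isOddPt_cF hX hinv hr ⟨1, odd_one, h⟩).symm⟩
  · rintro (_ | s)
    · exact congrArg X.toC hr
    · rfl

/-- The pair of forms attached to a tree rooted at a fixed vertex. -/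
theorem isGreenPair (hX : X.graph.IsTree) (hinv : ∀ e, ¬ X.IsInverted e) {r : V}
    (hr : X.F r = r) [Fintype X.S.verts]
    (hleaf : ∀ s ∈ X.S.verts, ∀ u v, X.graph.Adj s u → X.graph.Adj s v → u = v)
    (heven : ∀ s ∈ X.S.verts, IsOddPt X.F s → ∀ w, 3 ≤ X.deg w →
      Even (X.graph.height X.lenZ r w)) :
    IsGreenPair X.markedPerm (fun s t => X.graph.green X.lenZ r s t)
      (fun s t => X.graph.green X.evenLen r s t) where
  map s t := hX.green_map X.F hr lenZ_map s t
  map_zero s t := hX.green_map X.F hr evenLen_map s t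
  left_zero s t hs := finsum_eq_zero_of_forall_eq_zero fun e => by
    obtain ⟨e, he⟩ := e
    induction e with | _ u v =>
    rcases SimpleGraph.cut_eq_zero_or_one (G := X.graph) r s(u, v) s with h | h
    · rw [h]; ring
    · rw [evenLen, if_pos (oddEdge_of_cut hX hr ((isOddPt_markedPerm s).1 hs) he h)]; ring
  right_zero s t ht := finsum_eq_zero_of_forall_eq_zero fun e => by
    obtain ⟨e, he⟩ := e
    induction e with | _ u v =>
    rcases SimpleGraph.cut_eq_zero_or_one (G := X.graph) r s(u, v) t with h | h
    · rw [h]; ring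
    · rw [evenLen, if_pos (oddEdge_of_cut hX hr ((isOddPt_markedPerm t).1 ht) he h)]; ring
  norm s := by
    classical
    have := Fintype.ofFinite X.graph.edgeSet
    have h1 : (fun t : X.S.verts => if IsOddPt X.markedPerm t then 0 else
        X.graph.green X.lenZ r s t - X.graph.green X.evenLen r s t) =
        ∑ e : X.graph.edgeSet, fun t : X.S.verts => if IsOddPt X.markedPerm t then 0 else
          (X.lenZ e - X.evenLen e) * X.graph.cut r e s * X.graph.cut r e t := by
      ext t
      rw [Finset.sum_apply]
      split_ifs with ht
      · simp
      · simp only [SimpleGraph.green, finsum_eq_sum_of_fintype, sub_mul, Finset.sum_sub_distrib]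
    convert AddSubgroup.sum_mem (normSub X.markedPerm) (t := Finset.univ)
      (f := fun e : X.graph.edgeSet => fun t : X.S.verts => if IsOddPt X.markedPerm t then 0 else
          (X.lenZ e - X.evenLen e) * X.graph.cut r e s * X.graph.cut r e t) ?_ using 1
    rintro ⟨e, he⟩ -
    induction e with | _ u v =>
    by_cases ho : X.OddEdge s(u, v)
    -- An odd iterate fixes the edge and hence preserves its cut; on the points of even period such
    -- a function is a norm.
    · obtain ⟨k, hk, h2, h3⟩ := fixed_of_oddEdge hinv he ho
      obtain ⟨φ, hφ⟩ := SimpleGraph.exists_iso_iterate X.F k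
      refine indicator_mem_normSub hk (fun t => ?_) fun t ht => if_pos ht
      have hcut := hX.cut_map φ ((hφ r).trans (iterate_root hr k)) he t
      rw [Sym2.map_mk, hφ, hφ, h2, h3, hφ, ← markedPerm_iterate] at hcut
      have hper : IsOddPt X.markedPerm (X.markedPerm^[k] t) ↔ IsOddPt X.markedPerm t := by
        clear hcut
        have : ∀ n : ℕ, IsOddPt X.markedPerm (X.markedPerm^[n] t) ↔ IsOddPt X.markedPerm t := by
          intro n
          induction n with
          | zero => rfl
          | succ n ih =>
            rw [Function.iterate_succ_apply', isOddPt_apply_iff X.markedPerm.injective, ih]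
        exact this k
      exact if_congr hper rfl (by rw [hcut])
    · convert (normSub X.markedPerm).zero_mem using 1
      ext t
      simp [evenLen, ho, lenZ]
  even s t hst ht := by
    by_cases hs : (s : V) = r
    · rw [hs, SimpleGraph.green_comm, SimpleGraph.green_root]; exact Even.zero
    by_cases ht' : (t : V) = r
    · rw [ht', SimpleGraph.green_root]; exact Even.zero
    -- The common part of the two paths ends at the meet, which is the root or a branch vertex; both
    -- have even height.
    obtain ⟨w, hw, hcut⟩ := hX.exists_meet_of_leaf (fun h => hst (Subtype.ext h)) hs ht'
      (hleaf s s.2) (hleaf t t.2)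
    rw [SimpleGraph.green_eq_height_of_meet _ _ hcut]
    rcases hw with rfl | hw
    · rw [SimpleGraph.height_root]; exact Even.zero
    · exact heven t t.2 ((isOddPt_markedPerm t).1 ht) w hw
  nondeg w hw h := by
    classical
    have := Fintype.ofFinite V
    let W : V → ℤ := fun v => if hv : v ∈ X.S.verts then w ⟨v, hv⟩ else 0
    have hW : ∀ s : X.S.verts, W s = w s := fun s => dif_pos s.2
    ext s
    by_cases hs : IsOddPt X.markedPerm s
    · exact hw s hs
    have hs' := mt (isOddPt_markedPerm s).2 hs
    rw [← hW]
    refine hX.green_nondegenerate (wt := X.evenLen) (r := r) ?_ ?_ ?_ ?_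
    · intro e _
      unfold evenLen
      split_ifs <;> positivity
    · intro t ht
      have htS : t ∈ X.S.verts := by
        by_contra h'
        exact ht (dif_neg h')
      have h2 := h ⟨t, htS⟩ fun h' => ht (by rw [hW ⟨t, htS⟩]; exact hw _ h')
      rw [← h2, ← Finset.sum_subset (Finset.subset_univ X.S.verts.toFinset),
        ← Finset.sum_coe_sort]
      · refine Fintype.sum_equiv (Equiv.subtypeEquivRight fun v => Set.mem_toFinset) _ _ fun v => ?_
        exact congrArg (· * _) (dif_pos (Set.mem_toFinset.1 v.2))
      · intro v _ hv
        have : W v = 0 := dif_neg (fun h => hv (Set.mem_toFinset.2 h))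
        rw [this, zero_mul]
    · rintro hsr
      exact hs' ⟨1, odd_one, by rw [hsr]; exact hr⟩
    · intro u hu
      -- The edges at a point of even period lie in even orbits and keep their positive length, as
      -- nondegeneracy at that point requires.
      have ho : ¬ X.OddEdge s(u, s) := fun ho => by
        obtain ⟨k, hk, -, h3⟩ := fixed_of_oddEdge hinv hu ho
        exact hs' ⟨k, hk, h3⟩
      rw [evenLen, if_neg ho]
      exact_mod_cast X.len_pos _ hu

end BYPair

theorem iterOrbit_eq_iff {α : Type*} [Finite α] {f : α → α} (hf : f.Injective) (a b : α) :
    iterOrbit f a = iterOrbit f b ↔ ∃ k, f^[k] a = b := by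
  constructor
  · intro h
    have : b ∈ iterOrbit f a := h ▸ ⟨0, rfl⟩
    exact this
  · rintro ⟨k, rfl⟩
    obtain ⟨P, hP, hper⟩ := hf.mem_periodicPts a
    refine Set.Subset.antisymm ?_ ?_
    · rintro _ ⟨n, rfl⟩
      refine ⟨n + k * (P - 1), ?_⟩
      change f^[n + k * (P - 1)] (f^[k] a) = f^[n] a
      have h1 : k * (P - 1) + k = k * P := by
        obtain ⟨m, rfl⟩ := Nat.exists_eq_add_of_lt hP
        simp only [zero_add, Nat.add_sub_cancel]; ring
      rw [← Function.iterate_add_apply, add_assoc, h1, Function.iterate_add_apply, hper.const_mul k]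
    · rintro _ ⟨n, rfl⟩
      exact ⟨n + k, Function.iterate_add_apply f n k a⟩

/-! ### A fixed branch vertex -/

namespace SimpleGraph

variable {V : Type*} [Finite V] {G : SimpleGraph V}

/-- If an automorphism of odd order on a leaf `s` acts without inversions on a tree which is not a
path, then it fixes a vertex of degree at least three. -/
theorem IsTree.exists_fixed_branch (hG : G.IsTree) (F : G ≃g G)
    (hF : ∀ u v, G.Adj u v → F u = v → F v ≠ u) {s b : V} (hs : IsOddPt F s)
    (hleaf : ∀ u v, G.Adj s u → G.Adj s v → u = v) (hb : 3 ≤ (G.neighborSet b).ncard) :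
    ∃ r, F r = r ∧ 3 ≤ (G.neighborSet r).ncard := by
  classical
  have := Fintype.ofFinite V
  -- Take the fixed vertex nearest to `b`. The next vertex towards `b` is moved by `F`, so it and
  -- its image are two neighbours of `r`.
  obtain ⟨r, hr, hmin⟩ := Set.exists_min_image {v | F v = v} (G.dist · b) (Set.toFinite _)
    (hG.exists_fixed F hF)
  have hr : F r = r := hr
  by_cases hrb : r = b
  · exact ⟨r, hr, hrb ▸ hb⟩
  refine ⟨r, hr, ?_⟩
  obtain ⟨w, hw⟩ := hG.1.exists_walk_length_eq_dist r b
  cases w with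
  | nil => exact absurd rfl hrb
  | @cons _ v _ h w =>
    have hlt : G.dist v b < G.dist r b := by
      rw [← hw, Walk.length_cons]
      exact Nat.lt_succ_of_le (dist_le w)
    have hv : F v ≠ v := fun hv => absurd (hmin v hv) (not_le.2 hlt)
    have h' : G.Adj r (F v) := by
      have := F.map_adj_iff.2 h
      rwa [hr] at this
    have hsr : s ≠ r := by
      rintro rfl
      exact hv (hleaf _ _ h' h)
    obtain ⟨u, hu, hc⟩ := hG.exists_adj_cut_ne r hsr
    rw [cut_root] at hc
    have hc1 := (cut_eq_zero_or_one _ _ _).resolve_left (Ne.symm hc)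
    obtain ⟨k, hk, hks⟩ := hs
    obtain ⟨φ, hφ⟩ := exists_iso_iterate F k
    have hfix := (hG.fixed_of_cut_eq_one φ ((hφ r).trans (Function.iterate_fixed hr k))
      ((hφ s).trans hks) hu hc1).2
    rw [hφ] at hfix
    -- If there were no third neighbour, `F` would exchange these two. But one of them leads to `s`
    -- and is fixed by an odd iterate.
    by_contra hdeg
    have hsub : ∀ x, G.Adj r x → x = v ∨ x = F v := fun x hx => by
      by_contra! hne
      refine hdeg ?_
      have h3 : ({x, v, F v} : Set V).ncard = 3 :=
        Set.ncard_eq_three.2 ⟨x, v, F v, hne.1, hne.2, hv.symm, rfl⟩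
      rw [← h3]
      refine Set.ncard_le_ncard ?_ (Set.toFinite _)
      rintro y (rfl | rfl | rfl)
      exacts [hx, h, h']
    have hFF : F (F v) = v := by
      have h2 := F.map_adj_iff.2 h'
      rw [hr] at h2
      exact (hsub _ h2).resolve_right fun h3 => hv (F.injective h3)
    have hu2 : F (F u) = u ∧ F u ≠ u := by
      rcases hsub u hu with rfl | rfl
      · exact ⟨hFF, hv⟩
      · exact ⟨congrArg F hFF, fun h => hv (F.injective h)⟩
    obtain ⟨m, rfl⟩ := hk
    have h2m : F^[2 * m] u = u := by
      have h2 : Function.IsPeriodicPt F 2 u := hu2.1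
      exact h2.mul_const m
    have h1 := (Function.iterate_succ_apply' F (2 * m) u).symm.trans hfix
    rw [h2m] at h1
    exact hu2.2 h1

end SimpleGraph

namespace BYGraph

variable {V : Type*} [Finite V] {T : BYGraph V}

open Classical in
/-- The Tamagawa number of a negative tree on which no edge is inverted. -/
theorem tamagawa_eq_mul_prime (hT : T.graph.IsTree) (hS : ∀ u v, ¬ T.S.Adj u v)
    (hε : ∀ C, T.sign C = -1) (hinv : ∀ e, ¬ T.IsInverted e)
    (hleaf : ∀ s ∈ T.S.verts, ∀ u v, T.graph.Adj s u → T.graph.Adj s v → u = v)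
    (hne : T.S.verts.Nonempty) {b : V} (hb : 3 ≤ T.deg b) {p : V → ZMod 2} (hp : T.IsParity p)
    {q : ZMod 2} (hq : ∀ w, 3 ≤ T.deg w → p w = q) {A : Set (Set V)}
    (hA : A = {o | ∃ s ∈ T.S.verts, IsOddPt T.F s ∧ p s = q ∧ o = iterOrbit T.F s}) :
    T.tamagawa = (if 1 ≤ A.ncard then 2 ^ (A.ncard - 1)
      else if Even T.S.verts.ncard then 2 else 1) * T.prime.tamagawa := by
  have := Fintype.ofFinite T.S.verts
  have : Nonempty T.S.verts := hne.to_subtype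
  have hF : ∀ u v, T.graph.Adj u v → T.F u = v → T.F v ≠ u := fun u v h h1 h2 =>
    hinv s(u, v) ⟨h, 1, u, v, rfl, h1, h2⟩
  -- The root must have the parity of the branch vertices only if some marked point has odd period.
  -- Otherwise the parity requirements are vacuous and any fixed vertex serves.
  obtain ⟨r, hr, hr3⟩ : ∃ r, T.F r = r ∧ ∀ s ∈ T.S.verts, IsOddPt T.F s → 3 ≤ T.deg r := by
    by_cases h : ∃ s ∈ T.S.verts, IsOddPt T.F s
    · obtain ⟨s, hs, hs'⟩ := h
      obtain ⟨r, hr, hr3⟩ := hT.exists_fixed_branch T.F hF hs' (hleaf s hs) hb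
      exact ⟨r, hr, fun _ _ _ => hr3⟩
    · obtain ⟨r, hr⟩ := hT.exists_fixed T.F hF
      exact ⟨r, hr, fun s hs hs' => absurd ⟨s, hs, hs'⟩ h⟩
  have hheight : ∀ w, Even (T.graph.height T.lenZ r w) ↔ p w = p r := fun w => by
    rw [← hp.even_dist_iff hT.1, ← Int.even_coe_nat, T.dist_eq_height hT]
    rfl
  have hdiag : ∀ w, Even (T.graph.green T.lenZ r w w) ↔ p w = p r := fun w => by
    rw [SimpleGraph.green_self, hheight]
  have hpair := BYPair.isGreenPair hT hinv hr hleaf fun s hs hs' w hw =>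
    (hheight w).2 ((hq w hw).trans (hq r (hr3 s hs hs')).symm)
  rw [tamagawa_eq_index hT hS hε r (j := fun s : T.S.verts => (s : V)) Subtype.val_injective
    Subtype.range_coe T.markedPerm fun _ => rfl, BYPair.prime_tamagawa hT hinv hr]
  have hunits : ((-1 : ℤˣ) : ℤ) = -1 := rfl
  rw [hunits, hpair.index_tamSub (orb := fun s : T.S.verts => iterOrbit T.F s) fun s t => ?_]
  · have hset : (fun s : T.S.verts => iterOrbit T.F s) '' {s | IsGreenPair.EvenDiag T.markedPerm
        (fun s t : T.S.verts => T.graph.green T.lenZ r s t) s} = A := by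
      rw [hA]
      ext o
      constructor
      · rintro ⟨s, ⟨h1, h2⟩, rfl⟩
        have h1 := (BYPair.isOddPt_markedPerm s).1 h1
        exact ⟨s, s.2, h1, ((hdiag s).1 h2).trans (hq r (hr3 s s.2 h1)), rfl⟩
      · rintro ⟨s, hs, h1, h2, rfl⟩
        refine ⟨⟨s, hs⟩, ⟨(BYPair.isOddPt_markedPerm _).2 h1, ?_⟩, rfl⟩
        exact (hdiag s).2 (h2.trans (hq r (hr3 s hs h1)).symm)
    rw [hset, ← Nat.card_eq_fintype_card, Nat.card_coe_set_eq]
  · rw [iterOrbit_eq_iff T.F.injective]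
    refine exists_congr fun k => ?_
    rw [← BYPair.markedPerm_iterate, Subtype.ext_iff]

end BYGraph

/-! ### Subdividing the inverted edges -/

namespace BYPair

variable {V : Type*} {X : BYPair V}

theorem subdivide_adj_inl {u v : V} (h : X.graph.Adj u v)
    (hm : ¬ (X.IsInverted s(u, v) ∧ Even (X.len s(u, v)))) :
    X.subdivide.graph.Adj (.inl u) (.inl v) := ⟨h, hm⟩

theorem subdivide_adj_inr {u : V} {m : X.Mid} (h : u ∈ m.1) :
    X.subdivide.graph.Adj (.inl u) (.inr m) := h

theorem subdivide_iterate_inl (u : V) (k : ℕ) :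
    X.subdivide.F^[k] (.inl u) = .inl (X.F^[k] u) := by
  induction k generalizing u with
  | zero => rfl
  | succ k ih => exact ih (X.F u)

theorem subdivide_connected (hX : X.graph.Connected) : X.subdivide.graph.Connected := by
  have hadj : ∀ u v, X.graph.Adj u v → X.subdivide.graph.Reachable (.inl u) (.inl v) := by
    intro u v h
    by_cases hm : X.IsInverted s(u, v) ∧ Even (X.len s(u, v))
    · exact (subdivide_adj_inr (m := ⟨s(u, v), hm⟩) (Sym2.mem_mk_left u v)).reachable.trans
        (subdivide_adj_inr (m := ⟨s(u, v), hm⟩) (Sym2.mem_mk_right u v)).reachable.symm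
    · exact (subdivide_adj_inl h hm).reachable
  have hinl : ∀ u v, X.subdivide.graph.Reachable (.inl u) (.inl v) := fun u v => by
    obtain ⟨p⟩ := hX.preconnected u v
    induction p with
    | nil => exact SimpleGraph.Reachable.refl _
    | cons h _ ih => exact (hadj _ _ h).trans ih
  obtain ⟨r⟩ := hX.nonempty
  have hr : ∀ a, X.subdivide.graph.Reachable a (.inl r) := by
    rintro (a | m)
    · exact hinl a r
    · exact (subdivide_adj_inr (Sym2.out_fst_mem m.1)).reachable.symm.trans (hinl _ r)
  have : Nonempty (V ⊕ X.Mid) := ⟨.inl r⟩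
  exact ⟨fun a b => (hr a).trans (hr b).symm⟩

open Classical in
/-- Extend a function on the vertices to the midpoints, with a given value at the midpoint
of `e`. -/
noncomputable def midExtend (X : BYPair V) (κ : V → ℤ) (e : Sym2 V) (c : ℤ) : V ⊕ X.Mid → ℤ :=
  Sum.elim κ fun m => if m.1 = e then c else κ (Quot.out m.1).1

theorem midExtend_self {κ : V → ℤ} {e : Sym2 V} {c : ℤ} {m : X.Mid} (hm : m.1 = e) :
    X.midExtend κ e c (.inr m) = c := if_pos hm

theorem midExtend_of_ne {κ : V → ℤ} {e : Sym2 V} {c : ℤ} {m : X.Mid} (hm : m.1 ≠ e) :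
    X.midExtend κ e c (.inr m) = κ (Quot.out m.1).1 := if_neg hm

theorem midExtend_eq {κ : V → ℤ} {e : Sym2 V} {c : ℤ}
    (hκ : ∀ a b, X.graph.Adj a b → s(a, b) ≠ e → κ a = κ b)
    {m : X.Mid} (hm : m.1 ≠ e) {x : V} (hx : x ∈ m.1) :
    X.midExtend κ e c (.inl x) = X.midExtend κ e c (.inr m) := by
  rw [midExtend_of_ne hm]
  change κ x = _
  have h1 := Sym2.out_fst_mem m.1
  by_cases h2 : x = (Quot.out m.1).1
  · rw [← h2]
  · have h3 : m.1 = s(x, (Quot.out m.1).1) := (Sym2.mem_and_mem_iff h2).1 ⟨hx, h1⟩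
    refine hκ _ _ ?_ (h3 ▸ hm)
    have := m.2.1.1
    rwa [h3] at this

variable [Finite V]

omit [Finite V] in
theorem subdivide_isTree (hX : X.graph.IsTree) : X.subdivide.graph.IsTree := by
  refine SimpleGraph.Connected.isTree_of_separating (subdivide_connected hX.1) ?_
  have key : ∀ (u : V) (m : X.Mid), u ∈ m.1 → ∃ f : V ⊕ X.Mid → ℤ, f (.inl u) ≠ f (.inr m) ∧
      ∀ a b, X.subdivide.graph.Adj a b → s(a, b) ≠ s(.inl u, .inr m) → f a = f b := by
    rintro u ⟨e, he⟩ hu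
    obtain ⟨v, rfl⟩ := hu
    have h : X.graph.Adj u v := he.1.1
    have hκ : ∀ a b, X.graph.Adj a b → s(a, b) ≠ s(u, v) →
        X.graph.cut u s(u, v) a = X.graph.cut u s(u, v) b :=
      fun a b hab hne => SimpleGraph.cut_eq_of_adj u hab hne
    have h1 := hX.cut_add_cut u h
    rw [SimpleGraph.cut_root, zero_add] at h1
    -- Rooted at `u`, the cut is `0` at `u` and `1` at `v`. The value `1` at the midpoint puts the
    -- jump on the half containing `u`.
    refine ⟨X.midExtend (X.graph.cut u s(u, v)) s(u, v) 1, ?_, ?_⟩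
    · rw [midExtend_self (m := ⟨s(u, v), he⟩) rfl]
      change X.graph.cut u s(u, v) u ≠ 1
      rw [SimpleGraph.cut_root]
      exact zero_ne_one
    · have hmix : ∀ (x : V) (m : X.Mid), x ∈ m.1 →
          s(Sum.inl x, Sum.inr m) ≠ s(Sum.inl u, Sum.inr ⟨s(u, v), he⟩) →
          X.midExtend (X.graph.cut u s(u, v)) s(u, v) 1 (.inl x) =
            X.midExtend (X.graph.cut u s(u, v)) s(u, v) 1 (.inr m) := by
        intro x m hx hne
        by_cases hm : m.1 = s(u, v)
        · rw [hm] at hx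
          rcases Sym2.mem_iff.1 hx with rfl | rfl
          · exact absurd (by rw [show m = ⟨s(x, v), he⟩ from Subtype.ext hm]) hne
          · rw [midExtend_self hm]
            exact h1
        · exact midExtend_eq hκ hm hx
      rintro (a | a) (b | b) hab hne
      · exact hκ a b hab.1 fun h' => hab.2 (h' ▸ he)
      · exact hmix a b hab hne
      · exact (hmix b a hab (by rwa [Sym2.eq_swap])).symm
      · exact hab.elim
  rintro (u | u) (v | v) h
  · have hκ : ∀ a b, X.graph.Adj a b → s(a, b) ≠ s(u, v) →
        X.graph.cut u s(u, v) a = X.graph.cut u s(u, v) b :=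
      fun a b hab hne => SimpleGraph.cut_eq_of_adj u hab hne
    have hmid : ∀ m : X.Mid, m.1 ≠ s(u, v) := fun m hm => h.2 (hm ▸ m.2)
    refine ⟨X.midExtend (X.graph.cut u s(u, v)) s(u, v) 0, hX.cut_ne u h.1, ?_⟩
    rintro (a | a) (b | b) hab hne
    · exact hκ a b hab.1 fun h' => hne (by
        have := congrArg (Sym2.map (Sum.inl : V → V ⊕ X.Mid)) h'
        exact this)
    · exact midExtend_eq hκ (hmid b) hab
    · exact (midExtend_eq hκ (hmid a) hab).symm
    · exact hab.elim
  · exact key u v h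
  · obtain ⟨f, hf1, hf2⟩ := key v u h
    exact ⟨f, hf1.symm, fun a b hab hne => hf2 a b hab (by rwa [Sym2.eq_swap (a := Sum.inl v)])⟩
  · exact h.elim

omit [Finite V] in
/-- A cut of the subdivided tree does not separate the ends of an edge disjoint from it. -/
theorem subdivide_cut_eq (r : V) {e : Sym2 (V ⊕ X.Mid)} {a b : V} (h : X.graph.Adj a b)
    (h1 : s(.inl a, .inl b) ≠ e)
    (h2 : ∀ m : X.Mid, m.1 = s(a, b) → s(.inl a, .inr m) ≠ e ∧ s(.inl b, .inr m) ≠ e) :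
    X.subdivide.graph.cut (.inl r) e (.inl a) = X.subdivide.graph.cut (.inl r) e (.inl b) := by
  by_cases hm : X.IsInverted s(a, b) ∧ Even (X.len s(a, b))
  · obtain ⟨h3, h4⟩ := h2 ⟨_, hm⟩ rfl
    exact (SimpleGraph.cut_eq_of_adj _ (subdivide_adj_inr (Sym2.mem_mk_left a b)) h3).trans
      (SimpleGraph.cut_eq_of_adj _ (subdivide_adj_inr (Sym2.mem_mk_right a b)) h4).symm
  · exact SimpleGraph.cut_eq_of_adj _ (subdivide_adj_inl h hm) h1

omit [Finite V] in
theorem subdivide_cut_inl (hX : X.graph.IsTree) (r : V) {u v : V} (h : X.graph.Adj u v)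
    (hm : ¬ (X.IsInverted s(u, v) ∧ Even (X.len s(u, v)))) (x : V) :
    X.subdivide.graph.cut (.inl r) s(.inl u, .inl v) (.inl x) = X.graph.cut r s(u, v) x := by
  refine hX.eq_cut (f := fun x => X.subdivide.graph.cut (.inl r) s(.inl u, .inl v) (.inl x)) h
    (SimpleGraph.cut_root _ _) (fun a b hab hne => ?_)
    ((subdivide_isTree hX).cut_add_cut _ (subdivide_adj_inl h hm)) x
  refine subdivide_cut_eq r hab (fun h' => hne ?_) fun m _ => ⟨by simp, by simp⟩
  exact Sym2.map.injective (f := (Sum.inl : V → V ⊕ X.Mid)) Sum.inl_injective h'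

omit [Finite V] in
-- On the old vertices either half of an edge induces the cut of the whole edge; the two cuts differ
-- only at the midpoint.
theorem subdivide_cut_inr (hX : X.graph.IsTree) (r : V) {u v : V} {m : X.Mid}
    (hm : m.1 = s(u, v)) (x : V) :
    X.subdivide.graph.cut (.inl r) s(.inl u, .inr m) (.inl x) = X.graph.cut r s(u, v) x := by
  have h : X.graph.Adj u v := by
    have := m.2.1.1
    rwa [hm] at this
  have hu : X.subdivide.graph.Adj (.inl u) (.inr m) :=
    subdivide_adj_inr (hm ▸ Sym2.mem_mk_left u v)
  have hv : X.subdivide.graph.Adj (.inl v) (.inr m) :=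
    subdivide_adj_inr (hm ▸ Sym2.mem_mk_right u v)
  refine hX.eq_cut (f := fun x => X.subdivide.graph.cut (.inl r) s(.inl u, .inr m) (.inl x)) h
    (SimpleGraph.cut_root _ _) (fun a b hab hne => ?_) ?_ x
  · refine subdivide_cut_eq r hab (by simp) fun m' hm' => ?_
    have : m' ≠ m := fun h' => hne (by rw [← hm', h', hm])
    exact ⟨by simp [this], by simp [this]⟩
  · have h1 := SimpleGraph.cut_eq_of_adj (.inl r) hv (e := s(.inl u, .inr m))
      (by simp [h.ne.symm])
    change _ + X.subdivide.graph.cut (.inl r) s(.inl u, .inr m) (.inl v) = 1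
    rw [h1]
    exact (subdivide_isTree hX).cut_add_cut _ hu

/-- The increments over the two halves add up to the increment over the edge, because the value at
the midpoint cancels and the even length is halved exactly. -/
theorem subdivide_green (hX : X.graph.IsTree) (r s t : V) :
    X.subdivide.graph.green X.subdivide.lenZ (.inl r) (.inl s) (.inl t) =
      X.graph.green X.lenZ r s t := by
  refine hX.eq_green (f := fun t => X.subdivide.graph.green X.subdivide.lenZ (.inl r) (.inl s)
    (.inl t)) (SimpleGraph.green_root _ _ _) (fun u v h => ?_) t
  by_cases hm : X.IsInverted s(u, v) ∧ Even (X.len s(u, v))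
  · have hu : X.subdivide.graph.Adj (.inl u) (.inr ⟨s(u, v), hm⟩) :=
      subdivide_adj_inr (Sym2.mem_mk_left u v)
    have hv : X.subdivide.graph.Adj (.inl v) (.inr ⟨s(u, v), hm⟩) :=
      subdivide_adj_inr (Sym2.mem_mk_right u v)
    have h1 := SimpleGraph.green_sub X.subdivide.lenZ (.inl r) (.inl s) hu
    have h2 := SimpleGraph.green_sub X.subdivide.lenZ (.inl r) (.inl s) hv
    have h3 := (subdivide_isTree hX).cut_add_cut (.inl r) hu
    have h4 := (subdivide_isTree hX).cut_add_cut (.inl r) hv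
    have h5 := hX.cut_add_cut r h
    have hsw : (⟨s(u, v), hm⟩ : X.Mid).1 = s(v, u) := Sym2.eq_swap
    rw [subdivide_cut_inr hX r (m := ⟨s(u, v), hm⟩) rfl] at h1 h3
    rw [subdivide_cut_inr hX r (m := ⟨s(u, v), hm⟩) rfl] at h1
    rw [subdivide_cut_inr hX r hsw, Sym2.eq_swap (a := v) (b := u)] at h2 h4
    rw [subdivide_cut_inr hX r hsw, Sym2.eq_swap (a := v) (b := u)] at h2
    have hl1 : X.subdivide.lenZ s(.inl u, .inr ⟨s(u, v), hm⟩) = (X.len s(u, v) / 2 : ℕ) := rfl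
    have hl2 : X.subdivide.lenZ s(.inl v, .inr ⟨s(u, v), hm⟩) = (X.len s(u, v) / 2 : ℕ) := rfl
    have hl : X.lenZ s(u, v) = 2 * ((X.len s(u, v) / 2 : ℕ) : ℤ) := by
      rw [lenZ]
      exact_mod_cast (Nat.two_mul_div_two_of_even hm.2).symm
    rw [hl1] at h1
    rw [hl2] at h2
    rw [hl]
    have h3' := eq_sub_of_add_eq' h3
    have h4' := eq_sub_of_add_eq' h4
    rw [h3'] at h1
    rw [h4'] at h2
    linear_combination h1 - h2
  · have h1 := SimpleGraph.green_sub X.subdivide.lenZ (.inl r) (.inl s) (subdivide_adj_inl h hm)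
    rwa [subdivide_cut_inl hX r h hm, subdivide_cut_inl hX r h hm,
      subdivide_cut_inl hX r h hm] at h1

omit [Finite V] in
-- By (B) every inverted old edge has even length and has been subdivided. A half-edge joins an old
-- vertex to a midpoint, and `F` preserves both kinds.
theorem subdivide_not_isInverted (hB : X.ParityB) (e : Sym2 (V ⊕ X.Mid)) :
    ¬ X.subdivide.IsInverted e := by
  rintro ⟨he, n, a, b, rfl, h1, h2⟩
  rcases a with u | m <;> rcases b with v | m'
  · rw [subdivide_iterate_inl] at h1 h2
    have hinv : X.IsInverted s(u, v) :=
      ⟨he.1, n, u, v, rfl, Sum.inl_injective h1, Sum.inl_injective h2⟩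
    exact he.2 ⟨hinv, Nat.not_odd_iff_even.1 (hB _ hinv)⟩
  · rw [subdivide_iterate_inl] at h1
    exact Sum.inl_ne_inr h1
  · rw [subdivide_iterate_inl] at h2
    exact Sum.inl_ne_inr h2
  · exact he.elim

omit [Finite V] in
theorem subdivide_isParity {p : V → ZMod 2} (hp : X.IsParity p) :
    X.subdivide.IsParity (Sum.elim p fun m => p (Quot.out m.1).1 + (X.len m.1 / 2 : ℕ)) := by
  -- The ends of an inverted edge have equal parity since its length is even, so it does not matter
  -- which end defines the value at the midpoint.
  have key : ∀ (u : V) (m : X.Mid), u ∈ m.1 →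
      p u = p (Quot.out m.1).1 := fun u m hu => by
    have h1 := Sym2.out_fst_mem m.1
    by_cases h2 : u = (Quot.out m.1).1
    · rw [← h2]
    · have h3 : m.1 = s(u, (Quot.out m.1).1) := (Sym2.mem_and_mem_iff h2).1 ⟨hu, h1⟩
      have h4 : X.graph.Adj u (Quot.out m.1).1 := by
        have := m.2.1.1
        rwa [h3] at this
      rw [hp _ _ h4, ← h3, (ZMod.natCast_eq_zero_iff_even).2 m.2.2, zero_add]
  rintro (u | m) (v | m') h
  · exact hp u v h.1
  · change p u = ((X.len m'.1 / 2 : ℕ) : ZMod 2) + (p (Quot.out m'.1).1 + (X.len m'.1 / 2 : ℕ))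
    rw [key u m' h, add_left_comm, CharTwo.add_self_eq_zero, add_zero]
  · change p (Quot.out m.1).1 + (X.len m.1 / 2 : ℕ) = ((X.len m.1 / 2 : ℕ) : ZMod 2) + p v
    rw [key v m h, add_comm]
  · exact h.elim

open Classical in
/-- The neighbour of `u` in the subdivided graph in the direction of the neighbour `v`. -/
noncomputable def subdivideNeighbor (X : BYPair V) (u v : V) : V ⊕ X.Mid :=
  if h : X.IsInverted s(u, v) ∧ Even (X.len s(u, v)) then .inr ⟨s(u, v), h⟩ else .inl v

omit [Finite V] in
theorem subdivideNeighbor_injective (u : V) : (X.subdivideNeighbor u).Injective := by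
  intro v w h
  unfold subdivideNeighbor at h
  split_ifs at h with h1 h2 h2
  · exact Sym2.congr_right.1 (congrArg Subtype.val (Sum.inr_injective h))
  · exact Sum.inl_injective h

omit [Finite V] in
theorem subdivide_neighborSet (u : V) :
    X.subdivide.graph.neighborSet (.inl u) = X.subdivideNeighbor u '' X.graph.neighborSet u := by
  ext a
  constructor
  · rcases a with v | ⟨e, he⟩
    · intro h
      exact ⟨v, h.1, dif_neg h.2⟩
    · rintro ⟨v, rfl⟩
      exact ⟨v, he.1.1, dif_pos he⟩
  · rintro ⟨v, hv, rfl⟩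
    unfold subdivideNeighbor
    split_ifs with h
    · exact Sym2.mem_mk_left u v
    · exact ⟨hv, h⟩

omit [Finite V] in
theorem subdivide_deg (u : V) : X.subdivide.deg (.inl u) = X.deg u := by
  rw [deg, subdivide_neighborSet, Set.ncard_image_of_injective _ (subdivideNeighbor_injective u)]
  rfl

omit [Finite V] in
theorem subdivide_deg_inr (m : X.Mid) : X.subdivide.deg (.inr m) ≤ 2 := by
  obtain ⟨e, he⟩ := m
  induction e with | _ u v =>
  have h : X.subdivide.graph.neighborSet (.inr ⟨s(u, v), he⟩) ⊆ {.inl u, .inl v} := by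
    rintro (a | a) ha
    · rcases Sym2.mem_iff.1 (show a ∈ s(u, v) from ha) with rfl | rfl
      · exact Or.inl rfl
      · exact Or.inr rfl
    · exact ha.elim
  exact (Set.ncard_le_ncard h (Set.toFinite _)).trans (Set.ncard_insert_le _ _ |>.trans (by simp))

omit [Finite V] in
theorem subdivide_not_adj (hS : ∀ u v, ¬ X.S.Adj u v) (a b : V ⊕ X.Mid) :
    ¬ X.subdivide.S.Adj a b := by
  have h : ∀ e, e ∉ X.S.edgeSet := fun e he => by
    induction e with | _ u v => exact hS u v he
  rcases a with u | m <;> rcases b with v | m'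
  · exact fun h' => hS u v h'.1
  · exact fun h' => h _ h'.2
  · exact fun h' => h _ h'.2
  · exact id

omit [Finite V] in
theorem subdivide_verts (hS : ∀ u v, ¬ X.S.Adj u v) :
    X.subdivide.S.verts = Sum.inl '' X.S.verts := by
  ext a
  rcases a with u | ⟨e, he⟩
  · exact ⟨fun h => ⟨u, h, rfl⟩, fun ⟨_, h, h'⟩ => Sum.inl_injective h' ▸ h⟩
  · refine ⟨fun h => ?_, fun ⟨_, _, h⟩ => absurd h Sum.inl_ne_inr⟩
    induction e with | _ u v => exact absurd h (hS u v)

omit [Finite V] in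
theorem subdivide_isOddPt (u : V) : IsOddPt X.subdivide.F (.inl u) ↔ IsOddPt X.F u := by
  refine exists_congr fun k => and_congr_right fun _ => ?_
  rw [subdivide_iterate_inl, Sum.inl_injective.eq_iff]

omit [Finite V] in
theorem subdivide_iterOrbit (u : V) :
    iterOrbit X.subdivide.F (.inl u) = Sum.inl '' iterOrbit X.F u := by
  unfold iterOrbit
  rw [← Set.range_comp]
  exact congrArg Set.range (funext fun k => subdivide_iterate_inl u k)

end BYPair

namespace BYGraph

variable {V : Type*} [Finite V] {T : BYGraph V}

/-- Subdividing the inverted edges does not change the Tamagawa number. -/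
theorem tamagawa_subdivide (hT : T.graph.IsTree) (hS : ∀ u v, ¬ T.S.Adj u v)
    (hε : ∀ C, T.sign C = -1) :
    T.tamagawa = ({ T.subdivide with sign := fun _ => -1 } : BYGraph (V ⊕ T.Mid)).tamagawa := by
  have := Fintype.ofFinite T.S.verts
  obtain ⟨r⟩ := hT.1.nonempty
  rw [tamagawa_eq_index hT hS hε r (j := fun s : T.S.verts => (s : V)) Subtype.val_injective
    Subtype.range_coe T.markedPerm fun _ => rfl,
    tamagawa_eq_index (T := { T.subdivide with sign := fun _ => -1 }) (ε := -1)
      (BYPair.subdivide_isTree hT) (BYPair.subdivide_not_adj hS) (fun _ => rfl) (.inl r)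
      (j := fun s : T.S.verts => (.inl (s : V) : V ⊕ T.Mid))
      (Sum.inl_injective.comp Subtype.val_injective) ?_ T.markedPerm fun _ => rfl]
  · congr 2
    funext s t
    exact (BYPair.subdivide_green hT r s t).symm
  · refine Eq.trans ?_ (BYPair.subdivide_verts hS).symm
    ext a
    simp

end BYGraph


/-! ### Parity condition (A) and assembly -/

namespace BYGraph

variable {V : Type*} [Finite V] {T : BYGraph V}

omit [Finite V] in
/-- Under condition (A) all vertices of degree at least three have the same parity. -/
theorem parity_eq_of_parityA (hT : T.graph.Connected) (hA : T.ParityA) {p : V → ZMod 2}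
    (hp : T.IsParity p) {u v : V} (hu : 3 ≤ T.deg u) (hv : 3 ≤ T.deg v) : p u = p v := by
  rw [← hp.even_dist_iff hT, ← Nat.not_odd_iff_even]
  intro h
  -- All exceptions allowed by (A) have degree one or two.
  obtain ⟨w, hw, hw'⟩ := hA u v h
  have h3 : 3 ≤ T.deg w := by rcases hw with rfl | rfl <;> assumption
  rcases hw' with ⟨h1, -⟩ | ⟨h1, -⟩ | ⟨h1, -⟩ <;> omega

omit [Finite V] in
-- All branch vertices have the same parity, so the nearest one decides nothing special; `b`
-- guarantees that the infimum is attained.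
theorem not_oddTwig_iff (hT : T.graph.Connected) {p : V → ZMod 2} (hp : T.IsParity p) {q : ZMod 2}
    (hq : ∀ w, 3 ≤ T.deg w → p w = q) {b : V} (hb : 3 ≤ T.deg b) (s : V) :
    ¬ T.OddTwig s ↔ p s = q := by
  obtain ⟨w, hw, hd⟩ := Nat.sInf_mem (s := {n | ∃ w, 3 ≤ T.deg w ∧ T.dist s w = n}) ⟨_, b, hb, rfl⟩
  rw [BYPair.OddTwig, ← hd, Nat.not_odd_iff_even, hp.even_dist_iff hT, hq w hw]

theorem A0_eq (hT : T.graph.Connected) {p : V → ZMod 2} (hp : T.IsParity p) {q : ZMod 2}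
    (hq : ∀ w, 3 ≤ T.deg w → p w = q) {b : V} (hb : 3 ≤ T.deg b) :
    T.A0 = {o | ∃ s ∈ T.S.verts, IsOddPt T.F s ∧ p s = q ∧ o = iterOrbit T.F s} := by
  ext o
  refine exists_congr fun s => and_congr_right fun _ => ?_
  rw [BYPair.oddVertex_iff, not_oddTwig_iff hT hp hq hb]

theorem tamagawa_eq_c1_mul (hT : T.graph.IsTree) (hSimple : T.IsSimple)
    (hNeg : ∀ C, T.sign C = -1) (hA : T.ParityA) {b : V} (hb : 3 ≤ T.deg b)
    (hinv : ∀ e, ¬ T.IsInverted e) : T.tamagawa = T.c1 * T.prime.tamagawa := by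
  have hp := T.isParity_height hT b
  have hq := fun w (hw : 3 ≤ T.deg w) => parity_eq_of_parityA hT.1 hA hp hw hb
  exact tamagawa_eq_mul_prime hT hSimple.1 hNeg hinv (fun s hs u v => hSimple.eq_of_adj hT hs)
    hSimple.2.1 hb hp hq (A0_eq hT.1 hp hq hb)

/-- Condition (A) is needed for `T` alone. The parity extends to the midpoints, which have degree at
most two, so the branch vertices and the orbits in `A0` are unchanged. -/
theorem tamagawa_eq_c1_mul_subdivide (hT : T.graph.IsTree) (hSimple : T.IsSimple)
    (hNeg : ∀ C, T.sign C = -1) (hA : T.ParityA) (hB : T.ParityB) {b : V} (hb : 3 ≤ T.deg b) :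
    T.tamagawa = T.c1 * T.subdivide.prime.tamagawa := by
  obtain ⟨p, hp⟩ : ∃ p, T.IsParity p := ⟨_, T.isParity_height hT b⟩
  have hq : ∀ w, 3 ≤ T.deg w → p w = p b := fun w hw => parity_eq_of_parityA hT.1 hA hp hw hb
  have hA0 := A0_eq hT.1 hp hq hb
  have hverts := BYPair.subdivide_verts (X := T.toBYPair) hSimple.1
  have hinj := Set.image_injective.2 (Sum.inl_injective (α := V) (β := T.Mid))
  rw [tamagawa_subdivide hT hSimple.1 hNeg,
    tamagawa_eq_mul_prime (T := { T.subdivide with sign := fun _ => -1 })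
      (BYPair.subdivide_isTree hT) (BYPair.subdivide_not_adj hSimple.1) (fun _ => rfl) (BYPair.subdivide_not_isInverted hB)
      ?_ ?_ (b := .inl b) ?_ (BYPair.subdivide_isParity hp) (q := p b) ?_
      (A := Set.image Sum.inl '' T.A0) ?_]
  · congr 1
    rw [BYPair.c1, Set.ncard_image_of_injective _ hinj]
    change (if _ then _ else if Even T.subdivide.S.verts.ncard then 2 else 1) = _
    rw [hverts, Set.ncard_image_of_injective _ Sum.inl_injective]
  · intro a ha
    change a ∈ T.subdivide.S.verts at ha
    rw [hverts] at ha
    obtain ⟨s, hs, rfl⟩ := ha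
    intro u v hu hv
    change u ∈ T.subdivide.graph.neighborSet (.inl s) at hu
    change v ∈ T.subdivide.graph.neighborSet (.inl s) at hv
    rw [BYPair.subdivide_neighborSet] at hu hv
    obtain ⟨u, hu, rfl⟩ := hu
    obtain ⟨v, hv, rfl⟩ := hv
    rw [hSimple.eq_of_adj hT hs hu hv]
  · change T.subdivide.S.verts.Nonempty
    rw [hverts]
    exact hSimple.2.1.image _
  · exact hb.trans_eq (BYPair.subdivide_deg b).symm
  · rintro (w | m) hw
    · exact hq w (hw.trans_eq (BYPair.subdivide_deg w))
    · exact absurd (hw.trans (BYPair.subdivide_deg_inr m)) (by norm_num)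
  · rw [hA0]
    ext o
    constructor
    · rintro ⟨_, ⟨s, hs, h1, h2, rfl⟩, rfl⟩
      exact ⟨.inl s, hs, (BYPair.subdivide_isOddPt s).2 h1, h2,
        (BYPair.subdivide_iterOrbit s).symm⟩
    · rintro ⟨a, ha, h1, h2, rfl⟩
      change a ∈ T.subdivide.S.verts at ha
      rw [hverts] at ha
      obtain ⟨s, hs, rfl⟩ := ha
      exact ⟨_, ⟨s, hs, (BYPair.subdivide_isOddPt s).1 h1, h2, rfl⟩,
        (BYPair.subdivide_iterOrbit s).symm⟩

end BYGraph

theorem BYPair.prime_isTree_of_not_isInverted {V : Type*} [Finite V] {X : BYPair V}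
    (hX : X.graph.IsTree) (hinv : ∀ e, ¬ X.IsInverted e) :
    X.prime.HasUniqueFixedPoint ∧ X.prime.graph.IsTree ∧ X.prime.ParityB := by
  obtain ⟨r, hr⟩ := hX.exists_fixed X.F fun u v h h1 h2 => hinv s(u, v) ⟨h, 1, u, v, rfl, h1, h2⟩
  exact ⟨prime_hasUniqueFixedPoint hX hinv hr, prime_isTree hX hinv hr, prime_parityB hX hinv hr⟩

/-- The case without inverted edges is also given for `T.prime` itself, because the subdivision
lives on `V ⊕ T.Mid` even when there are no midpoints. -/
theorem mainTheorem4 {V : Type*} [Finite V] (T : BYGraph V)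
    (hTree : T.graph.IsTree) (hSimple : T.IsSimple) (hNeg : ∀ C, T.sign C = -1)
    (hA : T.ParityA) (hB : T.ParityB) :
    -- `T` is not a path
    ((∃ v, 3 ≤ T.deg v) →
      (T.subdivide.prime.HasUniqueFixedPoint ∧ T.subdivide.prime.graph.IsTree ∧
        T.subdivide.prime.ParityB ∧
        T.tamagawa = T.c1 * T.subdivide.prime.tamagawa) ∧
      ((∀ e, ¬ T.IsInverted e) →
        T.prime.HasUniqueFixedPoint ∧ T.prime.graph.IsTree ∧ T.prime.ParityB ∧
        T.tamagawa = T.c1 * T.prime.tamagawa)) ∧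
    (T.S.verts.ncard = 1 → T.tamagawa = 1) ∧
    -- `T` is a path connecting two points of `S`
    (∀ x y, x ≠ y → T.S.verts = {x, y} → (∀ v, T.deg v ≤ 2) →
      ((∀ v, T.F v = v) → Even (T.dist x y) → T.tamagawa = 2) ∧
      ((∀ v, T.F v = v) → Odd (T.dist x y) → T.tamagawa = 1) ∧
      (T.F x = y → T.tamagawa = T.dist x y)) := by
  refine ⟨fun ⟨b, hb⟩ => ⟨?_, fun hinv => ?_⟩, ?_, ?_⟩
  · obtain ⟨h1, h2, h3⟩ := BYPair.prime_isTree_of_not_isInverted (BYPair.subdivide_isTree hTree)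
      (BYPair.subdivide_not_isInverted hB)
    exact ⟨h1, h2, h3, BYGraph.tamagawa_eq_c1_mul_subdivide hTree hSimple hNeg hA hB hb⟩
  · obtain ⟨h1, h2, h3⟩ := BYPair.prime_isTree_of_not_isInverted hTree hinv
    exact ⟨h1, h2, h3, BYGraph.tamagawa_eq_c1_mul hTree hSimple hNeg hA hb hinv⟩
  · exact BYGraph.tamagawa_of_card_eq_one hTree hSimple.1 hNeg
  · intro x y hxy h _
    refine ⟨fun hF he => ?_, fun hF ho => ?_, fun hF => ?_⟩
    · rw [BYGraph.tamagawa_path_fixed hTree hSimple.1 hNeg hxy h hF, if_pos he]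
    · rw [BYGraph.tamagawa_path_fixed hTree hSimple.1 hNeg hxy h hF,
        if_neg (Nat.not_even_iff_odd.2 ho)]
    · exact BYGraph.tamagawa_path_reversed hTree hSimple.1 hNeg hxy h hF
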